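/- **Setting.** Let $\langle x\rangle=(1+|x|^2)^{1/2}$, $P=-i\nabla$, and let $\sigma=(\sigma_1,\sigma_2,\sigma_3)$ be the Pauli matrices $\sigma_1=\begin{bmatrix}0&1\\1&0\end{bmatrix}$, $\sigma_2=\begin{bmatrix}0&-i\\i&0\end{bmatrix}$, $\sigma_3=\begin{bmatrix}1&0\\0&-1\end{bmatrix}$. For $k,s\in\mathbb R$ let $H^{k,s}$ be the completion of the Schwartz space $\mathcal S(\mathbb R^3;\mathbb C^2)$ in the norm $\|u\|_{H^{k,s}}=\|\langle x\rangle^{s}(1-\Delta)^{k/2}u\|_{L^2}$, realized as a space of tempered distributions, and let $\mathscr B(k,s;k',s')$ be the bounded operators from $H^{k,s}$ to $H^{k',s'}$ with the operator norm. For $s_1\le s_2$ one has $H^{k,s_2}\hookrightarrow H^{k,s_1}$. Let $\beta>5$. Let $V\colon\mathbb R^3\to\mathbb R$ be measurable with $|V(x)|\lesssim\langle x\rangle^{-\beta}$. Let $B\in C^1(\mathbb R^3;\mathbb R^3)$ with $\nabla\cdot B=0$ and $|B(x)|\lesssim\langle x\rangle^{-\beta-1}$, and let $A\in C^1(\mathbb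 R^3;\mathbb R^3)$ satisfy $\operatorname{curl}A=B$ and $|A(x)|\lesssim\langle x\rangle^{-\beta}$. The Pauli operator in $L^2(\mathbb R^3;\mathbb C^2)$ is $$H_P=(\sigma\cdot(P-A))^2+V=-\Delta+W_P,\qquad W_P=-P\cdot A-A\cdot P+|A|^2+V-\sigma\cdot B ,$$ with domain the set of $u\in H^{1,0}$ such that the distribution $H_Pu$ lies in $L^2$. Zero is a *regular point* of $H_P$ if $u=0$ is the only $u\in\bigcap_{r<-1/2}H^{1,r}$ with $H_Pu=0$ in the sense of distributions. For $j\ge0$ let $G_j$ be the operator, acting componentwise on $\mathbb C^2$-valued functions, with integral kernel $(-1)^j\frac{|x-y|^{j-1}}{4\pi\, j!}$, extended by continuity from Schwartz functions to the spaces $H^{-1,a}$ below. Write $R_P(\kappa)=(H_P+\kappa^2)^{-1}$ for $\operatorname{Re}\kappa>0$, $-\kappa^2\notin\sigma(H_P)$; the same symbol denotes its extension by continuity from $L^2\cap H^{-1,s}$ to $H^{-1,s}$. **Theorem.** Assume that zero is a regular point of $H_P$. There are operators \begin{align*} F_0&=(I+G_0W_P)^{-1}G_0\in\mathscr B(-1,s;1,-s),\quad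 s>1,\\ F_1&=(I+G_0W_P)^{-1}G_1(I+W_PG_0)^{-1}\in\mathscr B(-1,s;1,-s),\quad s>\tfrac32, \end{align*} such that for every $s>\frac52$ $$R_P(\kappa)=F_0+\kappa F_1+\mathcal O(\kappa^2)\quad\text{in }\mathscr B(-1,s;1,-s),\quad\text{as }\kappa\to0,\ \operatorname{Re}\kappa>0.$$ Explicitly, there are $\delta>0$ and $C$ such that for all $\kappa\in\mathbb C$ with $\operatorname{Re}\kappa>0$ and $|\kappa|<\delta$ one has $-\kappa^2\notin\sigma(H_P)$, $R_P(\kappa)\in\mathscr B(-1,s;1,-s)$ and $\|R_P(\kappa)-F_0-\kappa F_1\|_{\mathscr B(-1,s;1,-s)}\le C|\kappa|^2$. The formula for $F_0$ (resp. $F_1$) is understood as follows: for every $t$ with $1<t\le s$ (resp. $\frac32<t\le s$) and $t<\beta-\frac12$, the operators $W_P\in\mathscr B(1,-t;-1,\beta-t)$, $G_0\in\mathscr B(-1,\beta-t;1,-t)$, $G_0\in\mathscr B(-1,t;1,-t)$ (resp. also $G_1\in\mathscr B(-1,t;1,-t)$, $G_0\in\mathscr B(-1,t;1,t-\beta)$,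 $W_P\in\mathscr B(1,t-\beta;-1,t)$) exist, $I+G_0W_P$ has a bounded inverse on $H^{1,-t}$ (resp. also $I+W_PG_0$ on $H^{-1,t}$), and $F_0$ (resp. $F_1$) is the stated product in $\mathscr B(-1,t;1,-t)$, preceded by the embedding $H^{-1,s}\hookrightarrow H^{-1,t}$ and followed by $H^{1,-t}\hookrightarrow H^{1,-s}$. -/

import Mathlib

open MeasureTheory TemperedDistribution
open scoped SchwartzMap LineDeriv ENNReal Topology

noncomputable section

namespace PauliThreshold

/-! ### Weighted Sobolev spaces of spinor-valued tempered distributions -/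

/-- The configuration space `ℝ³`. -/
abbrev R3 : Type := EuclideanSpace ℝ (Fin 3)

/-- The spin space `ℂ²`. -/
abbrev Spinor : Type := EuclideanSpace ℂ (Fin 2)

/-- Tempered distributions on `ℝ³` with values in `ℂ²`. -/
abbrev Dist : Type := 𝓢'(R3, Spinor)

/-- The Hilbert space `L²(ℝ³; ℂ²)`. -/
abbrev L2 : Type := Lp Spinor 2 (volume : Measure R3)

/-- The weight `⟨x⟩ ^ s = (1 + |x|²) ^ (s / 2)`. -/
def bracket (s : ℝ) (x : R3) : ℝ := (1 + ‖x‖ ^ 2) ^ (s / 2)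

/-- `⟨x⟩ ^ s` as a complex-valued function. -/
def weight (s : ℝ) (x : R3) : ℂ := (bracket s x : ℂ)

/-- The symbol of `(1 - Δ) ^ (k / 2)`. Mathlib's Fourier transform has the phase
`exp (-2 π i x · ξ)`, so `-Δ` is multiplication by `|2 π ξ|²`. -/
def besselSymbol (k : ℝ) (ξ : R3) : ℂ := weight k ((2 * Real.pi) • ξ)

theorem hasTemperateGrowth_weight (s : ℝ) : (weight s).HasTemperateGrowth :=
  (Function.RCLike.hasTemperateGrowth_ofReal (𝕜 := ℂ)).comp
    (Function.hasTemperateGrowth_one_add_norm_sq_rpow R3 (s / 2))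

theorem hasTemperateGrowth_besselSymbol (k : ℝ) : (besselSymbol k).HasTemperateGrowth :=
  (hasTemperateGrowth_weight k).comp
    ((2 * Real.pi) • ContinuousLinearMap.id ℝ R3).hasTemperateGrowth

theorem weight_mul (s t : ℝ) : weight s * weight t = weight (s + t) := by
  ext x
  have h : (0 : ℝ) < 1 + ‖x‖ ^ 2 := by positivity
  simp only [weight, bracket, Pi.mul_apply]
  rw [← Complex.ofReal_mul, ← Real.rpow_add h]
  congr 2
  ring

theorem weight_zero : weight 0 = fun _ => 1 := by
  ext x
  simp [weight, bracket]

theorem besselSymbol_mul (s t : ℝ) : besselSymbol s * besselSymbol t = besselSymbol (s + t) := by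
  ext x
  exact congrFun (weight_mul s t) _

theorem besselSymbol_zero : besselSymbol 0 = fun _ => 1 := by
  ext x
  exact congrFun weight_zero _

/-- The operator `⟨x⟩ ^ s (1 - Δ) ^ (k / 2)` on tempered distributions. -/
def sobolevMap (k s : ℝ) : Dist →L[ℂ] Dist :=
  smulLeftCLM Spinor (weight s) ∘L fourierMultiplierCLM Spinor (besselSymbol k)

theorem smulLeft_weight_weight (s t : ℝ) (u : Dist) :
    smulLeftCLM Spinor (weight t) (smulLeftCLM Spinor (weight s) u) =
      smulLeftCLM Spinor (weight (s + t)) u := by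
  rw [smulLeftCLM_smulLeftCLM_apply (hasTemperateGrowth_weight s) (hasTemperateGrowth_weight t),
    weight_mul]

theorem sobolevMap_injective (k s : ℝ) : Function.Injective (sobolevMap k s) := by
  intro u v h
  have h1 := congrArg (smulLeftCLM Spinor (weight (-s))) h
  simp only [sobolevMap, ContinuousLinearMap.comp_apply, smulLeft_weight_weight, add_neg_cancel,
    weight_zero, smulLeftCLM_const, one_smul] at h1
  have h2 := congrArg (fourierMultiplierCLM Spinor (besselSymbol (-k))) h1
  simpa only [fourierMultiplierCLM_fourierMultiplierCLM_apply (hasTemperateGrowth_besselSymbol k)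
    (hasTemperateGrowth_besselSymbol (-k)), besselSymbol_mul, add_neg_cancel, besselSymbol_zero,
    fourierMultiplierCLM_const, one_smul, ContinuousLinearMap.id_apply] using h2

/-- The embedding of `L²(ℝ³; ℂ²)` into the tempered distributions. -/
def ofL2 : L2 →L[ℂ] Dist := Lp.toTemperedDistributionCLM Spinor volume 2

theorem ofL2_injective : Function.Injective ofL2 :=
  LinearMap.ker_eq_bot.1 (Lp.ker_toTemperedDistributionCLM_eq_bot (F := Spinor)
    (μ := (volume : Measure R3)) (p := 2))

/-- The tempered distributions `u` with `⟨x⟩ ^ s (1 - Δ) ^ (k / 2) u ∈ L²`. -/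
def sobolevSubmodule (k s : ℝ) : Submodule ℂ Dist :=
  (LinearMap.range (ofL2 : L2 →ₗ[ℂ] Dist)).comap (sobolevMap k s : Dist →ₗ[ℂ] Dist)

/-- The weighted Sobolev space `H^{k,s}(ℝ³; ℂ²)`. Since `⟨x⟩ ^ s (1 - Δ) ^ (k / 2)` maps the
Schwartz space onto itself and the Schwartz space is dense in `L²`, this is the completion of the
Schwartz space for the norm `‖⟨x⟩ ^ s (1 - Δ) ^ (k / 2) u‖_{L²}`, realized inside the tempered
distributions. It carries that norm (see below), not the topology induced by distributions. -/
@[ext]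
structure H (k s : ℝ) : Type where
  /-- The distribution underlying an element of `H^{k,s}`. -/
  dist : Dist
  mem : dist ∈ sobolevSubmodule k s

namespace H

variable {k s : ℝ}

instance : Zero (H k s) := ⟨⟨0, zero_mem _⟩⟩
instance : Add (H k s) := ⟨fun u v => ⟨u.dist + v.dist, add_mem u.mem v.mem⟩⟩
instance : Neg (H k s) := ⟨fun u => ⟨-u.dist, neg_mem u.mem⟩⟩
instance : Sub (H k s) := ⟨fun u v => ⟨u.dist - v.dist, sub_mem u.mem v.mem⟩⟩
instance : SMul ℂ (H k s) := ⟨fun c u => ⟨c • u.dist, Submodule.smul_mem _ c u.mem⟩⟩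
instance : SMul ℕ (H k s) := ⟨fun n u => ⟨n • u.dist, nsmul_mem u.mem n⟩⟩
instance : SMul ℤ (H k s) := ⟨fun n u => ⟨n • u.dist, zsmul_mem u.mem n⟩⟩

theorem dist_injective : Function.Injective (H.dist : H k s → Dist) := fun _ _ h => H.ext h

instance : AddCommGroup (H k s) :=
  dist_injective.addCommGroup H.dist rfl (fun _ _ => rfl) (fun _ => rfl) (fun _ _ => rfl)
    (fun _ _ => rfl) (fun _ _ => rfl)

/-- The inclusion of `H^{k,s}` into the tempered distributions. -/
def distHom : H k s →+ Dist where
  toFun := H.dist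
  map_zero' := rfl
  map_add' _ _ := rfl

instance : Module ℂ (H k s) := dist_injective.module ℂ distHom (fun _ _ => rfl)

end H

/-- The map `u ↦ ⟨x⟩ ^ s (1 - Δ) ^ (k / 2) u` from `H^{k,s}` to `L²`. -/
def H.toL2 {k s : ℝ} : H k s →ₗ[ℂ] L2 where
  toFun u := u.mem.choose
  map_add' u v := ofL2_injective <| by
    have h1 : ofL2 _ = sobolevMap k s u.dist := u.mem.choose_spec
    have h2 : ofL2 _ = sobolevMap k s v.dist := v.mem.choose_spec
    have h3 : ofL2 _ = sobolevMap k s (u.dist + v.dist) := (u + v).mem.choose_spec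
    rw [map_add, h1, h2, h3, map_add]
  map_smul' c u := ofL2_injective <| by
    have h1 : ofL2 _ = sobolevMap k s u.dist := u.mem.choose_spec
    have h3 : ofL2 _ = sobolevMap k s (c • u.dist) := (c • u).mem.choose_spec
    rw [RingHom.id_apply, map_smul, h1, h3, map_smul]

theorem H.ofL2_toL2 {k s : ℝ} (u : H k s) : ofL2 (H.toL2 u) = sobolevMap k s (H.dist u) :=
  u.mem.choose_spec

theorem H.toL2_injective {k s : ℝ} : Function.Injective (H.toL2 : H k s →ₗ[ℂ] L2) := by
  intro u v h
  refine H.dist_injective (sobolevMap_injective k s ?_)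
  rw [← H.ofL2_toL2, ← H.ofL2_toL2, h]

/-- The norm `‖u‖_{H^{k,s}} = ‖⟨x⟩ ^ s (1 - Δ) ^ (k / 2) u‖_{L²}`. -/
instance (k s : ℝ) : NormedAddCommGroup (H k s) :=
  NormedAddCommGroup.induced (H k s) L2 H.toL2 H.toL2_injective

instance (k s : ℝ) : NormedSpace ℂ (H k s) :=
  NormedSpace.induced ℂ (H k s) L2 H.toL2

theorem H.norm_def {k s : ℝ} (u : H k s) : ‖u‖ = ‖H.toL2 u‖ := rfl

/-- Multiplication of an `L²` function by `⟨x⟩ ^ r`, `r ≤ 0`. -/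
theorem exists_ofL2_eq_smul_weight {r : ℝ} (hr : r ≤ 0) (g : L2) :
    ∃ g' : L2, ofL2 g' = smulLeftCLM Spinor (weight r) (ofL2 g) ∧ ‖g'‖ ≤ ‖g‖ := by
  have hb : ∀ x, ‖weight r x‖ ≤ 1 := by
    intro x
    have h : (0 : ℝ) ≤ (1 + ‖x‖ ^ 2) ^ (r / 2) := by positivity
    simp only [weight, bracket, Complex.norm_real, Real.norm_of_nonneg h]
    exact Real.rpow_le_one_of_one_le_of_nonpos (by nlinarith [norm_nonneg x]) (by linarith)
  have hc : Continuous (weight r) := by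
    have := (hasTemperateGrowth_weight r).1
    exact this.continuous
  have hm : MemLp (weight r) ∞ (volume : Measure R3) :=
    memLp_top_of_bound hc.aestronglyMeasurable 1 (Filter.Eventually.of_forall hb)
  refine ⟨((hm.toLp (weight r)) • g : L2), ?_, ?_⟩
  · exact Lp.toTemperedDistribution_smul_eq (hasTemperateGrowth_weight r) hm g
  · refine Lp.norm_le_norm_of_ae_le ?_
    filter_upwards [Lp.coeFn_lpSMul (r := 2) (hm.toLp (weight r)) g, hm.coeFn_toLp] with x h1 h2
    rw [h1, Pi.smul_apply', h2, norm_smul]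
    exact mul_le_of_le_one_left (norm_nonneg _) (hb x)

theorem H.exists_incl {k s t : ℝ} (h : t ≤ s) (u : H k s) :
    ∃ g' : L2, ofL2 g' = sobolevMap k t (H.dist u) ∧ ‖g'‖ ≤ ‖u‖ := by
  obtain ⟨g', h1, h2⟩ := exists_ofL2_eq_smul_weight (sub_nonpos.2 h) (H.toL2 u)
  refine ⟨g', ?_, h2⟩
  rw [h1, H.ofL2_toL2]
  simp only [sobolevMap, ContinuousLinearMap.comp_apply, smulLeft_weight_weight]
  congr 3
  ring

theorem H.mem_of_le {k s t : ℝ} (h : t ≤ s) (u : H k s) :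
    H.dist u ∈ sobolevSubmodule k t := by
  obtain ⟨g', h1, -⟩ := H.exists_incl h u
  exact ⟨g', h1⟩

/-- The embedding `H^{k,s} ↪ H^{k,t}` for `t ≤ s` as a linear map. -/
def H.inclLinear {k s t : ℝ} (h : t ≤ s) : H k s →ₗ[ℂ] H k t where
  toFun u := ⟨H.dist u, H.mem_of_le h u⟩
  map_add' _ _ := rfl
  map_smul' _ _ := rfl

theorem H.dist_inclLinear {k s t : ℝ} (h : t ≤ s) (u : H k s) :
    H.dist (H.inclLinear h u) = H.dist u := rfl

theorem H.norm_inclLinear_le {k s t : ℝ} (h : t ≤ s) (u : H k s) :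
    ‖H.inclLinear h u‖ ≤ 1 * ‖u‖ := by
  obtain ⟨g', h1, h2⟩ := H.exists_incl h u
  have h3 : H.toL2 (H.inclLinear h u) = g' := by
    apply ofL2_injective
    rw [H.ofL2_toL2, h1, H.dist_inclLinear]
  rw [one_mul, H.norm_def, h3]
  exact h2

/-- The continuous embedding `H^{k,s} ↪ H^{k,t}` for `t ≤ s`; it is the identity on
distributions. -/
def H.incl {k s t : ℝ} (h : t ≤ s) : H k s →L[ℂ] H k t :=
  (H.inclLinear h).mkContinuous 1 (H.norm_inclLinear_le h)

theorem H.dist_incl {k s t : ℝ} (h : t ≤ s) (u : H k s) : H.dist (H.incl h u) = H.dist u :=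
  H.dist_inclLinear h u

/-! ### Distributions given by functions, products -/

/-- The distribution `u` is given by the (polynomially bounded in the mean) function `f`. -/
def IsRep (f : R3 → Spinor) (u : Dist) : Prop :=
  (∃ m : ℝ, Integrable (fun x => bracket m x • f x)) ∧ ∀ φ : 𝓢(R3, ℂ), u φ = ∫ x, φ x • f x

/-- `v` is the pointwise product `M u` of the matrix-valued function `M` with the distribution `u`,
where `u` and `v` are given by functions. -/
def IsMul (M : R3 → Spinor →L[ℂ] Spinor) (u v : Dist) : Prop :=
  ∃ f : R3 → Spinor, IsRep f u ∧ IsRep (fun x => M x (f x)) v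

/-- The scalar function `c`, as a multiple of the `2 × 2` identity matrix. -/
def scalar (c : R3 → ℝ) (x : R3) : Spinor →L[ℂ] Spinor :=
  (c x : ℂ) • ContinuousLinearMap.id ℂ Spinor

/-- The Pauli matrices. -/
def pauli : Fin 3 → Matrix (Fin 2) (Fin 2) ℂ :=
  ![!![0, 1; 1, 0], !![0, -Complex.I; Complex.I, 0], !![1, 0; 0, -1]]

/-- The Pauli matrices as operators on spin space. -/
def pauliOp (j : Fin 3) : Spinor →L[ℂ] Spinor := Matrix.toEuclideanCLM (𝕜 := ℂ) (pauli j)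

/-- The matrix-valued function `σ · F` of a vector field `F`. -/
def sigmaDot (F : R3 → R3) (x : R3) : Spinor →L[ℂ] Spinor := ∑ j, (F x j : ℂ) • pauliOp j

/-- The unit vector in the direction of the `j`-th coordinate. -/
def axis (j : Fin 3) : R3 := EuclideanSpace.single j 1

/-- The momentum operator `P_j = -i ∂_j` on distributions. -/
def momentum (j : Fin 3) (u : Dist) : Dist := (-Complex.I) • ∂_{axis j} u

/-- A fixed matrix acting on the values of a distribution. -/
def spinAct (T : Spinor →L[ℂ] Spinor) (u : Dist) : Dist :=
  ContinuousLinearMap.comp T u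

/-! ### Potentials, Pauli operator, perturbation -/

/-- The partial derivative `∂_i F_j` of a vector field. -/
def partialD (F : R3 → R3) (i j : Fin 3) (x : R3) : ℝ := fderiv ℝ F x (axis i) j

/-- The divergence of a vector field. -/
def divergence (F : R3 → R3) (x : R3) : ℝ := ∑ j, partialD F j j x

/-- The curl of a vector field. -/
def curl (F : R3 → R3) (x : R3) : R3 :=
  !₂[partialD F 1 2 x - partialD F 2 1 x, partialD F 2 0 x - partialD F 0 2 x,
    partialD F 0 1 x - partialD F 1 0 x]

/-- The assumptions on the electric potential `V` and the magnetic field `B`, with decay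
rate `β`. -/
structure FieldAssumption (β : ℝ) (V : R3 → ℝ) (B : R3 → R3) : Prop where
  measurable_V : Measurable V
  decay_V : ∃ C : ℝ, ∀ x, |V x| ≤ C * bracket (-β) x
  contDiff_B : ContDiff ℝ 1 B
  divergence_B : ∀ x, divergence B x = 0
  decay_B : ∃ C : ℝ, ∀ x, ‖B x‖ ≤ C * bracket (-β - 1) x

/-- `A` is a short range vector potential of `B`. -/
structure IsVectorPotential (β : ℝ) (B A : R3 → R3) : Prop where
  contDiff : ContDiff ℝ 1 A
  curl_eq : ∀ x, curl A x = B x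
  decay : ∃ C : ℝ, ∀ x, ‖A x‖ ≤ C * bracket (-β) x

/-- `v = σ · (P - A) u` in the sense of distributions. -/
def IsDirac (A : R3 → R3) (u v : Dist) : Prop :=
  ∃ a : Dist, IsMul (sigmaDot A) u a ∧ v = ∑ j, spinAct (pauliOp j) (momentum j u) - a

/-- `v = H_P u` in the sense of distributions, where `H_P = (σ · (P - A))² + V`. -/
def IsPauli (V : R3 → ℝ) (A : R3 → R3) (u v : Dist) : Prop :=
  ∃ d e w : Dist, IsDirac A u d ∧ IsDirac A d e ∧ IsMul (scalar V) u w ∧ v = e + w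

/-- `v = W_P u` in the sense of distributions, where `W_P = H_P + Δ` is the first order operator
`W_P = - P · A - A · P + |A|² + V - σ · B`. With `P = -i ∇`, `curl A = B` and the Pauli matrices
above, `[P_1 - A_1, P_2 - A_2] = i B_3` and `σ_1 σ_2 = i σ_3`, whence
`(σ · (P - A))² = (P - A)² - σ · B`. -/
def IsPerturbation (V : R3 → ℝ) (B A : R3 → R3) (u v : Dist) : Prop :=
  ∃ (a b : Fin 3 → Dist) (c : Dist),
    (∀ j, IsMul (scalar fun x => A x j) u (a j)) ∧
    (∀ j, IsMul (scalar fun x => A x j) (momentum j u) (b j)) ∧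
    IsMul (fun x => scalar (fun y => ‖A y‖ ^ 2 + V y) x - sigmaDot B x) u c ∧
    v = -(∑ j, momentum j (a j)) - ∑ j, b j + c

/-- The graph of the Pauli operator `H_P` as an operator in `L²(ℝ³; ℂ²)`: its domain consists of
the `u` in the form domain `H^{1,0}` for which the distribution `H_P u` is in `L²`. -/
def PauliGraph (V : R3 → ℝ) (A : R3 → R3) (u v : L2) : Prop :=
  ofL2 u ∈ sobolevSubmodule 1 0 ∧ IsPauli V A (ofL2 u) (ofL2 v)

/-- `R` is the resolvent `R_P(κ) = (H_P + κ²)⁻¹`, a bounded operator in `L²(ℝ³; ℂ²)`. -/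
def IsPauliResolvent (V : R3 → ℝ) (A : R3 → R3) (κ : ℂ) (R : L2 →L[ℂ] L2) : Prop :=
  (∀ g : L2, PauliGraph V A (R g) (g - κ ^ 2 • R g)) ∧
    ∀ u v : L2, PauliGraph V A u v → R (v + κ ^ 2 • u) = u

/-- The bounded operator `T` from `H^{-1,s}` to `H^{1,r}` is the extension by continuity of the
operator `R` in `L²`: both agree on `L² ∩ H^{-1,s}`, which is dense in `H^{-1,s}`. -/
def IsExtension {s r : ℝ} (R : L2 →L[ℂ] L2) (T : H (-1) s →L[ℂ] H 1 r) : Prop :=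
  ∀ (g : L2) (f : H (-1) s), H.dist f = ofL2 g → H.dist (T f) = ofL2 (R g)

/-- The generalized null space of `H_P`: all `u` in the intersection of the spaces `H^{1,r}`,
`r < -1/2`, with `H_P u = 0` in the sense of distributions. -/
def pauliNull (V : R3 → ℝ) (A : R3 → R3) : Set Dist :=
  {u | (∀ r : ℝ, r < -1 / 2 → u ∈ sobolevSubmodule 1 r) ∧ IsPauli V A u 0}

/-- Zero is a regular point of `H_P`: the generalized null space is trivial. -/
def IsRegularPoint (V : R3 → ℝ) (A : R3 → R3) : Prop :=
  ∀ u ∈ pauliNull V A, u = 0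

/-! ### The coefficients of the expansion -/

/-- The integral kernel `(-1) ^ j |x - y| ^ (j - 1) / (4 π j!)` of `G_j`. -/
def freeKernel (j : ℕ) (x y : R3) : ℝ :=
  (-1) ^ j * ‖x - y‖ ^ ((j : ℤ) - 1) / (4 * Real.pi * (j.factorial : ℝ))

/-- The bounded operator `G` from `H^{-1,a}` to `H^{1,b}` is `G_j` (times the `2 × 2` identity):
on Schwartz functions, which are dense in `H^{-1,a}`, it is the integral operator with kernel
`freeKernel j`. -/
def IsFree (j : ℕ) {a b : ℝ} (G : H (-1) a →L[ℂ] H 1 b) : Prop :=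
  ∀ (φ : 𝓢(R3, Spinor)) (f : H (-1) a), IsRep φ (H.dist f) →
    IsRep (fun x => ∫ y, freeKernel j x y • φ y) (H.dist (G f))

/-- The bounded operator `W` from `H^{1,a}` to `H^{-1,b}` is `W_P`. -/
def IsW (V : R3 → ℝ) (B A : R3 → R3) {a b : ℝ} (W : H 1 a →L[ℂ] H (-1) b) : Prop :=
  ∀ u : H 1 a, IsPerturbation V B A (H.dist u) (H.dist (W u))

/-- `Q` is the bounded two-sided inverse of `T`. -/
def IsInverse {X : Type*} [NormedAddCommGroup X] [NormedSpace ℂ X] (Q T : X →L[ℂ] X) : Prop :=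
  Q ∘L T = ContinuousLinearMap.id ℂ X ∧ T ∘L Q = ContinuousLinearMap.id ℂ X

/-- `Q = (I + G_0 W_P)⁻¹` as a bounded operator on `H^{1,-t}`; here `W_P` maps `H^{1,-t}` to
`H^{-1,β-t}`, which `G_0` maps back to `H^{1,-t}`. -/
def IsLeftInv (β : ℝ) (V : R3 → ℝ) (B A : R3 → R3) (t : ℝ) (Q : H 1 (-t) →L[ℂ] H 1 (-t)) :
    Prop :=
  ∃ (G : H (-1) (β - t) →L[ℂ] H 1 (-t)) (W : H 1 (-t) →L[ℂ] H (-1) (β - t)),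
    IsFree 0 G ∧ IsW V B A W ∧ IsInverse Q (ContinuousLinearMap.id ℂ (H 1 (-t)) + G ∘L W)

/-- `Q = (I + W_P G_0)⁻¹` as a bounded operator on `H^{-1,t}`; here `G_0` maps `H^{-1,t}` to
`H^{1,t-β}`, which `W_P` maps back to `H^{-1,t}`. -/
def IsRightInv (β : ℝ) (V : R3 → ℝ) (B A : R3 → R3) (t : ℝ) (Q : H (-1) t →L[ℂ] H (-1) t) :
    Prop :=
  ∃ (G : H (-1) t →L[ℂ] H 1 (t - β)) (W : H 1 (t - β) →L[ℂ] H (-1) t),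
    IsFree 0 G ∧ IsW V B A W ∧ IsInverse Q (ContinuousLinearMap.id ℂ (H (-1) t) + W ∘L G)

/-- `F = (I + G_0 W_P)⁻¹ G_0` as an operator from `H^{-1,s}` to `H^{1,-s}`. The inverse
is bounded on `H^{1,-t}` for `1/2 < t < β - 1/2` only, so that the composition is formed on
every admissible scale `1 < t ≤ s` and preceded and followed by the embeddings
`H^{-1,s} ↪ H^{-1,t}` and `H^{1,-t} ↪ H^{1,-s}`. -/
def IsF0 (β : ℝ) (V : R3 → ℝ) (B A : R3 → R3) (s : ℝ) (F : H (-1) s →L[ℂ] H 1 (-s)) : Prop :=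
  ∀ (t : ℝ) (hts : t ≤ s), 1 < t → t < β - 1 / 2 →
    ∃ (G : H (-1) t →L[ℂ] H 1 (-t)) (Q : H 1 (-t) →L[ℂ] H 1 (-t)),
      IsFree 0 G ∧ IsLeftInv β V B A t Q ∧
      F = H.incl (neg_le_neg hts) ∘L Q ∘L G ∘L H.incl hts

/-- `F = (I + G_0 W_P)⁻¹ G_1 (I + W_P G_0)⁻¹` as an operator from `H^{-1,s}` to `H^{1,-s}`,
the composition being formed on every admissible scale `3/2 < t ≤ s`. -/
def IsF1 (β : ℝ) (V : R3 → ℝ) (B A : R3 → R3) (s : ℝ) (F : H (-1) s →L[ℂ] H 1 (-s)) : Prop :=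
  ∀ (t : ℝ) (hts : t ≤ s), 3 / 2 < t → t < β - 1 / 2 →
    ∃ (G : H (-1) t →L[ℂ] H 1 (-t)) (Q : H 1 (-t) →L[ℂ] H 1 (-t))
      (Q' : H (-1) t →L[ℂ] H (-1) t),
      IsFree 1 G ∧ IsLeftInv β V B A t Q ∧ IsRightInv β V B A t Q' ∧
      F = H.incl (neg_le_neg hts) ∘L Q ∘L G ∘L Q' ∘L H.incl hts

end PauliThreshold

end

open PauliThreshold

open MeasureTheory TemperedDistribution
open scoped SchwartzMap LineDeriv ENNReal Topology

noncomputable section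

namespace PauliThreshold

/-! ### Weights and Fourier multipliers on tempered distributions -/

/-! Write R_0(κ) = (-Δ + κ²)⁻¹. For Re κ > 0 the second resolvent identity turns (H_P + κ²) u = f
into the Lippmann-Schwinger equation (I + R_0(κ) W_P) u = R_0(κ) f, so that R_P(κ) = (I + R_0(κ)
W_P)⁻¹ R_0(κ). The expansion then follows from two facts: R_0(κ) = G_0 + κ G_1 + O(κ²) between
weighted spaces, and I + G_0 W_P is invertible. A Neumann series (`exists_inverse_expansion`)
combines them, with (I + W_P G_0)⁻¹ = I - W_P (I + G_0 W_P)⁻¹ G_0.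

The free expansion is a kernel estimate. The Taylor remainder of exp(-κ|x-y|) / (4π|x-y|) is at most
|κ|² |x-y|, and conjugated with ⟨x⟩^(-s) and ⟨y⟩^(-s) it is Hilbert-Schmidt for s > 5/2
(`exists_norm_greenOp_expansion_le`). The passage from L² to H^{-1,s} → H^{1,-s} rests on (1 - Δ)
R_0(κ) = I + (1 - κ²) R_0(κ), which needs no further kernel estimate (`dist_free`). That the kernel
inverts -Δ + κ² is proved by hand in `integral_greenFn`.

Invertibility is the Fredholm alternative (`exists_isInverse_lippmann`). The operator G_0 W_P is
compact because the weighted Newtonian kernel is Hilbert-Schmidt and (1 - Δ)^(-1/2) ⟨x⟩^(-γ) is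
compact for γ > 1. A null vector satisfies u = -G_0 W_P u, and each use of this equation can improve
the weight by 3, because W_P gains β > 5 and G_0 loses little more than 2. Hence u lies in H^{1,r}
for every r < -1/2 and solves H_P u = 0, so u = 0 at a regular point. The identity H_P = -Δ + W_P is
needed here for distributions and for A that is only C¹ (`momentum_curl`,
`exists_isPerturbation_isPauli`).

First order operators act between the weighted spaces because ⟨x⟩^(-s) L² is stable under (1 -
Δ)^(-1/2) and P_j (1 - Δ)^(-1/2) (`isStable`): commutators with the coordinates give integer s, and
interpolation gives the rest. Operators attached to different weights agree on common distributions
(`free_compat`, `inverse_compat`, `dualInv_compat`). This makes F_0 and F_1 independent of the scale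
on which they are formed. -/

/-- Multiplication by `⟨x⟩ ^ s` on tempered distributions. -/
abbrev wt (s : ℝ) : Dist →L[ℂ] Dist := smulLeftCLM Spinor (weight s)

/-- The Fourier multiplier with symbol `m`. -/
abbrev fm (m : R3 → ℂ) : Dist →L[ℂ] Dist := fourierMultiplierCLM Spinor m

/-- The Bessel potential `(1 - Δ) ^ (k / 2)`. -/
abbrev bes (k : ℝ) : Dist →L[ℂ] Dist := fm (besselSymbol k)

theorem wt_wt (s t : ℝ) (u : Dist) : wt t (wt s u) = wt (s + t) u := smulLeft_weight_weight s t u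

theorem wt_zero (u : Dist) : wt 0 u = u := by
  simp [wt, weight_zero]

theorem wt_wt_neg (s : ℝ) (u : Dist) : wt s (wt (-s) u) = u := by
  rw [wt_wt, neg_add_cancel, wt_zero]

theorem wt_neg_wt (s : ℝ) (u : Dist) : wt (-s) (wt s u) = u := by
  rw [wt_wt, add_neg_cancel, wt_zero]

theorem fm_fm {m n : R3 → ℂ} (hm : m.HasTemperateGrowth) (hn : n.HasTemperateGrowth) (u : Dist) :
    fm n (fm m u) = fm (m * n) u :=
  fourierMultiplierCLM_fourierMultiplierCLM_apply hm hn u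

theorem bes_bes (s t : ℝ) (u : Dist) : bes t (bes s u) = bes (s + t) u := by
  rw [bes, bes, fm_fm (hasTemperateGrowth_besselSymbol s) (hasTemperateGrowth_besselSymbol t),
    besselSymbol_mul]

theorem bes_zero (u : Dist) : bes 0 u = u := by
  simp [bes, fm, besselSymbol_zero]

theorem bes_bes_neg (s : ℝ) (u : Dist) : bes s (bes (-s) u) = u := by
  rw [bes_bes, neg_add_cancel, bes_zero]

theorem bes_neg_bes (s : ℝ) (u : Dist) : bes (-s) (bes s u) = u := by
  rw [bes_bes, add_neg_cancel, bes_zero]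

/-- The range of `L²` in the tempered distributions. -/
abbrev rangeL2 : Submodule ℂ Dist := LinearMap.range (ofL2 : L2 →ₗ[ℂ] Dist)

theorem ofL2_mem (g : L2) : ofL2 g ∈ rangeL2 := ⟨g, rfl⟩

theorem mem_rangeL2 {u : Dist} : u ∈ rangeL2 ↔ ∃ g : L2, ofL2 g = u := Iff.rfl

/-- The weighted space `{u | ⟨x⟩ ^ s u ∈ L²}`. -/
def LW (s : ℝ) : Submodule ℂ Dist := rangeL2.comap (wt s : Dist →ₗ[ℂ] Dist)

theorem mem_LW {s : ℝ} {u : Dist} : u ∈ LW s ↔ ∃ g : L2, ofL2 g = wt s u := Iff.rfl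

theorem wt_neg_ofL2_mem_LW (s : ℝ) (g : L2) : wt (-s) (ofL2 g) ∈ LW s :=
  ⟨g, (wt_wt_neg s _).symm⟩

theorem mem_LW_iff_exists {s : ℝ} {u : Dist} : u ∈ LW s ↔ ∃ g : L2, u = wt (-s) (ofL2 g) := by
  constructor
  · rintro ⟨g, hg⟩
    refine ⟨g, ?_⟩
    have hg' : ofL2 g = wt s u := hg
    rw [hg', wt_neg_wt]
  · rintro ⟨g, rfl⟩
    exact wt_neg_ofL2_mem_LW s g

theorem wt_mem_LW {s r : ℝ} {u : Dist} : wt r u ∈ LW s ↔ u ∈ LW (r + s) := by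
  rw [mem_LW, mem_LW, wt_wt]

theorem mem_LW_zero {u : Dist} : u ∈ LW 0 ↔ u ∈ rangeL2 := by
  rw [mem_LW, mem_rangeL2, wt_zero]

theorem LW_mono {s t : ℝ} (h : t ≤ s) : LW s ≤ LW t := by
  rintro u ⟨g, hg⟩
  have hg' : ofL2 g = wt s u := hg
  obtain ⟨g', h1, -⟩ := exists_ofL2_eq_smul_weight (sub_nonpos.2 h) g
  refine ⟨g', ?_⟩
  change ofL2 g' = wt t u
  rw [h1, hg', wt_wt]
  congr 2
  ring

theorem mem_sobolevSubmodule {k s : ℝ} {u : Dist} : u ∈ sobolevSubmodule k s ↔ bes k u ∈ LW s :=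
  Iff.rfl

/-- The element of `H^{k,s}` with `⟨x⟩ ^ s (1 - Δ) ^ (k / 2) u = g`. -/
def H.ofFun (k s : ℝ) (g : L2) : H k s :=
  ⟨bes (-k) (wt (-s) (ofL2 g)), ⟨g, by
    change ofL2 g = wt s (bes k _)
    rw [bes_bes_neg, wt_wt_neg]⟩⟩

theorem H.dist_ofFun (k s : ℝ) (g : L2) : (H.ofFun k s g).dist = bes (-k) (wt (-s) (ofL2 g)) := rfl

theorem H.toL2_ofFun (k s : ℝ) (g : L2) : H.toL2 (H.ofFun k s g) = g := by
  apply ofL2_injective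
  rw [H.ofL2_toL2, H.dist_ofFun]
  change wt s (bes k _) = _
  rw [bes_bes_neg, wt_wt_neg]

/-- `H^{k,s}` is isometric to `L²`. -/
def H.iso (k s : ℝ) : H k s ≃ₗᵢ[ℂ] L2 where
  toLinearEquiv := LinearEquiv.ofBijective H.toL2
    ⟨H.toL2_injective, fun g => ⟨H.ofFun k s g, H.toL2_ofFun k s g⟩⟩
  norm_map' _ := rfl

theorem H.iso_apply {k s : ℝ} (u : H k s) : H.iso k s u = H.toL2 u := rfl

theorem H.iso_symm_apply {k s : ℝ} (g : L2) : (H.iso k s).symm g = H.ofFun k s g := by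
  rw [LinearIsometryEquiv.symm_apply_eq, H.iso_apply, H.toL2_ofFun]

theorem H.bes_dist {k s : ℝ} (u : H k s) : bes k u.dist = wt (-s) (ofL2 (H.toL2 u)) := by
  rw [H.ofL2_toL2]
  exact (wt_neg_wt s _).symm

theorem H.dist_eq {k s : ℝ} (u : H k s) : u.dist = bes (-k) (wt (-s) (ofL2 (H.toL2 u))) := by
  rw [← H.bes_dist, bes_neg_bes]

instance (k s : ℝ) : CompleteSpace (H k s) :=
  (H.iso k s).toIsometryEquiv.completeSpace

/-- The operator `H^{k,s} → H^{k',s'}` that corresponds to an operator in `L²`. -/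
def H.conj (k s k' s' : ℝ) (T : L2 →L[ℂ] L2) : H k s →L[ℂ] H k' s' :=
  ((H.iso k' s').symm.toContinuousLinearEquiv : L2 →L[ℂ] H k' s') ∘L T ∘L
    ((H.iso k s).toContinuousLinearEquiv : H k s →L[ℂ] L2)

theorem H.conj_apply {k s k' s' : ℝ} (T : L2 →L[ℂ] L2) (u : H k s) :
    H.conj k s k' s' T u = H.ofFun k' s' (T (H.toL2 u)) := by
  rw [← H.iso_symm_apply]; rfl

theorem H.toL2_conj {k s k' s' : ℝ} (T : L2 →L[ℂ] L2) (u : H k s) :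
    H.toL2 (H.conj k s k' s' T u) = T (H.toL2 u) := by
  rw [H.conj_apply, H.toL2_ofFun]

theorem H.dist_conj {k s k' s' : ℝ} (T : L2 →L[ℂ] L2) (u : H k s) :
    (H.conj k s k' s' T u).dist = bes (-k') (wt (-s') (ofL2 (T (H.toL2 u)))) := by
  rw [H.conj_apply, H.dist_ofFun]

theorem H.norm_conj_le {k s k' s' : ℝ} (T : L2 →L[ℂ] L2) : ‖H.conj k s k' s' T‖ ≤ ‖T‖ := by
  refine ContinuousLinearMap.opNorm_le_bound _ (norm_nonneg _) fun u => ?_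
  rw [H.norm_def, H.toL2_conj, H.norm_def]
  exact T.le_opNorm _

theorem H.conj_comp {k s k' s' k'' s'' : ℝ} (T T' : L2 →L[ℂ] L2) :
    H.conj k' s' k'' s'' T ∘L H.conj k s k' s' T' = H.conj k s k'' s'' (T ∘L T') := by
  ext1 u
  apply H.toL2_injective
  simp only [ContinuousLinearMap.comp_apply, H.toL2_conj]

theorem H.isCompactOperator_conj {k s k' s' : ℝ} {T : L2 →L[ℂ] L2} (hT : IsCompactOperator T) :
    IsCompactOperator (H.conj k s k' s' T) :=
  (hT.comp_clm ((H.iso k s).toContinuousLinearEquiv : H k s →L[ℂ] L2)).clm_comp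
    ((H.iso k' s').symm.toContinuousLinearEquiv : L2 →L[ℂ] H k' s')

/-! ### Bounded operators on `L²` from operators on distributions -/

/-- Closed graph theorem: the graph is the set of pairs with `ofL2 p.2 = Φ (ofL2 p.1)`, closed
because both sides are continuous into distributions. Boundedness on L² thus reduces to membership,
so most mapping properties below need no norm estimate. -/
theorem exists_clm_of_rangeL2 (Φ : Dist →L[ℂ] Dist) (h : ∀ g : L2, Φ (ofL2 g) ∈ rangeL2) :
    ∃ T : L2 →L[ℂ] L2, ∀ g, ofL2 (T g) = Φ (ofL2 g) := by
  choose F hF using h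
  have hF' : ∀ g, ofL2 (F g) = Φ (ofL2 g) := hF
  let L : L2 →ₗ[ℂ] L2 :=
    { toFun := F
      map_add' := fun u v => ofL2_injective (by rw [hF', map_add, map_add, map_add, hF', hF'])
      map_smul' := fun c u => ofL2_injective (by
        rw [hF', map_smul, map_smul, RingHom.id_apply, map_smul, hF']) }
  have hL : Continuous L := by
    apply LinearMap.continuous_of_isClosed_graph
    have : (L.graph : Set (L2 × L2)) = {p | ofL2 p.2 = Φ (ofL2 p.1)} := by
      ext p
      simp only [SetLike.mem_coe, LinearMap.mem_graph_iff, Set.mem_ofPred_eq]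
      constructor
      · intro h
        rw [h]
        exact hF' p.1
      · intro h
        exact ofL2_injective (h.trans (hF' p.1).symm)
    rw [this]
    exact isClosed_eq (ofL2.continuous.comp continuous_snd)
      (Φ.continuous.comp (ofL2.continuous.comp continuous_fst))
  exact ⟨⟨L, hL⟩, hF'⟩

/-! ### Elementary bounds for weights and bounded multipliers -/

theorem norm_weight (s : ℝ) (x : R3) : ‖weight s x‖ = bracket s x := by
  have h : (0 : ℝ) ≤ (1 + ‖x‖ ^ 2) ^ (s / 2) := by positivity
  simp only [weight, bracket, Complex.norm_real, Real.norm_of_nonneg h]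

theorem bracket_pos (s : ℝ) (x : R3) : 0 < bracket s x := by
  unfold bracket; positivity

theorem bracket_mul (s t : ℝ) (x : R3) : bracket s x * bracket t x = bracket (s + t) x := by
  have h : (0 : ℝ) < 1 + ‖x‖ ^ 2 := by positivity
  rw [bracket, bracket, bracket, ← Real.rpow_add h, add_div]

theorem bracket_zero (x : R3) : bracket 0 x = 1 := by simp [bracket]

theorem bracket_mul_neg (s : ℝ) (x : R3) : bracket s x * bracket (-s) x = 1 := by
  rw [bracket_mul, add_neg_cancel, bracket_zero]

theorem bracket_neg_mul (s : ℝ) (x : R3) : bracket (-s) x * bracket s x = 1 := by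
  rw [bracket_mul, neg_add_cancel, bracket_zero]

theorem bracket_rpow (s r : ℝ) (x : R3) : bracket s x ^ r = bracket (s * r) x := by
  rw [bracket, bracket, ← Real.rpow_mul (by positivity)]
  congr 1; ring

theorem bracket_le_bracket {s t : ℝ} (h : s ≤ t) (x : R3) : bracket s x ≤ bracket t x := by
  apply Real.rpow_le_rpow_of_exponent_le
  · nlinarith [norm_nonneg x]
  · linarith

theorem bracket_le_one {s : ℝ} (h : s ≤ 0) (x : R3) : bracket s x ≤ 1 :=
  (bracket_le_bracket h x).trans_eq (bracket_zero x)

theorem one_le_bracket {s : ℝ} (h : 0 ≤ s) (x : R3) : 1 ≤ bracket s x :=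
  (bracket_zero x).symm.trans_le (bracket_le_bracket h x)

theorem bracket_two (x : R3) : bracket 2 x = 1 + ‖x‖ ^ 2 := by simp [bracket]

theorem norm_le_bracket_one (x : R3) : ‖x‖ ≤ bracket 1 x := by
  have h1 : bracket 1 x * bracket 1 x = 1 + ‖x‖ ^ 2 := by
    rw [bracket_mul, ← bracket_two]; norm_num
  nlinarith [norm_nonneg x, bracket_pos 1 x]

theorem continuous_bracket (s : ℝ) : Continuous (bracket s) := by
  unfold bracket
  exact (by fun_prop : Continuous fun x : R3 => 1 + ‖x‖ ^ 2).rpow_const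
    fun x => Or.inl (by positivity)

theorem smulLeft_mem_rangeL2 {m : R3 → ℂ} (hm : m.HasTemperateGrowth) {C : ℝ}
    (hC : ∀ x, ‖m x‖ ≤ C) {u : Dist} (hu : u ∈ rangeL2) : smulLeftCLM Spinor m u ∈ rangeL2 := by
  obtain ⟨g, rfl⟩ := hu
  have hm' : MemLp m ∞ (volume : Measure R3) :=
    memLp_top_of_bound hm.1.continuous.aestronglyMeasurable C (Filter.Eventually.of_forall hC)
  exact ⟨((hm'.toLp m) • g : L2), Lp.toTemperedDistribution_smul_eq hm hm' g⟩

theorem fm_mem_rangeL2 {m : R3 → ℂ} (hm : m.HasTemperateGrowth) {C : ℝ}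
    (hC : ∀ x, ‖m x‖ ≤ C) {u : Dist} (hu : u ∈ rangeL2) : fm m u ∈ rangeL2 := by
  obtain ⟨g, rfl⟩ := hu
  have h1 : MemSobolev 0 2 (ofL2 g) := memSobolev_zero_iff.2 ⟨g, rfl⟩
  obtain ⟨g', hg'⟩ := memSobolev_zero_iff.1 (h1.fourierMultiplierCLM_of_bounded hm ⟨C, hC⟩)
  exact ⟨g', hg'.symm⟩

theorem smulLeft_comm {m n : R3 → ℂ} (hm : m.HasTemperateGrowth) (hn : n.HasTemperateGrowth)
    (u : Dist) : smulLeftCLM Spinor n (smulLeftCLM Spinor m u) =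
      smulLeftCLM Spinor m (smulLeftCLM Spinor n u) := by
  rw [smulLeftCLM_smulLeftCLM_apply hm hn, smulLeftCLM_smulLeftCLM_apply hn hm, mul_comm]

theorem smulLeft_mem_LW {m : R3 → ℂ} (hm : m.HasTemperateGrowth) {C : ℝ}
    (hC : ∀ x, ‖m x‖ ≤ C) {s : ℝ} {u : Dist} (hu : u ∈ LW s) : smulLeftCLM Spinor m u ∈ LW s := by
  change wt s _ ∈ rangeL2
  rw [wt, smulLeft_comm hm (hasTemperateGrowth_weight s)]
  exact smulLeft_mem_rangeL2 hm hC hu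

/-! ### Commutators with coordinates -/

/-- The function `x ↦ x_j ⟨x⟩⁻¹`. -/
def dirWeight (j : Fin 3) (x : R3) : ℂ := (x j : ℂ) * weight (-1) x

/-- The symbol of `P_j`. -/
def momSymbol (j : Fin 3) (ξ : R3) : ℂ := ((2 * Real.pi * ξ j : ℝ) : ℂ)

/-- The symbol of `P_j (1 - Δ) ^ (-1 / 2)`. -/
def dirSymbol (j : Fin 3) (ξ : R3) : ℂ := momSymbol j ξ * besselSymbol (-1) ξ

theorem coord_eq_inner (j : Fin 3) (x : R3) : x j = inner ℝ x (axis j) := by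
  simp [axis, EuclideanSpace.inner_single_right]

theorem hasTemperateGrowth_coord (j : Fin 3) : (fun x : R3 => (x j : ℂ)).HasTemperateGrowth := by
  simp_rw [coord_eq_inner]
  fun_prop

theorem hasTemperateGrowth_momSymbol (j : Fin 3) : (momSymbol j).HasTemperateGrowth := by
  have h : momSymbol j = (fun _ => ((2 * Real.pi : ℝ) : ℂ)) * (fun x : R3 => (x j : ℂ)) := by
    ext x; simp [momSymbol]
  rw [h]
  exact (Function.HasTemperateGrowth.const _).mul (hasTemperateGrowth_coord j)

theorem hasTemperateGrowth_dirWeight (j : Fin 3) : (dirWeight j).HasTemperateGrowth :=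
  (hasTemperateGrowth_coord j).mul (hasTemperateGrowth_weight (-1))

theorem hasTemperateGrowth_dirSymbol (j : Fin 3) : (dirSymbol j).HasTemperateGrowth :=
  (hasTemperateGrowth_momSymbol j).mul (hasTemperateGrowth_besselSymbol (-1))

theorem norm_dirWeight_le (j : Fin 3) (x : R3) : ‖dirWeight j x‖ ≤ 1 := by
  rw [dirWeight, norm_mul, norm_weight, Complex.norm_real]
  have h1 : ‖x j‖ ≤ bracket 1 x := (EuclideanSpace.norm_eq x ▸ by
    refine Real.le_sqrt_of_sq_le ?_
    exact Finset.single_le_sum (f := fun i => ‖x i‖ ^ 2) (fun i _ => by positivity)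
      (Finset.mem_univ j) : ‖x j‖ ≤ ‖x‖).trans (norm_le_bracket_one x)
  calc ‖x j‖ * bracket (-1) x ≤ bracket 1 x * bracket (-1) x := by
        gcongr
        exact (bracket_pos _ _).le
    _ = 1 := bracket_mul_neg 1 x

theorem dirSymbol_eq (j : Fin 3) (ξ : R3) : dirSymbol j ξ = dirWeight j ((2 * Real.pi) • ξ) := by
  simp [dirSymbol, dirWeight, momSymbol, besselSymbol]

theorem norm_dirSymbol_le (j : Fin 3) (x : R3) : ‖dirSymbol j x‖ ≤ 1 := by
  rw [dirSymbol_eq]; exact norm_dirWeight_le j _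

theorem norm_besselSymbol_le {k : ℝ} (hk : k ≤ 0) (x : R3) : ‖besselSymbol k x‖ ≤ 1 := by
  rw [besselSymbol, norm_weight]; exact bracket_le_one hk _

theorem momentum_eq_fm (j : Fin 3) (u : Dist) : momentum j u = fm (momSymbol j) u := by
  have h1 : momSymbol j =
      ((2 * Real.pi : ℝ) : ℂ) • (fun x : R3 => ((inner ℝ x (axis j) : ℝ) : ℂ)) := by
    ext x; simp [momSymbol, ← coord_eq_inner]
  have h2 : (fun x : R3 => ((inner ℝ x (axis j) : ℝ) : ℂ)).HasTemperateGrowth := by fun_prop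
  rw [momentum, lineDeriv_eq_fourierMultiplierCLM, h1, fm, fourierMultiplierCLM_smul h2, smul_smul]
  change _ = ((2 * Real.pi : ℝ) : ℂ) • fourierMultiplierCLM Spinor _ u
  congr 1
  push_cast
  linear_combination (-2 * Real.pi : ℂ) * Complex.I_mul_I

/-- The Leibniz rule, proved on the test function side, where it is the pointwise product rule for
`g` times a Schwartz function. -/
theorem lineDeriv_smulLeft {g g' : R3 → ℂ} {m : R3} (hg : g.HasTemperateGrowth)
    (hg' : g'.HasTemperateGrowth) (hd : ∀ x, HasLineDerivAt ℝ g (g' x) x m) (u : Dist) :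
    ∂_{m} (smulLeftCLM Spinor g u) = smulLeftCLM Spinor g' u + smulLeftCLM Spinor g (∂_{m} u) := by
  ext1 φ
  have key : SchwartzMap.smulLeftCLM ℂ g (-∂_{m} φ) =
      SchwartzMap.smulLeftCLM ℂ g' φ + -∂_{m} (SchwartzMap.smulLeftCLM ℂ g φ) := by
    ext x
    have h1 : HasLineDerivAt ℝ φ (∂_{m} φ x) x m := by
      rw [SchwartzMap.lineDerivOp_apply_eq_fderiv]
      exact (φ.hasFDerivAt x).hasLineDerivAt m
    have h2 : HasLineDerivAt ℝ (SchwartzMap.smulLeftCLM ℂ g φ)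
        (∂_{m} (SchwartzMap.smulLeftCLM ℂ g φ) x) x m := by
      rw [SchwartzMap.lineDerivOp_apply_eq_fderiv]
      exact ((SchwartzMap.smulLeftCLM ℂ g φ).hasFDerivAt x).hasLineDerivAt m
    have h3 : HasLineDerivAt ℝ (SchwartzMap.smulLeftCLM ℂ g φ)
        (g x * ∂_{m} φ x + g' x * φ x) x m := by
      have h4 := HasDerivAt.mul (hd x) h1
      have h5 : (⇑(SchwartzMap.smulLeftCLM ℂ g φ)) = fun x => g x * φ x := by
        ext y; simp [SchwartzMap.smulLeftCLM_apply_apply hg]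
      rw [h5]
      simp only [zero_smul, add_zero] at h4
      rw [add_comm]
      exact h4
    have h6 := h2.unique h3
    simp only [add_apply, neg_apply, h6,
      SchwartzMap.smulLeftCLM_apply_apply hg, SchwartzMap.smulLeftCLM_apply_apply hg', smul_eq_mul]
    ring
  change u (SchwartzMap.smulLeftCLM ℂ g (-∂_{m} φ)) = u (SchwartzMap.smulLeftCLM ℂ g' φ) +
    u (-∂_{m} (SchwartzMap.smulLeftCLM ℂ g φ))
  rw [key, map_add]

/-- Multiplication by the coordinate `x_j`. -/
abbrev mulX (j : Fin 3) : Dist →L[ℂ] Dist := smulLeftCLM Spinor (fun x : R3 => (x j : ℂ))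

/-- The Fourier transform turns multiplication by x_j into a multiple of ∂_j, so the commutator with
a multiplier comes from the Leibniz rule for the symbol. -/
theorem mulX_fm {b b' : R3 → ℂ} {j : Fin 3} (hb : b.HasTemperateGrowth)
    (hb' : b'.HasTemperateGrowth) (hd : ∀ x, HasLineDerivAt ℝ b (b' x) x (axis j)) (u : Dist) :
    mulX j (fm b u) = fm b (mulX j u) - (2 * Real.pi * Complex.I)⁻¹ • fm b' u := by
  have hc : (2 * Real.pi * Complex.I : ℂ) ≠ 0 := by
    simp [Real.pi_ne_zero]
  have hX : (fun x : R3 => (x j : ℂ)) = (fun x : R3 => ((inner ℝ x (axis j) : ℝ) : ℂ)) := by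
    ext x; rw [coord_eq_inner]
  have h1 := fourierInv_lineDerivOp_eq (smulLeftCLM Spinor b (FourierTransform.fourier u)) (axis j)
  have h2 := lineDerivOp_fourier_eq u (axis j)
  rw [lineDeriv_smulLeft hb hb' hd, h2] at h1
  simp only [← hX] at h1
  simp only [fm, fourierMultiplierCLM_apply]
  simp only [FourierTransform.fourierInv_add, FourierTransform.fourier_smul, map_smul,
    FourierTransform.fourierInv_smul] at h1
  have h3 := congrArg (fun v => -((2 * Real.pi * Complex.I : ℂ)⁻¹ • v)) h1
  simp only [neg_smul, smul_neg, neg_neg, smul_smul, inv_mul_cancel₀ hc, one_smul, smul_add,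
    neg_add_rev] at h3
  rw [sub_eq_add_neg]
  exact h3.symm

/-! ### Operators of order zero in weighted spaces -/

theorem hasTemperateGrowth_const_smul {m : R3 → ℂ} (hm : m.HasTemperateGrowth) (c : ℂ) :
    (c • m).HasTemperateGrowth :=
  (Function.HasTemperateGrowth.const c).mul hm

theorem fm_smul {m : R3 → ℂ} (hm : m.HasTemperateGrowth) (c : ℂ) (u : Dist) :
    fm (c • m) u = c • fm m u := by
  rw [fm, fourierMultiplierCLM_smul hm]
  rfl

theorem fm_add {m n : R3 → ℂ} (hm : m.HasTemperateGrowth) (hn : n.HasTemperateGrowth) (u : Dist) :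
    fm (m + n) u = fm m u + fm n u := by
  simp only [fm, fourierMultiplierCLM_apply]
  rw [smulLeftCLM_add hm hn, add_apply, FourierTransform.fourierInv_add]

theorem hasLineDerivAt_besselSymbol (k : ℝ) (i : Fin 3) (ξ : R3) :
    HasLineDerivAt ℝ (besselSymbol k)
      (((2 * Real.pi * k : ℝ) : ℂ) * momSymbol i ξ * besselSymbol (k - 2) ξ) ξ (axis i) := by
  have hpos : (0 : ℝ) < 1 + ‖(2 * Real.pi) • ξ‖ ^ 2 := by positivity
  have h0 : HasDerivAt (fun t : ℝ => (2 * Real.pi) • (ξ + t • axis i))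
      ((2 * Real.pi) • axis i) 0 := by
    have := ((((hasDerivAt_id (0 : ℝ)).smul_const (axis i)).const_add ξ).const_smul (2 * Real.pi))
    rw [one_smul] at this
    exact this
  have h1 := (h0.norm_sq.const_add 1).rpow_const (p := k / 2) (Or.inl (by simpa using hpos.ne'))
  have h2 := h1.ofReal_comp
  change HasDerivAt (fun t : ℝ => besselSymbol k (ξ + t • axis i)) _ 0
  convert! h2 using 1
  simp only [zero_smul, add_zero, inner_smul_left, inner_smul_right, ← coord_eq_inner, momSymbol,
    besselSymbol, weight, bracket]
  have h3 : (k - 2) / 2 = k / 2 - 1 := by ring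
  rw [h3]
  generalize (1 + ‖(2 * Real.pi) • ξ‖ ^ 2) ^ (k / 2 - 1) = z
  simp only [RCLike.conj_to_real]
  push_cast
  ring

theorem hasLineDerivAt_momSymbol (i j : Fin 3) (ξ : R3) :
    HasLineDerivAt ℝ (momSymbol j) (if i = j then 2 * Real.pi else 0) ξ (axis i) := by
  change HasDerivAt (fun t : ℝ => momSymbol j (ξ + t • axis i)) _ 0
  have h : (fun t : ℝ => momSymbol j (ξ + t • axis i)) =
      fun t : ℝ => ((2 * Real.pi * ξ j + t * (2 * Real.pi * if i = j then 1 else 0) : ℝ) : ℂ) := by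
    ext t
    simp only [momSymbol, PiLp.add_apply, PiLp.smul_apply, axis, EuclideanSpace.single, PiLp.single_apply,
      smul_eq_mul, eq_comm (a := j)]
    congr 1
    ring
  rw [h]
  have := (((hasDerivAt_id (0 : ℝ)).mul_const
    (2 * Real.pi * if i = j then 1 else 0)).const_add (2 * Real.pi * ξ j)).ofReal_comp
  convert! this using 1
  split_ifs <;> simp

/-- The derivative of the symbol factors through `dirSymbol` and `besselSymbol (-1)` again. The
commutator with x_i therefore stays in the algebra generated by the two families in `IsStable`, and
only the existence of the constant matters. The same holds for `mulX_dir`. -/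
theorem mulX_bes (i : Fin 3) (u : Dist) : ∃ c : ℂ, mulX i (bes (-1) u) =
    bes (-1) (mulX i u) + c • fm (dirSymbol i) (bes (-1) (bes (-1) u)) := by
  have hb := hasTemperateGrowth_besselSymbol
  have hd := hasTemperateGrowth_dirSymbol
  have h : (fun ξ => ((2 * Real.pi * (-1) : ℝ) : ℂ) * momSymbol i ξ * besselSymbol (-1 - 2) ξ) =
      ((2 * Real.pi * (-1) : ℝ) : ℂ) •
        (besselSymbol (-1) * besselSymbol (-1) * dirSymbol i) := by
    ext ξ
    have h1 := congrFun (besselSymbol_mul (-1) (-1 + -1)) ξ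
    rw [← besselSymbol_mul] at h1
    have h2 : (-1 - 2 : ℝ) = -1 + (-1 + -1) := by norm_num
    simp only [Pi.mul_apply, Pi.smul_apply, smul_eq_mul, dirSymbol] at h1 ⊢
    rw [h2, ← h1]
    ring
  have h1 := mulX_fm (hb (-1)) (b' := fun ξ => ((2 * Real.pi * (-1) : ℝ) : ℂ) * momSymbol i ξ *
    besselSymbol (-1 - 2) ξ) (j := i)
    (((Function.HasTemperateGrowth.const _).mul (hasTemperateGrowth_momSymbol i)).mul (hb _))
    (fun ξ => hasLineDerivAt_besselSymbol (-1) i ξ) u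
  rw [h, fm_smul (((hb _).mul (hb _)).mul (hd i))] at h1
  refine ⟨-((2 * Real.pi * Complex.I)⁻¹ * ((2 * Real.pi * (-1) : ℝ) : ℂ)), ?_⟩
  rw [bes, h1, fm_fm (hb _) (hb _), fm_fm ((hb _).mul (hb _)) (hd i)]
  module

theorem mulX_dir (i j : Fin 3) (u : Dist) : ∃ c c' : ℂ, mulX i (fm (dirSymbol j) u) =
    fm (dirSymbol j) (mulX i u) + c • bes (-1) u +
      c' • fm (dirSymbol j) (fm (dirSymbol i) (bes (-1) u)) := by
  have hb := hasTemperateGrowth_besselSymbol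
  have hd := hasTemperateGrowth_dirSymbol
  set b' : R3 → ℂ := ((if i = j then 2 * Real.pi else 0 : ℂ)) • besselSymbol (-1) +
    ((2 * Real.pi * (-1) : ℝ) : ℂ) • (besselSymbol (-1) * dirSymbol i * dirSymbol j) with hb'
  have hder : ∀ ξ, HasLineDerivAt ℝ (dirSymbol j) (b' ξ) ξ (axis i) := by
    intro ξ
    have h1 := HasDerivAt.mul (hasLineDerivAt_momSymbol i j ξ)
      (hasLineDerivAt_besselSymbol (-1) i ξ)
    simp only [zero_smul, add_zero] at h1
    have h4 : b' ξ = (if i = j then 2 * Real.pi else 0 : ℂ) * besselSymbol (-1) ξ +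
        momSymbol j ξ * (((2 * Real.pi * (-1) : ℝ) : ℂ) * momSymbol i ξ *
          besselSymbol (-1 - 2) ξ) := by
      have h1 := congrFun (besselSymbol_mul (-1) (-1 + -1)) ξ
      rw [← besselSymbol_mul] at h1
      have h2 : (-1 - 2 : ℝ) = -1 + (-1 + -1) := by norm_num
      simp only [hb', Pi.add_apply, Pi.mul_apply, Pi.smul_apply, smul_eq_mul, dirSymbol] at h1 ⊢
      rw [h2, ← h1]
      ring
    rw [h4]
    exact h1
  have ht2 := (((hb (-1)).mul (hd i)).mul (hd j))
  have h1 := mulX_fm (hd j) (b' := b') (j := i)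
    ((hasTemperateGrowth_const_smul (hb _) _).add (hasTemperateGrowth_const_smul ht2 _)) hder u
  have h2 : fm b' u = (if i = j then 2 * Real.pi else 0 : ℂ) • bes (-1) u +
      ((2 * Real.pi * (-1) : ℝ) : ℂ) • fm (besselSymbol (-1) * dirSymbol i * dirSymbol j) u := by
    rw [hb', fm_add (hasTemperateGrowth_const_smul (hb _) _) (hasTemperateGrowth_const_smul ht2 _),
      fm_smul (hb _), fm_smul ht2]
  rw [h1, h2]
  refine ⟨-((2 * Real.pi * Complex.I)⁻¹ * (if i = j then 2 * Real.pi else 0 : ℂ)),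
    -((2 * Real.pi * Complex.I)⁻¹ * ((2 * Real.pi * (-1) : ℝ) : ℂ)), ?_⟩
  rw [fm_fm (hb _) (hd _), fm_fm ((hb _).mul (hd _)) (hd j)]
  module

/-- The weighted space `LW s` is stable under the operators `(1 - Δ) ^ (-1 / 2)` and
`P_j (1 - Δ) ^ (-1 / 2)`. -/
structure IsStable (s : ℝ) : Prop where
  bes_mem : ∀ u ∈ LW s, bes (-1) u ∈ LW s
  dir_mem : ∀ j, ∀ u ∈ LW s, fm (dirSymbol j) u ∈ LW s

theorem mulX_mem_LW {s : ℝ} {u : Dist} (i : Fin 3) (hu : u ∈ LW (s + 1)) : mulX i u ∈ LW s := by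
  have h1 : wt s (mulX i u) = smulLeftCLM Spinor (dirWeight i) (wt (s + 1) u) := by
    have h2 : (fun x : R3 => (x i : ℂ)) * weight s = weight (s + 1) * dirWeight i := by
      rw [show weight s = weight (s + 1) * weight (-1) by rw [weight_mul]; congr 1; ring]
      ext x
      simp only [Pi.mul_apply, dirWeight]
      ring
    rw [wt, mulX, smulLeftCLM_smulLeftCLM_apply (hasTemperateGrowth_coord i)
      (hasTemperateGrowth_weight s), h2, smulLeftCLM_smulLeftCLM_apply
      (hasTemperateGrowth_weight _) (hasTemperateGrowth_dirWeight i)]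
  change wt s (mulX i u) ∈ rangeL2
  rw [h1]
  exact smulLeft_mem_rangeL2 (hasTemperateGrowth_dirWeight i) (norm_dirWeight_le i) hu

theorem sum_sq_coord (x : R3) : ∑ i, (x i : ℂ) ^ 2 = ((‖x‖ ^ 2 : ℝ) : ℂ) := by
  rw [EuclideanSpace.norm_sq_eq]
  simp

/-- This is the partition 1 = ⟨x⟩⁻² + ∑ x_i · (x_i ⟨x⟩⁻¹) ⟨x⟩⁻¹. It trades one power of the weight
for one coordinate, and coordinates can be commuted through multipliers. -/
theorem eq_wt_add_sum_mulX (u : Dist) : u = wt (-2) u +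
    ∑ i, mulX i (smulLeftCLM Spinor (dirWeight i) (wt (-1) u)) := by
  have ht : ∀ i ∈ (Finset.univ : Finset (Fin 3)),
      (weight (-1) * dirWeight i * (fun x : R3 => (x i : ℂ))).HasTemperateGrowth := fun i _ =>
    ((hasTemperateGrowth_weight (-1)).mul (hasTemperateGrowth_dirWeight i)).mul
      (hasTemperateGrowth_coord i)
  have h1 : ∀ i, mulX i (smulLeftCLM Spinor (dirWeight i) (wt (-1) u)) =
      smulLeftCLM Spinor (weight (-1) * dirWeight i * (fun x : R3 => (x i : ℂ))) u := by
    intro i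
    rw [mulX, wt, smulLeftCLM_smulLeftCLM_apply (hasTemperateGrowth_weight _)
      (hasTemperateGrowth_dirWeight i), smulLeftCLM_smulLeftCLM_apply
      ((hasTemperateGrowth_weight _).mul (hasTemperateGrowth_dirWeight i))
      (hasTemperateGrowth_coord i)]
  simp_rw [h1]
  have h3 := congrArg (fun T => T u) (smulLeftCLM_sum (F := Spinor) ht)
  simp only [sum_apply] at h3
  rw [← h3]
  have h2 : weight (-2) + (fun x => ∑ i, (weight (-1) * dirWeight i * (fun x : R3 => (x i : ℂ))) x)
      = fun _ => 1 := by
    ext x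
    have h4 : ∀ i, (weight (-1) * dirWeight i * (fun x : R3 => (x i : ℂ))) x =
        (weight (-1) * weight (-1)) x * (x i : ℂ) ^ 2 := by
      intro i; simp only [Pi.mul_apply, dirWeight]; ring
    simp only [Pi.add_apply, h4]
    rw [← Finset.mul_sum, sum_sq_coord, weight_mul]
    have h5 : weight (-2) x * weight 2 x = 1 := by
      have := congrFun (weight_mul (-2) 2) x
      rw [Pi.mul_apply] at this
      rw [this]; norm_num [weight_zero]
    rw [show weight 2 x = ((1 + ‖x‖ ^ 2 : ℝ) : ℂ) by rw [weight, bracket_two]] at h5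
    rw [show (-1 + -1 : ℝ) = -2 by norm_num]
    push_cast at h5 ⊢
    linear_combination h5
  have h6 := congrArg (fun T => T u) (smulLeftCLM_add (F := Spinor) (hasTemperateGrowth_weight (-2))
    (Function.HasTemperateGrowth.sum ht))
  rw [h2] at h6
  simpa using h6

theorem mem_LW_add_one {s : ℝ} {u : Dist} (hu : u ∈ LW s) (hX : ∀ i, mulX i u ∈ LW s) :
    u ∈ LW (s + 1) := by
  have hd := hasTemperateGrowth_dirWeight
  have hw := hasTemperateGrowth_weight
  have hc := hasTemperateGrowth_coord
  rw [eq_wt_add_sum_mulX u]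
  refine add_mem (wt_mem_LW.2 (LW_mono (by linarith) hu)) (sum_mem fun i _ => ?_)
  have h1 : mulX i (smulLeftCLM Spinor (dirWeight i) (wt (-1) u)) =
      wt (-1) (smulLeftCLM Spinor (dirWeight i) (mulX i u)) := by
    rw [mulX, wt, smulLeft_comm (hd i) (hc i), smulLeft_comm (hw _) (hc i),
      smulLeft_comm (hw _) (hd i)]
  rw [h1, wt_mem_LW]
  refine LW_mono (by linarith) (smulLeft_mem_LW (hd i) (norm_dirWeight_le i) (hX i))

/-- To gain a power of the weight it suffices to control x_i times the image. This is the operator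
applied to x_i u, which lies in `LW s`, plus commutators built from operators already known to
preserve `LW s`. -/
theorem IsStable.add_one {s : ℝ} (h : IsStable s) : IsStable (s + 1) := by
  constructor
  · intro u hu
    have hu' := LW_mono (by linarith : s ≤ s + 1) hu
    refine mem_LW_add_one (h.bes_mem _ hu') fun i => ?_
    obtain ⟨c, hc⟩ := mulX_bes i u
    rw [hc]
    exact add_mem (h.bes_mem _ (mulX_mem_LW i hu)) (Submodule.smul_mem _ _
      (h.dir_mem _ _ (h.bes_mem _ (h.bes_mem _ hu'))))
  · intro j u hu
    have hu' := LW_mono (by linarith : s ≤ s + 1) hu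
    refine mem_LW_add_one (h.dir_mem j _ hu') fun i => ?_
    obtain ⟨c, c', hc⟩ := mulX_dir i j u
    rw [hc]
    exact add_mem (add_mem (h.dir_mem j _ (mulX_mem_LW i hu)) (Submodule.smul_mem _ _
      (h.bes_mem _ hu'))) (Submodule.smul_mem _ _
      (h.dir_mem _ _ (h.dir_mem _ _ (h.bes_mem _ hu'))))

/-- Here u is too large for `LW s`, but u = ⟨x⟩⁻² u + ∑ x_i v_i with v_i in `LW s`. The commutator
formula, read backwards, pulls x_i out of the operator, and multiplication by x_i costs exactly one
power. -/
theorem IsStable.sub_one {s : ℝ} (h : IsStable s) : IsStable (s - 1) := by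
  have hv : ∀ (u : Dist), u ∈ LW (s - 1) → ∀ i,
      smulLeftCLM Spinor (dirWeight i) (wt (-1) u) ∈ LW s := by
    intro u hu i
    refine smulLeft_mem_LW (hasTemperateGrowth_dirWeight i) (norm_dirWeight_le i)
      (wt_mem_LW.2 ?_)
    rwa [neg_add_eq_sub]
  have h0 : ∀ (u : Dist), u ∈ LW (s - 1) → wt (-2) u ∈ LW s := by
    intro u hu
    exact wt_mem_LW.2 (LW_mono (by linarith) hu)
  have hX : ∀ i (v : Dist), v ∈ LW s → mulX i v ∈ LW (s - 1) := by
    intro i v hv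
    exact mulX_mem_LW i (by rwa [sub_add_cancel])
  have hm : LW s ≤ LW (s - 1) := LW_mono (by linarith)
  constructor
  · intro u hu
    rw [eq_wt_add_sum_mulX u, map_add, map_sum]
    refine add_mem (hm (h.bes_mem _ (h0 u hu))) (sum_mem fun i _ => ?_)
    obtain ⟨c, hc⟩ := mulX_bes i (smulLeftCLM Spinor (dirWeight i) (wt (-1) u))
    rw [← sub_eq_iff_eq_add] at hc
    rw [← hc]
    exact sub_mem (hX _ _ (h.bes_mem _ (hv u hu i))) (Submodule.smul_mem _ _
      (hm (h.dir_mem _ _ (h.bes_mem _ (h.bes_mem _ (hv u hu i))))))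
  · intro j u hu
    rw [eq_wt_add_sum_mulX u, map_add, map_sum]
    refine add_mem (hm (h.dir_mem j _ (h0 u hu))) (sum_mem fun i _ => ?_)
    obtain ⟨c, c', hc⟩ := mulX_dir i j (smulLeftCLM Spinor (dirWeight i) (wt (-1) u))
    rw [← sub_eq_iff_eq_add, ← sub_eq_iff_eq_add] at hc
    rw [← hc]
    exact sub_mem (sub_mem (hX _ _ (h.dir_mem j _ (hv u hu i))) (Submodule.smul_mem _ _
      (hm (h.dir_mem _ _ (h.dir_mem _ _ (h.bes_mem _ (hv u hu i)))))))
      (Submodule.smul_mem _ _ (hm (h.bes_mem _ (hv u hu i))))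

theorem isStable_zero : IsStable 0 := by
  constructor
  · intro u hu
    rw [mem_LW_zero] at hu ⊢
    exact fm_mem_rangeL2 (hasTemperateGrowth_besselSymbol _)
      (norm_besselSymbol_le (by norm_num)) hu
  · intro j u hu
    rw [mem_LW_zero] at hu ⊢
    exact fm_mem_rangeL2 (hasTemperateGrowth_dirSymbol _) (norm_dirSymbol_le j) hu

theorem isStable_natCast (n : ℕ) : IsStable n ∧ IsStable (-n) := by
  induction n with
  | zero => simpa using isStable_zero
  | succ n ih =>
    refine ⟨by simpa using ih.1.add_one, ?_⟩
    have := ih.2.sub_one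
    push_cast
    rwa [neg_add']

/-! ### Functions in `L²` -/

theorem lintegral_enorm_sq (f : L2) : ∫⁻ x, ‖f x‖ₑ ^ 2 = ‖f‖ₑ ^ 2 := by
  rw [Lp.enorm_def, eLpNorm_eq_lintegral_rpow_enorm_toReal (by norm_num) (by norm_num)]
  rw [← ENNReal.rpow_natCast, ← ENNReal.rpow_mul]
  simp

theorem lintegral_enorm_sq_le (T : L2 →L[ℂ] L2) (f : L2) :
    ∫⁻ x, ‖T f x‖ₑ ^ 2 ≤ ‖T‖ₑ ^ 2 * ∫⁻ x, ‖f x‖ₑ ^ 2 := by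
  rw [lintegral_enorm_sq, lintegral_enorm_sq, ← mul_pow]
  gcongr
  exact T.le_opENorm f

theorem memLp_two_of_lintegral {f : R3 → Spinor} (hf : AEStronglyMeasurable f volume)
    (h : ∫⁻ x, ‖f x‖ₑ ^ 2 < ∞) : MemLp f 2 (volume : Measure R3) := by
  refine ⟨hf, ?_⟩
  rw [eLpNorm_lt_top_iff_lintegral_rpow_enorm_lt_top (by norm_num) (by norm_num)]
  simpa using h

/-- Multiplication by a bounded matrix-valued function. -/
theorem exists_mulOp {M : R3 → Spinor →L[ℂ] Spinor} (hM : AEStronglyMeasurable M volume) {C : ℝ}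
    (hC : ∀ x, ‖M x‖ ≤ C) : ∃ T : L2 →L[ℂ] L2, ∀ g : L2, T g =ᵐ[volume] fun x => M x (g x) := by
  have hmem : ∀ g : L2, MemLp (fun x => M x (g x)) 2 (volume : Measure R3) := by
    intro g
    refine MemLp.of_le_mul (c := C) (Lp.memLp g) ?_ (Filter.Eventually.of_forall fun x => ?_)
    · exact (ContinuousLinearMap.apply ℂ Spinor).aestronglyMeasurable_comp₂
        (Lp.aestronglyMeasurable g) hM
    · exact ((M x).le_opNorm _).trans (by gcongr; exact hC x)
  let L : L2 →ₗ[ℂ] L2 :=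
    { toFun := fun g => (hmem g).toLp _
      map_add' := fun f g => by
        ext1
        filter_upwards [(hmem (f + g)).coeFn_toLp, (hmem f).coeFn_toLp, (hmem g).coeFn_toLp,
          Lp.coeFn_add f g, Lp.coeFn_add ((hmem f).toLp _) ((hmem g).toLp _)] with x h1 h2 h3 h4 h5
        rw [h1, h5, Pi.add_apply, h2, h3, h4, Pi.add_apply, map_add]
      map_smul' := fun c g => by
        ext1
        filter_upwards [(hmem (c • g)).coeFn_toLp, (hmem g).coeFn_toLp,
          Lp.coeFn_smul c g, Lp.coeFn_smul c ((hmem g).toLp _)] with x h1 h2 h4 h5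
        rw [h1, RingHom.id_apply, h5, Pi.smul_apply, h2, h4, Pi.smul_apply, map_smul] }
  have hb : ∀ g, ‖L g‖ ≤ C * ‖g‖ := by
    intro g
    refine Lp.norm_le_mul_norm_of_ae_le_mul ?_
    filter_upwards [(hmem g).coeFn_toLp] with x h1
    change ‖(hmem g).toLp _ x‖ ≤ _
    rw [h1]
    exact ((M x).le_opNorm _).trans (by gcongr; exact hC x)
  exact ⟨L.mkContinuous C hb, fun g => (hmem g).coeFn_toLp⟩

theorem exists_smulOp {m : R3 → ℂ} (hm : AEStronglyMeasurable m volume) {C : ℝ}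
    (hC : ∀ x, ‖m x‖ ≤ C) : ∃ T : L2 →L[ℂ] L2, ∀ g : L2, T g =ᵐ[volume] fun x => m x • g x := by
  obtain ⟨T, hT⟩ := exists_mulOp (M := fun x => m x • ContinuousLinearMap.id ℂ Spinor)
    (hm.smul_const _) (C := C * ‖ContinuousLinearMap.id ℂ Spinor‖) fun x => by
      rw [norm_smul]; gcongr; exact hC x
  exact ⟨T, hT⟩

theorem ofL2_apply (g : L2) (φ : 𝓢(R3, ℂ)) : ofL2 g φ = ∫ x, φ x • g x :=
  Lp.toTemperedDistribution_apply g φ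

theorem ofL2_eq_smulLeft {m : R3 → ℂ} (hm : m.HasTemperateGrowth) {g g' : L2}
    (h : g' =ᵐ[volume] fun x => m x • g x) : ofL2 g' = smulLeftCLM Spinor m (ofL2 g) := by
  ext1 φ
  rw [smulLeftCLM_apply_apply, ofL2_apply, ofL2_apply]
  refine integral_congr_ae ?_
  filter_upwards [h] with x hx
  rw [hx, SchwartzMap.smulLeftCLM_apply_apply hm, smul_eq_mul, mul_comm, mul_smul, smul_comm]

theorem ofL2_eq_wt_iff {r : ℝ} {g g' : L2} :
    ofL2 g' = wt r (ofL2 g) ↔ g' =ᵐ[volume] fun x => weight r x • g x := by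
  refine ⟨fun h => ?_, ofL2_eq_smulLeft (hasTemperateGrowth_weight r)⟩
  have key : ∀ (r : ℝ) (g g' : L2), r ≤ 0 → ofL2 g' = wt r (ofL2 g) →
      g' =ᵐ[volume] fun x => weight r x • g x := by
    intro r g g' hr h
    obtain ⟨T, hT⟩ := exists_smulOp (m := weight r) (C := 1)
      (hasTemperateGrowth_weight r).1.continuous.aestronglyMeasurable
      (fun x => by rw [norm_weight]; exact bracket_le_one hr x)
    have h1 : ofL2 (T g) = ofL2 g' := by
      rw [h, ofL2_eq_smulLeft (hasTemperateGrowth_weight r) (hT g)]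
    rw [← ofL2_injective h1]
    exact hT g
  rcases le_total r 0 with hr | hr
  · exact key r g g' hr h
  · have h1 := key (-r) g' g (by linarith) (by rw [h, wt_neg_wt])
    filter_upwards [h1] with x hx
    rw [hx, smul_smul, ← Pi.mul_apply, weight_mul, add_neg_cancel, weight_zero, one_smul]

/-! ### Interpolation between weighted `L²` spaces -/

theorem enorm_sq_eq_ofReal {E : Type*} [SeminormedAddCommGroup E] (z : E) :
    ‖z‖ₑ ^ 2 = ENNReal.ofReal (‖z‖ ^ 2) := by
  rw [ENNReal.ofReal_pow (norm_nonneg _), ofReal_norm]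

theorem integrableOn_rpow_div {θ : ℝ} (h0 : 0 < θ) (h1 : θ < 1) :
    IntegrableOn (fun t : ℝ => t ^ (1 - 2 * θ) / (1 + t ^ 2)) (Set.Ioi 0) := by
  have hm : Measurable fun t : ℝ => t ^ (1 - 2 * θ) / (1 + t ^ 2) := by fun_prop
  rw [← Set.Ioc_union_Ioi_eq_Ioi zero_le_one]
  refine IntegrableOn.union ?_ ?_
  · have h2 : IntegrableOn (fun t : ℝ => t ^ (1 - 2 * θ)) (Set.Ioc 0 1) :=
      (intervalIntegrable_iff_integrableOn_Ioc_of_le zero_le_one).1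
        (intervalIntegral.intervalIntegrable_rpow' (by linarith))
    refine Integrable.mono' h2 hm.aestronglyMeasurable ?_
    refine (ae_restrict_iff' measurableSet_Ioc).2 (Filter.Eventually.of_forall fun t ht => ?_)
    have hp : 0 < t ^ (1 - 2 * θ) := Real.rpow_pos_of_pos ht.1 _
    rw [Real.norm_of_nonneg (by positivity)]
    exact div_le_self hp.le (by nlinarith [sq_nonneg t])
  · have h2 : IntegrableOn (fun t : ℝ => t ^ (-1 - 2 * θ)) (Set.Ioi 1) :=
      integrableOn_Ioi_rpow_of_lt (by linarith) one_pos
    refine Integrable.mono' h2 hm.aestronglyMeasurable ?_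
    refine (ae_restrict_iff' measurableSet_Ioi).2 (Filter.Eventually.of_forall fun t ht => ?_)
    have ht0 : 0 < t := one_pos.trans ht
    have hp : 0 < t ^ (-1 - 2 * θ) := Real.rpow_pos_of_pos ht0 _
    have h3 : t ^ (1 - 2 * θ) = t ^ (-1 - 2 * θ) * t ^ 2 := by
      rw [← Real.rpow_natCast, ← Real.rpow_add ht0]; congr 1; push_cast; ring
    rw [Real.norm_of_nonneg (by positivity), h3, div_le_iff₀ (by positivity)]
    gcongr
    linarith

/-- The substitution t ↦ v t extracts the homogeneity in v. The constant is positive and finite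
because 0 < θ < 1, so it can be cancelled in the interpolation inequality. -/
theorem exists_lintegral_rpow_div {θ : ℝ} (h0 : 0 < θ) (h1 : θ < 1) :
    ∃ c : ℝ≥0∞, c ≠ 0 ∧ c ≠ ∞ ∧ ∀ v : ℝ, 0 < v →
      ∫⁻ t in Set.Ioi (0 : ℝ), ENNReal.ofReal (t ^ (1 - 2 * θ) / (v ^ 2 + t ^ 2)) =
        ENNReal.ofReal (v ^ (-(2 * θ))) * c := by
  set f : ℝ → ℝ := fun t => t ^ (1 - 2 * θ) / (1 + t ^ 2) with hf
  have hint := integrableOn_rpow_div h0 h1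
  have hpos : ∀ t ∈ Set.Ioi (0 : ℝ), 0 < f t := fun t ht =>
    div_pos (Real.rpow_pos_of_pos ht _) (by positivity)
  have hJ : 0 < ∫ t in Set.Ioi (0 : ℝ), f t := by
    rw [setIntegral_pos_iff_support_of_nonneg_ae
      ((ae_restrict_iff' measurableSet_Ioi).2 (Filter.Eventually.of_forall fun t ht =>
        (hpos t ht).le)) hint]
    have : Function.support f ∩ Set.Ioi 0 = Set.Ioi 0 :=
      Set.inter_eq_right.2 fun t ht => (hpos t ht).ne'
    rw [this]
    simp
  refine ⟨ENNReal.ofReal (∫ t in Set.Ioi (0 : ℝ), f t), by simpa using hJ,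
    ENNReal.ofReal_ne_top, fun v hv => ?_⟩
  have hv' : 0 < v⁻¹ := inv_pos.2 hv
  have h3 : ∀ t ∈ Set.Ioi (0 : ℝ), t ^ (1 - 2 * θ) / (v ^ 2 + t ^ 2) =
      v ^ (-1 - 2 * θ) * f (v⁻¹ * t) := by
    intro t ht
    have ht' : (0 : ℝ) < t := ht
    have h4 : v ^ (1 - 2 * θ) = v ^ (-1 - 2 * θ) * v ^ 2 := by
      rw [← Real.rpow_natCast, ← Real.rpow_add hv]; congr 1; push_cast; ring
    have h5 : (v⁻¹ * t) ^ (1 - 2 * θ) = t ^ (1 - 2 * θ) / v ^ (1 - 2 * θ) := by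
      rw [← div_eq_inv_mul, Real.div_rpow ht'.le hv.le]
    have h6 : (0 : ℝ) < v ^ (-1 - 2 * θ) := Real.rpow_pos_of_pos hv _
    simp only [hf]
    rw [h5, h4]
    field_simp
  have hi : IntegrableOn (fun t => v ^ (-1 - 2 * θ) * f (v⁻¹ * t)) (Set.Ioi 0) := by
    refine Integrable.const_mul ?_ _
    have := (integrableOn_Ioi_comp_mul_left_iff f 0 hv').2 (by simpa using hint)
    exact this
  rw [setLIntegral_congr_fun measurableSet_Ioi fun t ht => by rw [h3 t ht],
    ← ofReal_integral_eq_lintegral_ofReal hi ((ae_restrict_iff' measurableSet_Ioi).2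
      (Filter.Eventually.of_forall fun t ht => ?_)), integral_const_mul,
    integral_comp_mul_left_Ioi f 0 hv', mul_zero, ← ENNReal.ofReal_mul (by positivity)]
  · congr 1
    rw [inv_inv, smul_eq_mul, ← mul_assoc]
    congr 1
    nth_rewrite 2 [← Real.rpow_one v]
    rw [← Real.rpow_add hv]
    congr 1; ring
  · have ht' : (0 : ℝ) < t := ht
    exact mul_nonneg (by positivity) (hpos _ (mul_pos hv' ht')).le

/-- Cauchy-Schwarz: any splitting a + v k has ‖a‖² + l² ‖k‖² at least as large as the optimal
splitting of the same vector. -/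
theorem weighted_norm_sq_add_le {v l : ℝ} (hl : 0 < l) (hv : 0 < v) (a k : Spinor) :
    l ^ 2 / (v ^ 2 + l ^ 2) * ‖a + (v : ℂ) • k‖ ^ 2 ≤ ‖a‖ ^ 2 + l ^ 2 * ‖k‖ ^ 2 := by
  have h1 : ‖a + (v : ℂ) • k‖ ≤ ‖a‖ + v * ‖k‖ := by
    refine (norm_add_le _ _).trans ?_
    rw [norm_smul, Complex.norm_real, Real.norm_of_nonneg hv.le]
  rw [div_mul_eq_mul_div, div_le_iff₀ (by positivity)]
  calc l ^ 2 * ‖a + (v : ℂ) • k‖ ^ 2 ≤ l ^ 2 * (‖a‖ + v * ‖k‖) ^ 2 := by gcongr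
    _ ≤ (‖a‖ ^ 2 + l ^ 2 * ‖k‖ ^ 2) * (v ^ 2 + l ^ 2) := by
        nlinarith [sq_nonneg (v * ‖a‖ - l ^ 2 * ‖k‖)]

/-- The two integrals are quadratic K-functionals at parameter l. The function h is split optimally
as a + v k with k = v h / (v² + l²). The bounds of `Tm` on a and of `Tp` on k then control one
splitting of `Tm h`, hence its K-functional from above. -/
theorem lintegral_interpolation {v : R3 → ℝ} (hv : Measurable v) (hpos : ∀ x, 0 < v x)
    (hle : ∀ x, v x ≤ 1) (Tm Tp : L2 →L[ℂ] L2)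
    (hT : ∀ h k : L2, h =ᵐ[volume] (fun x => (v x : ℂ) • k x) →
      Tm h =ᵐ[volume] fun x => (v x : ℂ) • Tp k x) (h : L2) {l : ℝ} (hl : 0 < l) :
    ∫⁻ x, ENNReal.ofReal (l ^ 2 / (v x ^ 2 + l ^ 2)) * ‖Tm h x‖ₑ ^ 2 ≤
      (‖Tm‖ₑ ^ 2 + ‖Tp‖ₑ ^ 2) *
        ∫⁻ x, ENNReal.ofReal (l ^ 2 / (v x ^ 2 + l ^ 2)) * ‖h x‖ₑ ^ 2 := by
  obtain ⟨S, hS⟩ := exists_smulOp (m := fun x => ((v x / (v x ^ 2 + l ^ 2) : ℝ) : ℂ))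
    (C := 1 / l ^ 2) (Complex.measurable_ofReal.comp
      (by fun_prop : Measurable fun x => v x / (v x ^ 2 + l ^ 2))).aestronglyMeasurable
    (fun x => by
      have := hpos x
      rw [Complex.norm_real, Real.norm_of_nonneg (by positivity)]
      exact div_le_div₀ zero_le_one (hle x) (by positivity) (by nlinarith))
  obtain ⟨V, hV⟩ := exists_smulOp (m := fun x => (v x : ℂ)) (C := 1)
    (Complex.measurable_ofReal.comp hv).aestronglyMeasurable (fun x => by
      rw [Complex.norm_real, Real.norm_of_nonneg (hpos x).le]; exact hle x)
  set k := S h with hk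
  set a := h - V k with ha
  have ha' : a =ᵐ[volume] fun x => ((l ^ 2 / (v x ^ 2 + l ^ 2) : ℝ) : ℂ) • h x := by
    filter_upwards [hS h, hV k, Lp.coeFn_sub h (V k)] with x h1 h2 h3
    have := hpos x
    rw [ha, h3, Pi.sub_apply, h2, h1, smul_smul, ← Complex.ofReal_mul]
    nth_rewrite 1 [← one_smul ℂ (h x)]
    rw [← sub_smul, ← Complex.ofReal_one, ← Complex.ofReal_sub]
    congr 2
    field_simp
    ring
  have hTh : Tm h =ᵐ[volume] fun x => Tm a x + (v x : ℂ) • Tp k x := by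
    have h1 : h = a + V k := by rw [ha, sub_add_cancel]
    have h2 : Tm h = Tm a + Tm (V k) := by rw [← map_add, ← h1]
    rw [h2]
    filter_upwards [Lp.coeFn_add (Tm a) (Tm (V k)), hT (V k) k (hV k)] with x h3 h4
    rw [h3, Pi.add_apply, h4]
  have e1 : ∀ᵐ x, ENNReal.ofReal (l ^ 2 / (v x ^ 2 + l ^ 2)) * ‖h x‖ₑ ^ 2 =
      ‖a x‖ₑ ^ 2 + ENNReal.ofReal (l ^ 2) * ‖k x‖ₑ ^ 2 := by
    filter_upwards [ha', hS h] with x h1 h2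
    have := hpos x
    rw [h1, h2]
    simp only [enorm_sq_eq_ofReal]
    rw [← ENNReal.ofReal_mul (by positivity), ← ENNReal.ofReal_mul (by positivity),
      ← ENNReal.ofReal_add (by positivity) (by positivity), norm_smul, norm_smul,
      Complex.norm_real, Complex.norm_real, Real.norm_of_nonneg (by positivity),
      Real.norm_of_nonneg (by positivity)]
    congr 1
    field_simp
    ring
  have e2 : ∀ᵐ x, ENNReal.ofReal (l ^ 2 / (v x ^ 2 + l ^ 2)) * ‖Tm h x‖ₑ ^ 2 ≤
      ‖Tm a x‖ₑ ^ 2 + ENNReal.ofReal (l ^ 2) * ‖Tp k x‖ₑ ^ 2 := by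
    filter_upwards [hTh] with x h1
    have := hpos x
    rw [h1]
    simp only [enorm_sq_eq_ofReal]
    rw [← ENNReal.ofReal_mul (by positivity), ← ENNReal.ofReal_mul (by positivity),
      ← ENNReal.ofReal_add (by positivity) (by positivity)]
    exact ENNReal.ofReal_le_ofReal (weighted_norm_sq_add_le hl (hpos x) _ _)
  have hmeas : ∀ f : L2, AEMeasurable (fun x => ‖f x‖ₑ ^ 2) volume := fun f =>
    (Lp.aestronglyMeasurable f).enorm.pow_const 2
  rw [lintegral_congr_ae e1]
  refine (lintegral_mono_ae e2).trans ?_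
  rw [lintegral_add_left' (hmeas _), lintegral_add_left' (hmeas _),
    lintegral_const_mul'' _ (hmeas _), lintegral_const_mul'' _ (hmeas _), mul_add]
  refine add_le_add ((lintegral_enorm_sq_le Tm a).trans ?_) ?_
  · gcongr; exact le_self_add
  · rw [← mul_assoc, mul_comm _ (ENNReal.ofReal (l ^ 2)), mul_assoc]
    gcongr
    refine (lintegral_enorm_sq_le Tp k).trans ?_
    gcongr; exact le_add_self

/-- Integrating the inequality for the K-functionals against t^(-1-2θ) dt and exchanging integrals
gives, up to one constant on both sides, the L² norm with weight v^(-2θ). Only finiteness of the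
result is needed. -/
theorem exists_eq_rpow_smul_of_interpolation {θ : ℝ} (h0 : 0 < θ) (h1 : θ < 1) {v : R3 → ℝ}
    (hv : Measurable v) (hpos : ∀ x, 0 < v x) (hle : ∀ x, v x ≤ 1) (Tm Tp : L2 →L[ℂ] L2)
    (hT : ∀ h k : L2, h =ᵐ[volume] (fun x => (v x : ℂ) • k x) →
      Tm h =ᵐ[volume] fun x => (v x : ℂ) • Tp k x) {h g : L2}
    (hg : h =ᵐ[volume] fun x => ((v x ^ θ : ℝ) : ℂ) • g x) :
    ∃ g' : L2, Tm h =ᵐ[volume] fun x => ((v x ^ θ : ℝ) : ℂ) • g' x := by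
  obtain ⟨c, hc0, hc1, hc⟩ := exists_lintegral_rpow_div h0 h1
  set K := ‖Tm‖ₑ ^ 2 + ‖Tp‖ₑ ^ 2 with hK
  have hKtop : K ≠ ∞ := by simp [hK]
  have swap : ∀ f : L2, ∫⁻ t in Set.Ioi (0 : ℝ), ENNReal.ofReal (t ^ (-1 - 2 * θ)) *
      (∫⁻ x, ENNReal.ofReal (t ^ 2 / (v x ^ 2 + t ^ 2)) * ‖f x‖ₑ ^ 2) =
      c * ∫⁻ x, ‖f x‖ₑ ^ 2 * ENNReal.ofReal (v x ^ (-(2 * θ))) := by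
    intro f
    have hmeas : AEMeasurable (fun x => ‖f x‖ₑ ^ 2) volume :=
      (Lp.aestronglyMeasurable f).enorm.pow_const 2
    have hvm : Measurable fun p : ℝ × R3 => ENNReal.ofReal (p.1 ^ 2 / (v p.2 ^ 2 + p.1 ^ 2)) := by
      fun_prop
    calc _ = ∫⁻ t in Set.Ioi (0 : ℝ), ∫⁻ x, ENNReal.ofReal (t ^ (-1 - 2 * θ)) *
          (ENNReal.ofReal (t ^ 2 / (v x ^ 2 + t ^ 2)) * ‖f x‖ₑ ^ 2) := by
          refine lintegral_congr fun t => ?_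
          rw [lintegral_const_mul'' _ (by fun_prop)]
      _ = ∫⁻ x, ∫⁻ t in Set.Ioi (0 : ℝ), ENNReal.ofReal (t ^ (-1 - 2 * θ)) *
          (ENNReal.ofReal (t ^ 2 / (v x ^ 2 + t ^ 2)) * ‖f x‖ₑ ^ 2) := by
          refine lintegral_lintegral_swap ?_
          refine AEMeasurable.mul (by fun_prop) (hvm.aemeasurable.mul ?_)
          exact hmeas.comp_quasiMeasurePreserving Measure.quasiMeasurePreserving_snd
      _ = ∫⁻ x, c * (‖f x‖ₑ ^ 2 * ENNReal.ofReal (v x ^ (-(2 * θ)))) := by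
          refine lintegral_congr fun x => ?_
          have e1 : ∀ t ∈ Set.Ioi (0 : ℝ), ENNReal.ofReal (t ^ (-1 - 2 * θ)) *
              (ENNReal.ofReal (t ^ 2 / (v x ^ 2 + t ^ 2)) * ‖f x‖ₑ ^ 2) =
              ENNReal.ofReal (t ^ (1 - 2 * θ) / (v x ^ 2 + t ^ 2)) * ‖f x‖ₑ ^ 2 := by
            intro t ht
            have ht0 : (0 : ℝ) < t := ht
            rw [← mul_assoc, ← ENNReal.ofReal_mul (by positivity)]
            congr 2
            rw [← mul_div_assoc]
            congr 1
            rw [← Real.rpow_natCast, ← Real.rpow_add ht0]; congr 1; push_cast; ring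
          rw [setLIntegral_congr_fun measurableSet_Ioi e1, lintegral_mul_const _ (by fun_prop),
            hc _ (hpos x)]
          ring
      _ = _ := by
          rw [lintegral_const_mul'' _ (by fun_prop)]
  have hfin : ∫⁻ x, ‖Tm h x‖ₑ ^ 2 * ENNReal.ofReal (v x ^ (-(2 * θ))) < ∞ := by
    have e1 : c * ∫⁻ x, ‖Tm h x‖ₑ ^ 2 * ENNReal.ofReal (v x ^ (-(2 * θ))) ≤
        K * (c * ∫⁻ x, ‖h x‖ₑ ^ 2 * ENNReal.ofReal (v x ^ (-(2 * θ)))) := by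
      rw [← swap, ← swap, ← lintegral_const_mul' _ _ hKtop]
      refine setLIntegral_mono' measurableSet_Ioi fun t ht => ?_
      rw [mul_left_comm]
      gcongr
      exact lintegral_interpolation hv hpos hle Tm Tp hT h ht
    have e2 : ∫⁻ x, ‖h x‖ₑ ^ 2 * ENNReal.ofReal (v x ^ (-(2 * θ))) = ∫⁻ x, ‖g x‖ₑ ^ 2 := by
      refine lintegral_congr_ae ?_
      filter_upwards [hg] with x hx
      have hp := hpos x
      rw [hx]
      simp only [enorm_sq_eq_ofReal]
      rw [← ENNReal.ofReal_mul (by positivity), norm_smul, Complex.norm_real,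
        Real.norm_of_nonneg (by positivity), mul_pow, mul_right_comm, ← Real.rpow_natCast,
        ← Real.rpow_mul hp.le, ← Real.rpow_add hp]
      have : θ * (2 : ℕ) + -(2 * θ) = 0 := by push_cast; ring
      rw [this, Real.rpow_zero, one_mul]
    rw [e2, lintegral_enorm_sq] at e1
    have e3 : K * (c * ‖g‖ₑ ^ 2) < ∞ :=
      ENNReal.mul_lt_top hKtop.lt_top (ENNReal.mul_lt_top hc1.lt_top (by simp))
    have e4 := e1.trans_lt e3
    rcases ENNReal.mul_lt_top_iff.1 e4 with h | h | h
    · exact h.2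
    · exact absurd h hc0
    · rw [h]; simp
  have hmem : MemLp (fun x => ((v x ^ (-θ) : ℝ) : ℂ) • Tm h x) 2 (volume : Measure R3) := by
    refine memLp_two_of_lintegral ?_ ?_
    · exact (by fun_prop : Measurable fun x =>
        ((v x ^ (-θ) : ℝ) : ℂ)).aestronglyMeasurable.smul (Lp.aestronglyMeasurable _)
    · refine lt_of_le_of_lt (le_of_eq (lintegral_congr fun x => ?_)) hfin
      have hp := hpos x
      simp only [enorm_sq_eq_ofReal]
      rw [← ENNReal.ofReal_mul (by positivity), norm_smul, Complex.norm_real,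
        Real.norm_of_nonneg (by positivity), mul_pow, mul_comm, ← Real.rpow_natCast (v x ^ (-θ)),
        ← Real.rpow_mul hp.le]
      congr 3; push_cast; ring
  refine ⟨hmem.toLp _, ?_⟩
  filter_upwards [hmem.coeFn_toLp] with x hx
  rw [hx, smul_smul, ← Complex.ofReal_mul, ← Real.rpow_add (hpos x), add_neg_cancel, Real.rpow_zero,
    Complex.ofReal_one, one_smul]

theorem weight_natCast_rpow (N θ : ℝ) (x : R3) :
    ((bracket N x ^ θ : ℝ) : ℂ) = weight (N * θ) x := by
  rw [bracket_rpow, weight]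

theorem mem_LW_of_interpolation {Φ : Dist →L[ℂ] Dist} {N : ℝ} (h1 : ∀ u ∈ LW N, Φ u ∈ LW N)
    (h2 : ∀ u ∈ LW (-N), Φ u ∈ LW (-N)) {s : ℝ} (hs : |s| < N) {u : Dist} (hu : u ∈ LW s) :
    Φ u ∈ LW s := by
  obtain ⟨hs1, hs2⟩ := abs_lt.1 hs
  have hN : 0 < N := (abs_nonneg s).trans_lt hs
  obtain ⟨Tp, hTp⟩ := exists_clm_of_rangeL2 (wt N ∘L Φ ∘L wt (-N)) fun g =>
    h1 _ (wt_neg_ofL2_mem_LW N g)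
  obtain ⟨Tm, hTm⟩ := exists_clm_of_rangeL2 (wt (-N) ∘L Φ ∘L wt (- -N)) fun g =>
    h2 _ (wt_neg_ofL2_mem_LW (-N) g)
  simp only [ContinuousLinearMap.comp_apply, neg_neg] at hTp hTm
  obtain ⟨g, hg⟩ := hu
  have hg' : ofL2 g = wt s u := hg
  obtain ⟨h, hh⟩ := LW_mono hs1.le (⟨g, hg⟩ : u ∈ LW s)
  have hh' : ofL2 h = wt (-N) u := hh
  have hv : (fun x => ((bracket (-(2 * N)) x : ℝ) : ℂ)) = weight (-(2 * N)) := rfl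
  have hθ : -(2 * N) * ((N + s) / (2 * N)) = -(N + s) := by field_simp
  -- The base space is `LW (-N)`, identified with L² by ⟨x⟩^(-N), and v = ⟨x⟩^(-2N) leads from it to
  -- `LW N`. With θ = (N + s) / (2N) one has v^θ = ⟨x⟩^(-(N+s)), which is the intermediate space `LW
  -- s`.
  obtain ⟨g', hg''⟩ := exists_eq_rpow_smul_of_interpolation (θ := (N + s) / (2 * N))
    (v := bracket (-(2 * N))) (div_pos (by linarith) (by linarith))
    ((div_lt_one (by linarith)).2 (by linarith)) (continuous_bracket _).measurable
    (bracket_pos _) (bracket_le_one (by linarith)) Tm Tp (fun a k hak => by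
      have e1 : ofL2 a = wt (-(2 * N)) (ofL2 k) := ofL2_eq_wt_iff.2 hak
      refine ofL2_eq_wt_iff.1 ?_
      rw [hTm, hTp, e1, wt_wt, wt_wt]
      have e2 : -(2 * N) + N = -N := by ring
      have e3 : N + -(2 * N) = -N := by ring
      rw [e2, e3]) (h := h) (g := g) (by
      simp only [weight_natCast_rpow, hθ]
      refine ofL2_eq_wt_iff.1 ?_
      rw [hh', hg', wt_wt]
      congr 2; ring)
  simp only [weight_natCast_rpow, hθ] at hg''
  refine ⟨g', ?_⟩
  change ofL2 g' = wt s (Φ u)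
  have e1 := ofL2_eq_wt_iff.2 hg''
  rw [hTm, hh', wt_wt_neg] at e1
  have e2 := congrArg (wt (N + s)) e1
  rw [wt_wt_neg, wt_wt] at e2
  rw [← e2]
  congr 2; ring

theorem isStable (s : ℝ) : IsStable s := by
  obtain ⟨n, hn⟩ := exists_nat_gt |s|
  obtain ⟨h1, h2⟩ := isStable_natCast n
  exact ⟨fun u hu => mem_LW_of_interpolation h1.bes_mem h2.bes_mem hn hu,
    fun j u hu => mem_LW_of_interpolation (h1.dir_mem j) (h2.dir_mem j) hn hu⟩

/-! ### Weighted Sobolev spaces of order one -/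

theorem hasLineDerivAt_weight (k : ℝ) (i : Fin 3) (x : R3) :
    HasLineDerivAt ℝ (weight k) ((k : ℂ) * (dirWeight i x * weight (k - 1) x)) x (axis i) := by
  have hpos : (0 : ℝ) < 1 + ‖x‖ ^ 2 := by positivity
  have h0 : HasDerivAt (fun t : ℝ => x + t • axis i) (axis i) 0 := by
    have := ((hasDerivAt_id (0 : ℝ)).smul_const (axis i)).const_add x
    rw [one_smul] at this
    exact this
  have h1 := (h0.norm_sq.const_add 1).rpow_const (p := k / 2) (Or.inl (by simpa using hpos.ne'))
  have h2 := h1.ofReal_comp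
  change HasDerivAt (fun t : ℝ => weight k (x + t • axis i)) _ 0
  convert! h2 using 1
  have h3 : weight (-1) x * weight (k - 1) x = weight (k - 2) x := by
    rw [← Pi.mul_apply, weight_mul]; congr 1; ring
  rw [dirWeight, mul_assoc, h3]
  simp only [zero_smul, add_zero, ← coord_eq_inner, weight, bracket]
  rw [show (k - 2) / 2 = k / 2 - 1 by ring]
  push_cast
  ring

theorem momentum_wt (j : Fin 3) (r : ℝ) (u : Dist) : momentum j (wt r u) =
    wt r (momentum j u) +
      (-Complex.I * r) • smulLeftCLM Spinor (dirWeight j) (wt (r - 1) u) := by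
  have hd := hasTemperateGrowth_dirWeight j
  have hw := hasTemperateGrowth_weight
  have h1 : (fun x => (r : ℂ) * (dirWeight j x * weight (r - 1) x)) =
      (r : ℂ) • (weight (r - 1) * dirWeight j) := by
    ext x; simp only [Pi.smul_apply, Pi.mul_apply, smul_eq_mul]; ring
  rw [momentum, wt, lineDeriv_smulLeft (hw r) (g' := fun x => (r : ℂ) * (dirWeight j x *
    weight (r - 1) x)) ((Function.HasTemperateGrowth.const _).mul (hd.mul (hw _)))
    (hasLineDerivAt_weight r j), h1, smulLeftCLM_smul ((hw _).mul hd), momentum,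
    smulLeftCLM_smulLeftCLM_apply (hw _) hd, map_smul]
  rw [smul_apply]
  module

theorem bes_two_eq (u : Dist) : bes 2 u = u + ∑ j, momentum j (momentum j u) := by
  have hm := hasTemperateGrowth_momSymbol
  have h1 : besselSymbol 2 = besselSymbol 0 + fun ξ => ∑ j, (momSymbol j * momSymbol j) ξ := by
    ext ξ
    have h2 : ∀ j, (momSymbol j * momSymbol j) ξ = (2 * Real.pi : ℂ) ^ 2 * (ξ j : ℂ) ^ 2 := by
      intro j; simp only [Pi.mul_apply, momSymbol]; push_cast; ring
    simp only [Pi.add_apply, h2]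
    rw [← Finset.mul_sum, sum_sq_coord, besselSymbol_zero, besselSymbol, weight, bracket_two,
      norm_smul, mul_pow, Real.norm_of_nonneg (by positivity)]
    push_cast
    rfl
  have h3 : ∀ j ∈ (Finset.univ : Finset (Fin 3)), (momSymbol j * momSymbol j).HasTemperateGrowth :=
    fun j _ => (hm j).mul (hm j)
  rw [bes, h1, fm_add (hasTemperateGrowth_besselSymbol 0) (Function.HasTemperateGrowth.sum h3),
    show fm (fun ξ => ∑ j, (momSymbol j * momSymbol j) ξ) = _ from
      fourierMultiplierCLM_sum Spinor h3, sum_apply]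
  have h4 := bes_zero u
  rw [bes, fm] at h4
  rw [h4]
  congr 1
  refine Finset.sum_congr rfl fun j _ => ?_
  rw [momentum_eq_fm, momentum_eq_fm, fm_fm (hm j) (hm j)]

theorem momentum_bes_neg_one (j : Fin 3) (u : Dist) :
    momentum j (bes (-1) u) = fm (dirSymbol j) u := by
  rw [momentum_eq_fm, bes, fm_fm (hasTemperateGrowth_besselSymbol _)
    (hasTemperateGrowth_momSymbol j), mul_comm]
  rfl

theorem bes_neg_one_momentum (j : Fin 3) (u : Dist) :
    bes (-1) (momentum j u) = fm (dirSymbol j) u := by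
  rw [momentum_eq_fm, bes, fm_fm (hasTemperateGrowth_momSymbol j)
    (hasTemperateGrowth_besselSymbol _)]
  rfl

/-- One direction writes u and P_j u as order-zero operators applied to (1 - Δ)^(1/2) u. The other
uses (1 - Δ)^(1/2) = (1 - Δ)^(-1/2) + ∑ P_j (1 - Δ)^(-1/2) P_j. -/
theorem mem_sobolev_one_iff {s : ℝ} {u : Dist} :
    u ∈ sobolevSubmodule 1 s ↔ u ∈ LW s ∧ ∀ j, momentum j u ∈ LW s := by
  rw [mem_sobolevSubmodule]
  constructor
  · intro h
    have h1 := bes_neg_bes 1 u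
    refine ⟨h1 ▸ (isStable s).bes_mem _ h, fun j => ?_⟩
    rw [← h1, momentum_bes_neg_one]
    exact (isStable s).dir_mem j _ h
  · rintro ⟨h1, h2⟩
    have h3 : bes 1 u = bes (-1) u + ∑ j, fm (dirSymbol j) (momentum j u) := by
      have h4 : bes 1 u = bes (-1) (bes 2 u) := by rw [bes_bes]; norm_num
      rw [h4, bes_two_eq, map_add, map_sum]
      simp_rw [bes_neg_one_momentum]
    rw [h3]
    exact add_mem ((isStable s).bes_mem _ h1)
      (sum_mem fun j _ => (isStable s).dir_mem j _ (h2 j))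

theorem wt_mem_sobolev_one {s r : ℝ} {u : Dist} (hu : u ∈ sobolevSubmodule 1 (r + s)) :
    wt r u ∈ sobolevSubmodule 1 s := by
  rw [mem_sobolev_one_iff] at hu ⊢
  refine ⟨wt_mem_LW.2 hu.1, fun j => ?_⟩
  rw [momentum_wt]
  refine add_mem (wt_mem_LW.2 (hu.2 j)) (Submodule.smul_mem _ _ ?_)
  refine smulLeft_mem_LW (hasTemperateGrowth_dirWeight j) (norm_dirWeight_le j) (wt_mem_LW.2 ?_)
  exact LW_mono (by linarith) hu.1

/-! ### Symmetry of multiplication operators and Fourier multipliers -/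

theorem ae_eq_of_ofL2_eq_smulLeft {m : R3 → ℂ} (hm : m.HasTemperateGrowth) {C : ℝ}
    (hC : ∀ x, ‖m x‖ ≤ C) {g g' : L2} (h : ofL2 g' = smulLeftCLM Spinor m (ofL2 g)) :
    g' =ᵐ[volume] fun x => m x • g x := by
  obtain ⟨T, hT⟩ := exists_smulOp hm.1.continuous.aestronglyMeasurable hC
  have h1 : ofL2 (T g) = ofL2 g' := by rw [h, ofL2_eq_smulLeft hm (hT g)]
  rw [← ofL2_injective h1]
  exact hT g

theorem inner_smul_real_comm {m : R3 → ℂ} (hm : ∀ x, (starRingEnd ℂ) (m x) = m x)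
    {f f' g g' : L2} (hf : f' =ᵐ[volume] fun x => m x • f x)
    (hg : g' =ᵐ[volume] fun x => m x • g x) : inner ℂ f' g = inner ℂ f g' := by
  rw [MeasureTheory.L2.inner_def, MeasureTheory.L2.inner_def]
  refine integral_congr_ae ?_
  filter_upwards [hf, hg] with x h1 h2
  rw [h1, h2, inner_smul_left, inner_smul_right, hm]

theorem inner_wt_comm {r : ℝ} {f f' g g' : L2} (hf : ofL2 f' = wt r (ofL2 f))
    (hg : ofL2 g' = wt r (ofL2 g)) : inner ℂ f' g = inner ℂ f g' :=
  inner_smul_real_comm (m := weight r) (fun _ => Complex.conj_ofReal _)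
    (ofL2_eq_wt_iff.1 hf) (ofL2_eq_wt_iff.1 hg)

theorem ofL2_fourier (f : L2) : ofL2 (FourierTransform.fourier f) =
    FourierTransform.fourier (ofL2 f) :=
  (Lp.fourier_toTemperedDistribution_eq f).symm

theorem fourier_ae_eq_of_bes {k : ℝ} (hk : k ≤ 0) {f f' : L2} (hf : ofL2 f' = bes k (ofL2 f)) :
    (FourierTransform.fourier f' : L2) =ᵐ[volume]
      fun x => besselSymbol k x • (FourierTransform.fourier f : L2) x := by
  refine ae_eq_of_ofL2_eq_smulLeft (hasTemperateGrowth_besselSymbol k) (norm_besselSymbol_le hk) ?_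
  rw [ofL2_fourier, hf, fourierMultiplierCLM_apply, FourierTransform.fourier_fourierInv_eq,
    ofL2_fourier]

theorem inner_bes_comm {k : ℝ} (hk : k ≤ 0) {f f' g g' : L2} (hf : ofL2 f' = bes k (ofL2 f))
    (hg : ofL2 g' = bes k (ofL2 g)) : inner ℂ f' g = inner ℂ f g' := by
  rw [← Lp.inner_fourier_eq f' g, ← Lp.inner_fourier_eq f g']
  exact inner_smul_real_comm (m := besselSymbol k) (fun _ => Complex.conj_ofReal _)
    (fourier_ae_eq_of_bes hk hf) (fourier_ae_eq_of_bes hk hg)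

/-- The hypothesis says S* S = Q. Then ‖S d‖² ≤ ‖Q d‖ ‖d‖, so S f_n is Cauchy along any subsequence
of the ball on which Q f_n converges. -/
theorem isCompactOperator_of_inner {S Q : L2 →L[ℂ] L2} (hQ : IsCompactOperator Q)
    (h : ∀ g, inner ℂ (S g) (S g) = inner ℂ (Q g) g) : IsCompactOperator S := by
  refine (isCompactOperator_iff_image_closedBall_subset_compact (S : L2 →ₗ[ℂ] L2) one_pos).2
    ⟨closure (S '' Metric.closedBall 0 1), ?_, subset_closure⟩
  refine IsSeqCompact.isCompact ?_
  have hseq : ∀ f : ℕ → L2, (∀ n, f n ∈ Metric.closedBall 0 1) →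
      ∃ φ : ℕ → ℕ, StrictMono φ ∧ CauchySeq fun n => S (f (φ n)) := by
    intro f hf
    obtain ⟨K, hK, hK'⟩ := IsCompactOperator.image_closedBall_subset_compact (f := (Q : L2 →ₗ[ℂ] L2)) hQ (1 : ℝ)
    obtain ⟨y, -, φ, hφ, hlim⟩ := hK.tendsto_subseq fun n => hK' ⟨f n, hf n, rfl⟩
    refine ⟨φ, hφ, ?_⟩
    have hc := hlim.cauchySeq
    rw [Metric.cauchySeq_iff] at hc ⊢
    intro ε hε
    obtain ⟨N, hN⟩ := hc (ε ^ 2 / 2) (by positivity)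
    refine ⟨N, fun m hm n hn => ?_⟩
    have h1 := hN m hm n hn
    rw [dist_eq_norm] at h1 ⊢
    simp only [Function.comp_apply] at h1
    have h1' : ‖Q (f (φ m)) - Q (f (φ n))‖ < ε ^ 2 / 2 := h1
    rw [← map_sub] at h1' ⊢
    set d := f (φ m) - f (φ n) with hd
    have h2 : ‖d‖ ≤ 2 := by
      have h3 := hf (φ m)
      have h4 := hf (φ n)
      rw [mem_closedBall_zero_iff] at h3 h4
      exact (norm_sub_le _ _).trans (by linarith)
    have h5 : ‖S d‖ ^ 2 ≤ ‖Q d‖ * ‖d‖ := by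
      have h6 := h d
      rw [inner_self_eq_norm_sq_to_K] at h6
      have h7 := norm_inner_le_norm (𝕜 := ℂ) (Q d) d
      rw [← h6] at h7
      simpa using h7
    have h8 : ‖S d‖ ^ 2 < ε ^ 2 := by
      have : ‖Q d‖ * ‖d‖ ≤ ‖Q d‖ * 2 := by gcongr
      linarith [h1']
    exact lt_of_pow_lt_pow_left₀ 2 hε.le h8
  intro x hx
  have h1 : ∀ n, ∃ f ∈ Metric.closedBall (0 : L2) 1, dist (x n) (S f) < 1 / (n + 1) := by
    intro n
    obtain ⟨_, ⟨f, hf, rfl⟩, hd⟩ := Metric.mem_closure_iff.1 (hx n) (1 / (n + 1)) (by positivity)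
    exact ⟨f, hf, hd⟩
  choose f hf hd using h1
  obtain ⟨φ, hφ, hc⟩ := hseq f hf
  obtain ⟨y, hy⟩ := cauchySeq_tendsto_of_complete hc
  refine ⟨y, mem_closure_of_tendsto hy (Filter.Eventually.of_forall fun n =>
    ⟨f (φ n), hf _, rfl⟩), φ, hφ, ?_⟩
  refine (tendsto_iff_of_dist ?_).2 hy
  have h2 := (tendsto_one_div_add_atTop_nhds_zero_nat (𝕜 := ℝ)).comp hφ.tendsto_atTop
  exact squeeze_zero (fun _ => dist_nonneg) (fun n => (hd (φ n)).le) h2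

/-! ### Hilbert–Schmidt operators -/

/-- The square of the Hilbert–Schmidt norm of the integral operator with kernel `k`. -/
def hsNorm (k : R3 → R3 → ℂ) : ℝ≥0∞ := ∫⁻ x, ∫⁻ y, ‖k x y‖ₑ ^ 2

theorem lintegral_mul_sq_le {f g : R3 → ℝ≥0∞} (hf : AEMeasurable f volume)
    (hg : AEMeasurable g volume) :
    (∫⁻ y, f y * g y) ^ 2 ≤ (∫⁻ y, f y ^ 2) * ∫⁻ y, g y ^ 2 := by
  have h := ENNReal.lintegral_mul_le_Lp_mul_Lq (volume : Measure R3)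
    (Real.HolderConjugate.two_two) hf hg
  calc (∫⁻ y, f y * g y) ^ 2 ≤
        ((∫⁻ y, f y ^ (2 : ℝ)) ^ (1 / 2 : ℝ) * (∫⁻ y, g y ^ (2 : ℝ)) ^ (1 / 2 : ℝ)) ^ 2 := by
        gcongr; exact h
    _ = _ := by
        rw [mul_pow, ← ENNReal.rpow_natCast, ← ENNReal.rpow_natCast, ← ENNReal.rpow_mul,
          ← ENNReal.rpow_mul]
        norm_num

variable {k : R3 → R3 → ℂ}

theorem enorm_kernel_integral_sq_le (hk : Measurable (Function.uncurry k)) (g : L2) (x : R3) :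
    ‖∫ y, k x y • g y‖ₑ ^ 2 ≤ (∫⁻ y, ‖k x y‖ₑ ^ 2) * ‖g‖ₑ ^ 2 := by
  have hkx : Measurable (k x) := hk.comp measurable_prodMk_left
  rw [← lintegral_enorm_sq]
  calc ‖∫ y, k x y • g y‖ₑ ^ 2 ≤ (∫⁻ y, ‖k x y • g y‖ₑ) ^ 2 := by
        gcongr; exact enorm_integral_le_lintegral_enorm _
    _ = (∫⁻ y, ‖k x y‖ₑ * ‖g y‖ₑ) ^ 2 := by simp_rw [enorm_smul]
    _ ≤ _ := lintegral_mul_sq_le hkx.enorm.aemeasurable (Lp.aestronglyMeasurable g).enorm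

theorem aestronglyMeasurable_kernel_integral (hk : Measurable (Function.uncurry k)) (g : L2) :
    AEStronglyMeasurable (fun x => ∫ y, k x y • g y) (volume : Measure R3) := by
  have h1 : AEStronglyMeasurable (fun p : R3 × R3 => k p.1 p.2 • g p.2)
      ((volume : Measure R3).prod volume) :=
    AEStronglyMeasurable.smul (hk.aestronglyMeasurable (f := fun p : R3 × R3 => k p.1 p.2))
      ((Lp.aestronglyMeasurable g).comp_quasiMeasurePreserving Measure.quasiMeasurePreserving_snd)
  exact h1.integral_prod_right'

theorem ae_lintegral_kernel_lt_top (hk : Measurable (Function.uncurry k)) (h : hsNorm k < ∞) :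
    ∀ᵐ x, ∫⁻ y, ‖k x y‖ₑ ^ 2 < ∞ := by
  refine ae_lt_top' ?_ h.ne
  have : Measurable fun p : R3 × R3 => ‖k p.1 p.2‖ₑ ^ 2 := hk.enorm.pow_const 2
  exact (this.lintegral_prod_right').aemeasurable

theorem integrable_kernel_smul (hk : Measurable (Function.uncurry k)) (g : L2) {x : R3}
    (hx : ∫⁻ y, ‖k x y‖ₑ ^ 2 < ∞) : Integrable (fun y => k x y • g y) := by
  have hkx : Measurable (k x) := hk.comp measurable_prodMk_left
  refine ⟨hkx.aestronglyMeasurable.smul (Lp.aestronglyMeasurable g), ?_⟩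
  have h1 : (∫⁻ y, ‖k x y • g y‖ₑ) ^ 2 < ∞ := by
    refine lt_of_le_of_lt ?_ (ENNReal.mul_lt_top hx
      (by simp : (‖g‖ₑ ^ 2 : ℝ≥0∞) < ∞))
    rw [← lintegral_enorm_sq]
    simp_rw [enorm_smul]
    exact lintegral_mul_sq_le hkx.enorm.aemeasurable (Lp.aestronglyMeasurable g).enorm
  exact (ENNReal.pow_lt_top_iff.1 h1).resolve_right (by norm_num)

theorem lintegral_enorm_kernel_integral_le (hk : Measurable (Function.uncurry k)) (g : L2) :
    ∫⁻ x, ‖∫ y, k x y • g y‖ₑ ^ 2 ≤ hsNorm k * ‖g‖ₑ ^ 2 := by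
  rw [hsNorm, ← lintegral_mul_const' _ _ (by simp)]
  exact lintegral_mono fun x => enorm_kernel_integral_sq_le hk g x

theorem memLp_kernel_integral (hk : Measurable (Function.uncurry k)) (h : hsNorm k < ∞) (g : L2) :
    MemLp (fun x => ∫ y, k x y • g y) 2 (volume : Measure R3) :=
  memLp_two_of_lintegral (aestronglyMeasurable_kernel_integral hk g)
    ((lintegral_enorm_kernel_integral_le hk g).trans_lt (ENNReal.mul_lt_top h (by simp)))

theorem exists_hsOp (hk : Measurable (Function.uncurry k)) (h : hsNorm k < ∞) :
    ∃ T : L2 →L[ℂ] L2, (∀ g : L2, T g =ᵐ[volume] fun x => ∫ y, k x y • g y) ∧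
      ‖T‖ ≤ Real.sqrt (hsNorm k).toReal := by
  have hm := memLp_kernel_integral hk h
  let L : L2 →ₗ[ℂ] L2 :=
    { toFun := fun g => (hm g).toLp _
      map_add' := fun f g => by
        ext1
        filter_upwards [(hm (f + g)).coeFn_toLp, (hm f).coeFn_toLp, (hm g).coeFn_toLp,
          Lp.coeFn_add ((hm f).toLp _) ((hm g).toLp _), ae_lintegral_kernel_lt_top hk h]
          with x h1 h2 h3 h5 hx
        rw [h1, h5, Pi.add_apply, h2, h3, ← integral_add (integrable_kernel_smul hk f hx)
          (integrable_kernel_smul hk g hx)]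
        refine integral_congr_ae ?_
        filter_upwards [Lp.coeFn_add f g] with y hy
        rw [hy, Pi.add_apply, smul_add]
      map_smul' := fun c g => by
        ext1
        filter_upwards [(hm (c • g)).coeFn_toLp, (hm g).coeFn_toLp,
          Lp.coeFn_smul c ((hm g).toLp _)] with x h1 h2 h5
        rw [h1, RingHom.id_apply, h5, Pi.smul_apply, h2, ← integral_smul]
        refine integral_congr_ae ?_
        filter_upwards [Lp.coeFn_smul c g] with y hy
        rw [hy, Pi.smul_apply, smul_comm] }
  have hb : ∀ g, ‖L g‖ ≤ Real.sqrt (hsNorm k).toReal * ‖g‖ := by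
    intro g
    have h1 : ‖L g‖ₑ ^ 2 ≤ hsNorm k * ‖g‖ₑ ^ 2 := by
      rw [← lintegral_enorm_sq (L g)]
      refine le_trans (le_of_eq (lintegral_congr_ae ?_)) (lintegral_enorm_kernel_integral_le hk g)
      filter_upwards [(hm g).coeFn_toLp] with x hx
      change ‖(hm g).toLp _ x‖ₑ ^ 2 = _
      rw [hx]
    rw [enorm_sq_eq_ofReal, enorm_sq_eq_ofReal, ← ENNReal.ofReal_toReal h.ne,
      ← ENNReal.ofReal_mul ENNReal.toReal_nonneg,
      ENNReal.ofReal_le_ofReal_iff (by positivity)] at h1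
    refine abs_le_of_sq_le_sq' ?_ (by positivity) |>.2
    rw [mul_pow, Real.sq_sqrt ENNReal.toReal_nonneg]
    exact h1
  exact ⟨L.mkContinuous _ hb, fun g => (hm g).coeFn_toLp,
    L.mkContinuous_norm_le (Real.sqrt_nonneg _) hb⟩

/-- The Hilbert–Schmidt operator with kernel `k`. -/
def hsOp (k : R3 → R3 → ℂ) : L2 →L[ℂ] L2 :=
  open Classical in
  if h : Measurable (Function.uncurry k) ∧ hsNorm k < ∞ then (exists_hsOp h.1 h.2).choose else 0

theorem hsOp_ae_eq (hk : Measurable (Function.uncurry k)) (h : hsNorm k < ∞) (g : L2) :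
    hsOp k g =ᵐ[volume] fun x => ∫ y, k x y • g y := by
  rw [hsOp, dif_pos ⟨hk, h⟩]
  exact (exists_hsOp hk h).choose_spec.1 g

theorem norm_hsOp_le (hk : Measurable (Function.uncurry k)) (h : hsNorm k < ∞) :
    ‖hsOp k‖ ≤ Real.sqrt (hsNorm k).toReal := by
  rw [hsOp, dif_pos ⟨hk, h⟩]
  exact (exists_hsOp hk h).choose_spec.2

theorem norm_hsOp_le_of_le (hk : Measurable (Function.uncurry k)) {C : ℝ} (hC : 0 ≤ C)
    (h : hsNorm k ≤ ENNReal.ofReal (C ^ 2)) : ‖hsOp k‖ ≤ C := by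
  refine (norm_hsOp_le hk (h.trans_lt ENNReal.ofReal_lt_top)).trans ?_
  rw [Real.sqrt_le_left hC]
  exact ENNReal.toReal_le_of_le_ofReal (by positivity) h

/-- Each component of the integral is the L² inner product with a fixed vector built from the row `k
x`, so weak convergence of f_n applies. -/
theorem kernel_integral_tendsto (hk : Measurable (Function.uncurry k)) {x : R3}
    (hx : ∫⁻ y, ‖k x y‖ₑ ^ 2 < ∞) {f : ℕ → L2} {g : L2}
    (hf : ∀ h : L2, Filter.Tendsto (fun n => inner ℂ h (f n)) Filter.atTop (𝓝 (inner ℂ h g))) :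
    Filter.Tendsto (fun n => ∫ y, k x y • f n y) Filter.atTop (𝓝 (∫ y, k x y • g y)) := by
  have hkx : Measurable (k x) := hk.comp measurable_prodMk_left
  have hmem : ∀ i : Fin 2, MemLp (fun y => (starRingEnd ℂ) (k x y) •
      (EuclideanSpace.single i (1 : ℂ) : Spinor)) 2 (volume : Measure R3) := by
    intro i
    refine memLp_two_of_lintegral ?_ ?_
    · exact (Complex.continuous_conj.measurable.comp hkx).aestronglyMeasurable.smul_const _
    · refine lt_of_le_of_lt (le_of_eq (lintegral_congr fun y => ?_)) hx
      rw [enorm_smul]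
      simp [enorm_eq_nnnorm]
  have hin : ∀ (i : Fin 2) (u : L2), inner ℂ ((hmem i).toLp _) u = (∫ y, k x y • u y) i := by
    intro i u
    rw [MeasureTheory.L2.inner_def]
    have h1 := (EuclideanSpace.proj i : Spinor →L[ℂ] ℂ).integral_comp_comm
      (integrable_kernel_smul hk u hx)
    change _ = (EuclideanSpace.proj i : Spinor →L[ℂ] ℂ) _
    rw [← h1]
    refine integral_congr_ae ?_
    filter_upwards [(hmem i).coeFn_toLp] with y hy
    rw [hy]
    simp [inner_smul_left, EuclideanSpace.inner_single_left]
  have h2 : Filter.Tendsto (fun n => (EuclideanSpace.equiv (Fin 2) ℂ) (∫ y, k x y • f n y))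
      Filter.atTop (𝓝 ((EuclideanSpace.equiv (Fin 2) ℂ) (∫ y, k x y • g y))) := by
    rw [tendsto_pi_nhds]
    intro i
    have h3 := hf ((hmem i).toLp _)
    simp_rw [hin] at h3
    exact h3
  have h4 := ((EuclideanSpace.equiv (Fin 2) ℂ).symm.continuous.tendsto _).comp h2
  simpa [Function.comp_def] using h4

/-- A sequence in the unit ball has a weakly convergent subsequence. Its images converge at almost
every x, since almost every row of the kernel is in L², and they are dominated by the row norms;
hence they converge in norm. -/
theorem isCompactOperator_hsOp (hk : Measurable (Function.uncurry k)) (h : hsNorm k < ∞) :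
    IsCompactOperator (hsOp k) := by
  refine (isCompactOperator_iff_image_closedBall_subset_compact (hsOp k : L2 →ₗ[ℂ] L2) one_pos).2
    ⟨_, IsSeqCompact.isCompact ?_, subset_rfl⟩
  intro z hz
  choose f hf hfz using hz
  have : Fact ((2 : ℝ≥0∞) ≠ ∞) := ⟨by simp⟩
  have : SecondCountableTopology L2 := inferInstance
  obtain ⟨l, hl, φ, hφ, hlim⟩ := WeakDual.isSeqCompact_closedBall ℂ L2 (0 : StrongDual ℂ L2) 1
    (x := fun n => StrongDual.toWeakDual (InnerProductSpace.toDual ℂ L2 (f n))) (fun n => by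
      simpa using hf n)
  set g : L2 := (InnerProductSpace.toDual ℂ L2).symm (WeakDual.toStrongDual l) with hg
  have hgl : ∀ a : L2, inner ℂ g a = l a := fun a => by
    rw [hg, InnerProductSpace.toDual_symm_apply]; rfl
  have hconv : ∀ a : L2, Filter.Tendsto (fun n => inner ℂ a (f (φ n))) Filter.atTop
      (𝓝 (inner ℂ a g)) := by
    intro a
    have h1 : Filter.Tendsto (fun n => inner ℂ (f (φ n)) a) Filter.atTop (𝓝 (inner ℂ g a)) := by
      rw [hgl]
      have := (WeakDual.eval_continuous (𝕜 := ℂ) a).tendsto l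
      exact this.comp hlim
    have h2 := (Complex.continuous_conj.tendsto _).comp h1
    simpa [Function.comp_def, inner_conj_symm] using h2
  have hgball : g ∈ Metric.closedBall (0 : L2) 1 := by
    rw [mem_closedBall_zero_iff, hg, LinearIsometryEquiv.norm_map]
    simpa using hl
  refine ⟨hsOp k g, ⟨g, hgball, rfl⟩, φ, hφ, ?_⟩
  have hz' : (z ∘ φ) = fun n => hsOp k (f (φ n)) := by
    ext1 n; exact (hfz (φ n)).symm
  rw [hz', tendsto_iff_norm_sub_tendsto_zero]
  have hn : ∀ n, ‖hsOp k (f (φ n)) - hsOp k g‖ₑ ^ 2 =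
      ∫⁻ x, ‖∫ y, k x y • (f (φ n) - g) y‖ₑ ^ 2 := by
    intro n
    rw [← map_sub, ← lintegral_enorm_sq]
    refine lintegral_congr_ae ?_
    filter_upwards [hsOp_ae_eq hk h (f (φ n) - g)] with x hx
    rw [hx]
  have hdom : Filter.Tendsto (fun n => ∫⁻ x, ‖∫ y, k x y • (f (φ n) - g) y‖ₑ ^ 2) Filter.atTop
      (𝓝 (∫⁻ _ : R3, 0)) := by
    -- The factor 2² bounds ‖f_n - g‖², both functions lying in the unit ball.
    refine tendsto_lintegral_of_dominated_convergence'
      (fun x => (∫⁻ y, ‖k x y‖ₑ ^ 2) * ENNReal.ofReal (2 ^ 2)) ?_ ?_ ?_ ?_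
    · intro n
      exact (aestronglyMeasurable_kernel_integral hk _).enorm.pow_const 2
    · intro n
      refine Filter.Eventually.of_forall fun x => ?_
      refine (enorm_kernel_integral_sq_le hk _ x).trans ?_
      rw [enorm_sq_eq_ofReal (f (φ n) - g)]
      refine mul_le_mul_right (ENNReal.ofReal_le_ofReal (pow_le_pow_left₀ (norm_nonneg _) ?_ 2)) _
      have h3 := hf (φ n)
      rw [mem_closedBall_zero_iff] at h3 hgball
      exact (norm_sub_le _ _).trans (by linarith)
    · rw [lintegral_mul_const' _ _ (by simp)]
      exact (ENNReal.mul_lt_top h ENNReal.ofReal_lt_top).ne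
    · filter_upwards [ae_lintegral_kernel_lt_top hk h] with x hx
      have h4 : ∀ a : L2, Filter.Tendsto (fun n => inner ℂ a (f (φ n) - g)) Filter.atTop
          (𝓝 (inner ℂ a (0 : L2))) := by
        intro a
        have := (hconv a).sub_const (inner ℂ a g)
        simpa [inner_sub_right] using this
      have h5 := kernel_integral_tendsto hk hx h4
      have h6 : ∫ y, k x y • (0 : L2) y = 0 := by
        rw [← integral_zero R3 Spinor]
        refine integral_congr_ae ?_
        filter_upwards [Lp.coeFn_zero Spinor 2 (volume : Measure R3)] with y hy
        rw [hy]; simp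
      rw [h6] at h5
      have h7 := (ENNReal.continuous_pow 2).continuousAt.tendsto.comp h5.enorm
      simpa [Function.comp_def] using h7
  simp_rw [← hn] at hdom
  rw [lintegral_zero] at hdom
  have h8 : Filter.Tendsto (fun n => ‖hsOp k (f (φ n)) - hsOp k g‖ ^ 2) Filter.atTop (𝓝 0) := by
    have h9 := (ENNReal.tendsto_toReal ENNReal.zero_ne_top).comp hdom
    simpa [Function.comp_def] using h9
  have h10 := h8.sqrt
  simpa [Real.sqrt_sq] using h10

/-! ### Weighted integrals of homogeneous kernels -/

theorem bracket_le_of_nonneg {p c : ℝ} (hp : 0 ≤ p) (hc : 0 ≤ c) {x y : R3}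
    (h : 1 + ‖x‖ ^ 2 ≤ c * (1 + ‖y‖ ^ 2)) : bracket p x ≤ c ^ (p / 2) * bracket p y := by
  rw [bracket, bracket, ← Real.mul_rpow hc (by positivity)]
  exact Real.rpow_le_rpow (by positivity) h (by positivity)

theorem bracket_neg_le_of_nonneg {p c : ℝ} (hp : 0 ≤ p) (hc : 0 ≤ c) {x y : R3}
    (h : 1 + ‖x‖ ^ 2 ≤ c * (1 + ‖y‖ ^ 2)) :
    bracket (-p) y ≤ c ^ (p / 2) * bracket (-p) x := by
  have h1 := bracket_le_of_nonneg hp hc h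
  have h2 := bracket_neg_mul p x
  have h3 := bracket_neg_mul p y
  have h4 := bracket_pos (-p) x
  have h5 := bracket_pos (-p) y
  calc bracket (-p) y = bracket (-p) y * (bracket (-p) x * bracket p x) := by rw [h2, mul_one]
    _ ≤ bracket (-p) y * (bracket (-p) x * (c ^ (p / 2) * bracket p y)) := by gcongr
    _ = c ^ (p / 2) * bracket (-p) x * (bracket (-p) y * bracket p y) := by ring
    _ = _ := by rw [h3, mul_one]

theorem integrable_bracket {p : ℝ} (hp : 3 < p) : Integrable (bracket (-p)) (volume : Measure R3) :=
  integrable_rpow_neg_one_add_norm_sq (by simpa using hp)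

/-- In polar coordinates the volume factor r² cancels the singularity, so a one-dimensional integral
with decay r^(-p) remains. -/
theorem integrable_norm_inv_sq_mul_bracket {p : ℝ} (hp : 1 < p) :
    Integrable (fun x : R3 => ‖x‖⁻¹ ^ 2 * bracket (-p) x) := by
  have h := (integrable_fun_norm_addHaar (volume : Measure R3)
    (f := fun r : ℝ => r⁻¹ ^ 2 * (1 + r ^ 2) ^ (-p / 2))).2 ?_
  · exact h
  · have h1 : Integrable (fun r : ℝ => (1 + ‖r‖ ^ 2) ^ (-p / 2)) :=
      integrable_rpow_neg_one_add_norm_sq (by simpa using hp)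
    refine (h1.integrableOn (s := Set.Ioi 0)).congr_fun (fun r hr => ?_) measurableSet_Ioi
    have hr' : (r : ℝ) ≠ 0 := ne_of_gt hr
    simp only [finrank_euclideanSpace, Fintype.card_fin, Real.norm_eq_abs, sq_abs, smul_eq_mul]
    field_simp

/-- N⁻² is split into powers of 5N² with exponents -θ and -(1-θ), and 5N² dominates both ⟨x⟩² and
⟨y⟩². The 5 arises from 1 ≤ N and |x|, |y| ≤ 2N. -/
theorem norm_inv_sq_le {x y : R3} {θ : ℝ} (h0 : 0 ≤ θ) (h1 : θ ≤ 1) {N : ℝ} (hN : 0 < N)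
    (hx : 1 + ‖x‖ ^ 2 ≤ 5 * N ^ 2) (hy : 1 + ‖y‖ ^ 2 ≤ 5 * N ^ 2) :
    N⁻¹ ^ 2 ≤ 5 * (bracket (-(2 * θ)) x * bracket (-(2 * (1 - θ))) y) := by
  have h5 : 0 < 5 * N ^ 2 := by positivity
  have e1 : (5 * N ^ 2) ^ (-θ) ≤ bracket (-(2 * θ)) x := by
    rw [bracket, show -(2 * θ) / 2 = -θ by ring]
    exact Real.rpow_le_rpow_of_nonpos (by positivity) hx (by linarith)
  have e2 : (5 * N ^ 2) ^ (-(1 - θ)) ≤ bracket (-(2 * (1 - θ))) y := by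
    rw [bracket, show -(2 * (1 - θ)) / 2 = -(1 - θ) by ring]
    exact Real.rpow_le_rpow_of_nonpos (by positivity) hy (by linarith)
  have e3 : N⁻¹ ^ 2 = 5 * ((5 * N ^ 2) ^ (-θ) * (5 * N ^ 2) ^ (-(1 - θ))) := by
    rw [← Real.rpow_add h5, show -θ + -(1 - θ) = -1 by ring, Real.rpow_neg_one]
    field_simp
  rw [e3]
  gcongr
  exact (bracket_pos _ _).le

/-- Either |x - y| dominates both |x| and |y|, and its inverse square can be distributed over the
two weights in proportion θ to 1-θ, or ⟨x⟩ and ⟨y⟩ are comparable. In the second case all weights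
move to x except ⟨x-y⟩^(-p), which makes the singular factor integrable. -/
theorem exists_kernel_sq_le {a b p θ : ℝ} (ha : 0 ≤ a) (h0 : 0 ≤ θ) (h1 : θ ≤ 1)
    (hp : 0 ≤ p) : ∃ C : ℝ, 0 ≤ C ∧ ∀ x y : R3,
      bracket (-(2 * b)) x * (‖x - y‖⁻¹ ^ 2 * bracket (-(2 * a)) y) ≤
        5 * (bracket (-(2 * b + 2 * θ)) x * bracket (-(2 * a + 2 * (1 - θ))) y) +
        C * (bracket (-(2 * a + 2 * b - p)) x * (‖x - y‖⁻¹ ^ 2 * bracket (-p) (x - y))) := by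
  refine ⟨(4 : ℝ) ^ (2 * a / 2) * (10 : ℝ) ^ (p / 2), by positivity, fun x y => ?_⟩
  have p1 := bracket_pos (-(2 * b)) x
  have p2 := bracket_pos (-(2 * a)) y
  have p3 := bracket_pos (-(2 * b + 2 * θ)) x
  have p4 := bracket_pos (-(2 * a + 2 * (1 - θ))) y
  have p5 := bracket_pos (-(2 * a + 2 * b - p)) x
  have p6 := bracket_pos (-p) (x - y)
  have t1 : ‖x‖ ≤ ‖x - y‖ + ‖y‖ := by simpa using norm_add_le (x - y) y
  have t2 : ‖y‖ ≤ ‖x - y‖ + ‖x‖ := by simpa using norm_sub_le x (x - y) |>.trans_eq (add_comm _ _)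
  have t3 : ‖x - y‖ ≤ ‖x‖ + ‖y‖ := norm_sub_le _ _
  set N := ‖x - y‖ with hN
  have hN0 : 0 ≤ N := norm_nonneg _
  have q1 := norm_nonneg x
  have q2 := norm_nonneg y
  by_cases hA : 1 ≤ N ∧ ‖x‖ ≤ 2 * N ∧ ‖y‖ ≤ 2 * N
  · obtain ⟨hA1, hA2, hA3⟩ := hA
    have h := norm_inv_sq_le (x := x) (y := y) h0 h1 (N := N) (by linarith) (by nlinarith)
      (by nlinarith)
    have e : bracket (-(2 * b)) x * (5 * (bracket (-(2 * θ)) x * bracket (-(2 * (1 - θ))) y) *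
        bracket (-(2 * a)) y) =
        5 * (bracket (-(2 * b + 2 * θ)) x * bracket (-(2 * a + 2 * (1 - θ))) y) := by
      rw [show -(2 * b + 2 * θ) = -(2 * b) + -(2 * θ) by ring,
        show -(2 * a + 2 * (1 - θ)) = -(2 * a) + -(2 * (1 - θ)) by ring, ← bracket_mul,
        ← bracket_mul]
      ring
    calc _ ≤ bracket (-(2 * b)) x * (5 * (bracket (-(2 * θ)) x * bracket (-(2 * (1 - θ))) y) *
        bracket (-(2 * a)) y) := by gcongr
      _ = _ := e
      _ ≤ _ := le_add_of_nonneg_right (by positivity)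
  -- Outside the first region either |x - y| < 1, or one of |x|, |y| exceeds 2|x - y|. In both cases
  -- ⟨x⟩² and ⟨y⟩² differ at most by a factor 4.
  · have hc : ‖x‖ ^ 2 + 1 ≤ 4 * (1 + ‖y‖ ^ 2) ∧ 1 + ‖y‖ ^ 2 ≤ 4 * (1 + ‖x‖ ^ 2) := by
      by_cases hN1 : N < 1
      · constructor
        · nlinarith [sq_nonneg (‖y‖ - 1)]
        · nlinarith [sq_nonneg (‖x‖ - 1)]
      · rw [not_and, not_and_or] at hA
        rcases hA (not_lt.1 hN1) with h | h
        · constructor <;> nlinarith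
        · constructor <;> nlinarith
    have r1 := bracket_neg_le_of_nonneg (p := 2 * a) (c := 4) (by linarith) (by norm_num)
      (x := x) (y := y) (by linarith)
    have r2 : bracket (-p) x ≤ (10 : ℝ) ^ (p / 2) * bracket (-p) (x - y) := by
      refine bracket_neg_le_of_nonneg hp (by norm_num) ?_
      have hy2 : ‖y‖ ≤ 2 * (bracket 1 x) := by
        have e := bracket_two x
        have e' : bracket 1 x * bracket 1 x = bracket 2 x := by rw [bracket_mul]; norm_num
        have e'' := bracket_pos 1 x
        nlinarith
      have e := bracket_two x
      have e' : bracket 1 x * bracket 1 x = bracket 2 x := by rw [bracket_mul]; norm_num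
      have hx1 := norm_le_bracket_one x
      rw [← hN]
      nlinarith [bracket_pos 1 x]
    have e : bracket (-(2 * b)) x * bracket (-(2 * a)) x =
        bracket (-(2 * a + 2 * b - p)) x * bracket (-p) x := by
      rw [bracket_mul, bracket_mul]; congr 1; ring
    calc _ ≤ bracket (-(2 * b)) x * (N⁻¹ ^ 2 * ((4 : ℝ) ^ (2 * a / 2) * bracket (-(2 * a)) x)) := by
          gcongr
      _ = (4 : ℝ) ^ (2 * a / 2) * N⁻¹ ^ 2 * (bracket (-(2 * b)) x * bracket (-(2 * a)) x) := by ring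
      _ = (4 : ℝ) ^ (2 * a / 2) * N⁻¹ ^ 2 * (bracket (-(2 * a + 2 * b - p)) x * bracket (-p) x) := by
          rw [e]
      _ ≤ (4 : ℝ) ^ (2 * a / 2) * N⁻¹ ^ 2 * (bracket (-(2 * a + 2 * b - p)) x *
          ((10 : ℝ) ^ (p / 2) * bracket (-p) (x - y))) := by gcongr
      _ = (4 : ℝ) ^ (2 * a / 2) * (10 : ℝ) ^ (p / 2) * (bracket (-(2 * a + 2 * b - p)) x *
          (N⁻¹ ^ 2 * bracket (-p) (x - y))) := by ring
      _ ≤ _ := le_add_of_nonneg_left (by positivity)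

theorem lintegral_prod_lt_top {f g : R3 → ℝ} (hf : Integrable f) (hg : Integrable g)
    (hf0 : ∀ x, 0 ≤ f x) :
    ∫⁻ x, ∫⁻ y, ENNReal.ofReal (f x * g y) < ∞ := by
  simp_rw [ENNReal.ofReal_mul (hf0 _)]
  simp_rw [lintegral_const_mul' _ _ ENNReal.ofReal_ne_top]
  have h1 := hf.lintegral_lt_top
  have h2 := hg.lintegral_lt_top
  rw [lintegral_mul_const' _ _ h2.ne]
  exact ENNReal.mul_lt_top h1 h2

theorem lintegral_conv_lt_top {f g : R3 → ℝ} (hf : Integrable f) (hg : Integrable g)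
    (hf0 : ∀ x, 0 ≤ f x) :
    ∫⁻ x, ∫⁻ y, ENNReal.ofReal (f x * g (x - y)) < ∞ := by
  simp_rw [ENNReal.ofReal_mul (hf0 _)]
  simp_rw [lintegral_const_mul' _ _ ENNReal.ofReal_ne_top]
  have h1 := hf.lintegral_lt_top
  have h2 := hg.lintegral_lt_top
  simp_rw [fun x : R3 => lintegral_sub_left_eq_self (μ := (volume : Measure R3))
    (fun y => ENNReal.ofReal (g y)) x]
  rw [lintegral_mul_const' _ _ h2.ne]
  exact ENNReal.mul_lt_top h1 h2

/-- The weighted Newtonian kernel. -/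
def newtonKernel (b a : ℝ) (x y : R3) : ℂ :=
  ((bracket b x * (‖x - y‖⁻¹ * bracket (-a) y) : ℝ) : ℂ)

/-- The weight `⟨x⟩ ^ b ⟨y⟩ ^ (-a)` as a kernel. -/
def constKernel (b a : ℝ) (x y : R3) : ℂ := ((bracket b x * bracket (-a) y : ℝ) : ℂ)

theorem enorm_sq_ofReal {r : ℝ} : ‖(r : ℂ)‖ₑ ^ 2 = ENNReal.ofReal (r ^ 2) := by
  rw [enorm_sq_eq_ofReal, Complex.norm_real, Real.norm_eq_abs, sq_abs]

theorem bracket_sq (p : ℝ) (x : R3) : bracket p x ^ 2 = bracket (2 * p) x := by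
  rw [sq, bracket_mul, two_mul]

/-- The product term is integrable for 3/2 + b < θ < a - 1/2, the convolution term for 1 < p <
2(a-b) - 3. The three hypotheses are what makes admissible θ in (0,1) and p available. -/
theorem hsNorm_newtonKernel {b a : ℝ} (ha : 1 / 2 < a) (hb : b < -1 / 2) (hab : 2 < a - b) :
    hsNorm (newtonKernel b a) < ∞ := by
  obtain ⟨θ, hθ1, hθ2⟩ : ∃ θ, max 0 (3 / 2 + b) < θ ∧ θ < min 1 (a - 1 / 2) := by
    apply exists_between
    rw [max_lt_iff, lt_min_iff, lt_min_iff]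
    refine ⟨⟨?_, ?_⟩, ?_, ?_⟩ <;> linarith
  rw [max_lt_iff] at hθ1
  rw [lt_min_iff] at hθ2
  obtain ⟨p, hp1, hp2⟩ : ∃ p, 1 < p ∧ p < 2 * (a - b) - 3 := exists_between (by linarith)
  obtain ⟨C, hC, h⟩ := exists_kernel_sq_le (a := a) (b := -b) (p := p) (θ := θ) (by linarith)
    hθ1.1.le hθ2.1.le (by linarith)
  have i1 := lintegral_prod_lt_top
    (integrable_bracket (p := 2 * -b + 2 * θ) (by linarith [hθ1.2]))
    (integrable_bracket (p := 2 * a + 2 * (1 - θ)) (by linarith [hθ2.2]))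
    (fun x => (bracket_pos _ x).le)
  have i2 := lintegral_conv_lt_top
    (integrable_bracket (p := 2 * a + 2 * -b - p) (by linarith))
    (integrable_norm_inv_sq_mul_bracket hp1) (fun x => (bracket_pos _ x).le)
  have hle : hsNorm (newtonKernel b a) ≤
      ENNReal.ofReal 5 * (∫⁻ x, ∫⁻ y, ENNReal.ofReal (bracket (-(2 * -b + 2 * θ)) x *
        bracket (-(2 * a + 2 * (1 - θ))) y)) +
      ENNReal.ofReal C * ∫⁻ x, ∫⁻ y, ENNReal.ofReal (bracket (-(2 * a + 2 * -b - p)) x *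
        (‖x - y‖⁻¹ ^ 2 * bracket (-p) (x - y))) := by
    rw [hsNorm, ← lintegral_const_mul' _ _ ENNReal.ofReal_ne_top,
      ← lintegral_const_mul' _ _ ENNReal.ofReal_ne_top]
    simp_rw [← lintegral_const_mul' _ _ ENNReal.ofReal_ne_top]
    have hm : ∀ p : ℝ, Measurable (bracket p) := fun p => (continuous_bracket p).measurable
    rw [← lintegral_add_left (by
      refine Measurable.lintegral_prod_right' (f := fun q : R3 × R3 => ENNReal.ofReal 5 *
        ENNReal.ofReal (bracket (-(2 * -b + 2 * θ)) q.1 *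
          bracket (-(2 * a + 2 * (1 - θ))) q.2)) ?_
      exact (((hm _).comp measurable_fst).mul ((hm _).comp measurable_snd)).ennreal_ofReal.const_mul _)]
    refine lintegral_mono fun x => ?_
    rw [← lintegral_add_left (by exact ((hm _).const_mul _).ennreal_ofReal.const_mul _)]
    refine lintegral_mono fun y => ?_
    rw [newtonKernel, enorm_sq_ofReal, ← ENNReal.ofReal_mul (by norm_num),
      ← ENNReal.ofReal_mul hC, ← ENNReal.ofReal_add
        (by have := bracket_pos (-(2 * -b + 2 * θ)) x
            have := bracket_pos (-(2 * a + 2 * (1 - θ))) y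
            positivity)
        (by have := bracket_pos (-(2 * a + 2 * -b - p)) x
            have := bracket_pos (-p) (x - y)
            positivity)]
    refine ENNReal.ofReal_le_ofReal (le_trans (le_of_eq ?_) (h x y))
    rw [mul_pow, mul_pow, bracket_sq, bracket_sq]
    simp only [mul_neg, neg_neg]
  exact hle.trans_lt (ENNReal.add_lt_top.2 ⟨ENNReal.mul_lt_top ENNReal.ofReal_lt_top i1,
    ENNReal.mul_lt_top ENNReal.ofReal_lt_top i2⟩)

theorem hsNorm_constKernel {b a : ℝ} (ha : 3 / 2 < a) (hb : b < -3 / 2) :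
    hsNorm (constKernel b a) < ∞ := by
  refine lt_of_le_of_lt (le_of_eq ?_) (lintegral_prod_lt_top
    (integrable_bracket (p := 2 * -b) (by linarith)) (integrable_bracket (p := 2 * a) (by linarith))
    (fun x => (bracket_pos _ x).le))
  refine lintegral_congr fun x => lintegral_congr fun y => ?_
  rw [constKernel, enorm_sq_ofReal, mul_pow, bracket_sq, bracket_sq]
  simp only [mul_neg, neg_neg]

theorem hsNorm_le_of_norm_le {k w : R3 → R3 → ℂ} {C : ℝ}
    (h : ∀ x y, ‖k x y‖ ≤ C * ‖w x y‖) : hsNorm k ≤ ENNReal.ofReal (C ^ 2) * hsNorm w := by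
  rw [hsNorm, hsNorm, ← lintegral_const_mul' _ _ ENNReal.ofReal_ne_top]
  simp_rw [← lintegral_const_mul' _ _ ENNReal.ofReal_ne_top]
  refine lintegral_mono fun x => lintegral_mono fun y => ?_
  rw [enorm_sq_eq_ofReal, enorm_sq_eq_ofReal, ← ENNReal.ofReal_mul (by positivity), ← mul_pow]
  gcongr
  exact h x y

theorem norm_hsOp_le_of_norm_le {k w : R3 → R3 → ℂ} (hk : Measurable (Function.uncurry k))
    (hw : hsNorm w < ∞) {C : ℝ} (hC : 0 ≤ C) (h : ∀ x y, ‖k x y‖ ≤ C * ‖w x y‖) :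
    ‖hsOp k‖ ≤ C * Real.sqrt (hsNorm w).toReal := by
  refine norm_hsOp_le_of_le hk (by positivity) ?_
  rw [mul_pow, Real.sq_sqrt ENNReal.toReal_nonneg, ENNReal.ofReal_mul (by positivity),
    ENNReal.ofReal_toReal hw.ne]
  exact hsNorm_le_of_norm_le h

theorem norm_sub_le_bracket (x y : R3) : ‖x - y‖ ≤ 2 * (bracket 1 x * bracket 1 y) := by
  have h1 := norm_sub_le x y
  have h2 := norm_le_bracket_one x
  have h3 := norm_le_bracket_one y
  have h4 := one_le_bracket (s := 1) zero_le_one x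
  have h5 := one_le_bracket (s := 1) zero_le_one y
  nlinarith

/-! ### The Green function of `-Δ + κ²` -/

/-- The function `exp (-κ r) / (4 π r)`. -/
def greenFn (κ : ℂ) (r : ℝ) : ℂ := Complex.exp (-(κ * r)) * (r : ℂ)⁻¹ / (4 * Real.pi)

/-- Minus `r⁻¹` times the derivative of `greenFn`. -/
def greenFnOne (κ : ℂ) (r : ℝ) : ℂ :=
  Complex.exp (-(κ * r)) * (κ * (r : ℂ)⁻¹ ^ 2 + (r : ℂ)⁻¹ ^ 3) / (4 * Real.pi)

/-- Minus `r⁻¹` times the derivative of `greenFnOne`. -/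
def greenFnTwo (κ : ℂ) (r : ℝ) : ℂ :=
  Complex.exp (-(κ * r)) * (κ ^ 2 * (r : ℂ)⁻¹ ^ 3 + 3 * κ * (r : ℂ)⁻¹ ^ 4 + 3 * (r : ℂ)⁻¹ ^ 5) /
    (4 * Real.pi)

theorem hasDerivAt_exp_neg_mul (κ : ℂ) (r : ℝ) :
    HasDerivAt (fun r : ℝ => Complex.exp (-(κ * r))) (Complex.exp (-(κ * r)) * -κ) r := by
  have h := ((((hasDerivAt_id r).ofReal_comp).const_mul κ).neg).cexp
  simpa using h

theorem hasDerivAt_ofReal_inv_pow (n : ℕ) {r : ℝ} (hr : 0 < r) :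
    HasDerivAt (fun r : ℝ => (r : ℂ)⁻¹ ^ n) (-(n : ℂ) * (r : ℂ)⁻¹ ^ (n + 1)) r := by
  have h0 : (r : ℂ) ≠ 0 := by exact_mod_cast hr.ne'
  have h := (((hasDerivAt_id r).ofReal_comp).inv (by simpa using h0)).pow n
  refine h.congr_deriv ?_
  simp only [id_eq, Complex.ofReal_one]
  rcases n with _ | n
  · simp
  · simp only [Nat.add_sub_cancel, Pi.inv_apply]
    ring

theorem hasDerivAt_greenFn (κ : ℂ) {r : ℝ} (hr : 0 < r) :
    HasDerivAt (greenFn κ) (-(r * greenFnOne κ r)) r := by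
  have h0 : (r : ℂ) ≠ 0 := by exact_mod_cast hr.ne'
  have h := ((hasDerivAt_exp_neg_mul κ r).mul (hasDerivAt_ofReal_inv_pow 1 hr)).div_const
    (4 * Real.pi : ℂ)
  refine (h.congr_deriv ?_).congr_of_eventuallyEq (Filter.Eventually.of_forall fun t => ?_)
  · have hu : (r : ℂ) * (r : ℂ)⁻¹ = 1 := mul_inv_cancel₀ h0
    rw [greenFnOne]
    push_cast
    linear_combination (Complex.exp (-(κ * r)) * (κ * (r : ℂ)⁻¹ + (r : ℂ)⁻¹ ^ 2) /
      (4 * Real.pi)) * hu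
  · simp [greenFn]

theorem hasDerivAt_greenFnOne (κ : ℂ) {r : ℝ} (hr : 0 < r) :
    HasDerivAt (greenFnOne κ) (-(r * greenFnTwo κ r)) r := by
  have h0 : (r : ℂ) ≠ 0 := by exact_mod_cast hr.ne'
  have h := ((hasDerivAt_exp_neg_mul κ r).mul
    (((hasDerivAt_ofReal_inv_pow 2 hr).const_mul κ).add (hasDerivAt_ofReal_inv_pow 3 hr))).div_const
    (4 * Real.pi : ℂ)
  refine (h.congr_deriv ?_).congr_of_eventuallyEq (Filter.Eventually.of_forall fun t => ?_)
  · have hu : (r : ℂ) * (r : ℂ)⁻¹ = 1 := mul_inv_cancel₀ h0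
    rw [greenFnTwo]
    simp only [Pi.add_apply]
    push_cast
    linear_combination (Complex.exp (-(κ * r)) * (κ ^ 2 * (r : ℂ)⁻¹ ^ 2 + 3 * κ * (r : ℂ)⁻¹ ^ 3 +
      3 * (r : ℂ)⁻¹ ^ 4) / (4 * Real.pi)) * hu
  · simp [greenFnOne]

/-- This is the radial equation G'' + 2G'/r = κ² G, rewritten with G' = -r G₁ and G₁' = -r G₂. -/
theorem green_equation (κ : ℂ) {r : ℝ} (hr : 0 < r) :
    κ ^ 2 * greenFn κ r + 3 * greenFnOne κ r = r ^ 2 * greenFnTwo κ r := by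
  have h0 : (r : ℂ) ≠ 0 := by exact_mod_cast hr.ne'
  rw [greenFn, greenFnOne, greenFnTwo]
  field_simp
  ring

theorem norm_exp_neg_mul_le {κ : ℂ} (hκ : 0 ≤ κ.re) {r : ℝ} (hr : 0 ≤ r) :
    ‖Complex.exp (-(κ * r))‖ ≤ 1 := by
  rw [Complex.norm_exp]
  simp only [Complex.neg_re, Complex.mul_re, Complex.ofReal_re, Complex.ofReal_im, mul_zero,
    sub_zero]
  exact Real.exp_le_one_iff.2 (by nlinarith [mul_nonneg hκ hr])

theorem norm_div_four_pi_le (z : ℂ) : ‖z / (4 * Real.pi)‖ ≤ ‖z‖ := by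
  have h : (1 : ℝ) ≤ 4 * Real.pi := by linarith [Real.pi_gt_three]
  rw [norm_div, show (4 * Real.pi : ℂ) = ((4 * Real.pi : ℝ) : ℂ) by push_cast; rfl,
    Complex.norm_real, Real.norm_of_nonneg (by linarith)]
  exact div_le_self (norm_nonneg _) h

theorem norm_greenFn_le {κ : ℂ} (hκ : 0 ≤ κ.re) {r : ℝ} (hr : 0 ≤ r) : ‖greenFn κ r‖ ≤ r⁻¹ := by
  refine (norm_div_four_pi_le _).trans ?_
  rw [norm_mul, norm_inv, Complex.norm_real, Real.norm_of_nonneg hr]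
  exact mul_le_of_le_one_left (by positivity) (norm_exp_neg_mul_le hκ hr)

theorem norm_greenFnOne_le {κ : ℂ} (hκ : 0 ≤ κ.re) {r : ℝ} (hr : 0 ≤ r) :
    ‖greenFnOne κ r‖ ≤ ‖κ‖ * r⁻¹ ^ 2 + r⁻¹ ^ 3 := by
  refine (norm_div_four_pi_le _).trans ?_
  rw [norm_mul]
  refine (mul_le_of_le_one_left (norm_nonneg _) (norm_exp_neg_mul_le hκ hr)).trans ?_
  refine (norm_add_le _ _).trans (le_of_eq ?_)
  simp [abs_of_nonneg hr]

theorem norm_greenFnTwo_le {κ : ℂ} (hκ : 0 ≤ κ.re) {r : ℝ} (hr : 0 ≤ r) :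
    ‖greenFnTwo κ r‖ ≤ ‖κ‖ ^ 2 * r⁻¹ ^ 3 + 3 * ‖κ‖ * r⁻¹ ^ 4 + 3 * r⁻¹ ^ 5 := by
  refine (norm_div_four_pi_le _).trans ?_
  rw [norm_mul]
  refine (mul_le_of_le_one_left (norm_nonneg _) (norm_exp_neg_mul_le hκ hr)).trans ?_
  refine (norm_add₃_le).trans (le_of_eq ?_)
  simp [abs_of_nonneg hr]

/-! ### The Green function regularized at its pole -/

/-- The regularized distance `(|x - y|² + ε²) ^ (1 / 2)`. -/
def regDist (ε : ℝ) (y x : R3) : ℝ := Real.sqrt (‖x - y‖ ^ 2 + ε ^ 2)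

section

variable {ε : ℝ} {y : R3}

theorem regDist_sq (ε : ℝ) (y x : R3) : regDist ε y x ^ 2 = ‖x - y‖ ^ 2 + ε ^ 2 :=
  Real.sq_sqrt (by positivity)

theorem le_regDist (hε : 0 < ε) (x : R3) : ε ≤ regDist ε y x :=
  (Real.le_sqrt' hε).2 (by nlinarith [norm_nonneg (x - y)])

theorem norm_le_regDist (x : R3) : ‖x - y‖ ≤ regDist ε y x :=
  Real.le_sqrt_of_sq_le (by nlinarith [sq_nonneg ε])

theorem continuous_regDist : Continuous (regDist ε y) := by
  unfold regDist; fun_prop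

theorem abs_coord_le (x : R3) (j : Fin 3) : |x j| ≤ ‖x‖ := by
  simpa using PiLp.norm_apply_le x j

theorem hasDerivAt_regDist (hε : 0 < ε) (x : R3) (j : Fin 3) :
    HasDerivAt (fun t : ℝ => regDist ε y (x + t • axis j)) ((x - y) j / regDist ε y x) 0 := by
  have h0 : HasDerivAt (fun t : ℝ => x + t • axis j - y) (axis j) 0 := by
    have := (((hasDerivAt_id (0 : ℝ)).smul_const (axis j)).const_add x).sub_const y
    rw [one_smul] at this
    exact this
  have hpos : ‖x + (0 : ℝ) • axis j - y‖ ^ 2 + ε ^ 2 ≠ 0 := by positivity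
  have h1 := (h0.norm_sq.add_const (ε ^ 2)).sqrt hpos
  refine h1.congr_deriv ?_
  simp only [zero_smul, add_zero, ← coord_eq_inner]
  rw [regDist]
  ring

theorem hasLineDerivAt_comp_regDist {G : ℝ → ℂ} {G' : ℝ → ℂ}
    (hG : ∀ r, 0 < r → HasDerivAt G (-(r * G' r)) r) (hε : 0 < ε) (x : R3) (j : Fin 3) :
    HasLineDerivAt ℝ (fun x => G (regDist ε y x)) (-(((x - y) j : ℝ) * G' (regDist ε y x))) x
      (axis j) := by
  have hr : 0 < regDist ε y x := hε.trans_le (le_regDist hε x)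
  have h1 := (hG _ hr)
  have h2 := hasDerivAt_regDist (y := y) hε x j
  have h3 : HasDerivAt (fun t : ℝ => G (regDist ε y (x + t • axis j)))
      (((x - y) j / regDist ε y x) • (-((regDist ε y x : ℝ) * G' (regDist ε y x)))) 0 := by
    refine HasDerivAt.scomp (𝕜 := ℝ) 0 ?_ h2
    simpa using h1
  refine HasDerivAt.congr_deriv h3 ?_
  have : (regDist ε y x : ℂ) ≠ 0 := by exact_mod_cast hr.ne'
  rw [Complex.real_smul]
  push_cast
  field_simp

theorem hasLineDerivAt_coord_mul {G : ℝ → ℂ} {G' : ℝ → ℂ}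
    (hG : ∀ r, 0 < r → HasDerivAt G (-(r * G' r)) r) (hε : 0 < ε) (x : R3) (j : Fin 3) :
    HasLineDerivAt ℝ (fun x => (((x - y) j : ℝ) : ℂ) * G (regDist ε y x))
      (G (regDist ε y x) - (((x - y) j : ℝ) : ℂ) ^ 2 * G' (regDist ε y x)) x (axis j) := by
  have h1 := hasLineDerivAt_comp_regDist (y := y) hG hε x j
  have h0 : HasDerivAt (fun t : ℝ => (((x + t • axis j - y) j : ℝ) : ℂ)) 1 0 := by
    have h2 : HasDerivAt (fun t : ℝ => (x j - y j) + t) 1 0 := (hasDerivAt_id (0 : ℝ)).const_add _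
    have h3 := h2.ofReal_comp
    simp only [Complex.ofReal_one] at h3
    refine h3.congr_of_eventuallyEq (Filter.Eventually.of_forall fun t => ?_)
    simp [axis]; ring
  have h4 := HasDerivAt.mul h0 h1
  refine HasDerivAt.congr_deriv h4 ?_
  simp
  ring

theorem continuous_comp_regDist {G G' : ℝ → ℂ}
    (hG : ∀ r, 0 < r → HasDerivAt G (G' r) r) (hε : 0 < ε) :
    Continuous fun x => G (regDist ε y x) := by
  rw [continuous_iff_continuousAt]
  intro x
  have hr : 0 < regDist ε y x := hε.trans_le (le_regDist hε x)
  exact ContinuousAt.comp (f := regDist ε y) (g := G) (hG _ hr).continuousAt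
    continuous_regDist.continuousAt

end

theorem continuous_greenFnTwo {r : ℝ} (κ : ℂ) (hr : 0 < r) : ContinuousAt (greenFnTwo κ) r := by
  have h0 : (r : ℂ) ≠ 0 := by exact_mod_cast hr.ne'
  have h := ((hasDerivAt_exp_neg_mul κ r).mul
    ((((hasDerivAt_ofReal_inv_pow 3 hr).const_mul (κ ^ 2)).add
      ((hasDerivAt_ofReal_inv_pow 4 hr).const_mul (3 * κ))).add
      ((hasDerivAt_ofReal_inv_pow 5 hr).const_mul 3))).div_const (4 * Real.pi : ℂ)
  exact h.continuousAt

theorem hasLineDerivAt_schwartz (φ : 𝓢(R3, ℂ)) (x m : R3) :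
    HasLineDerivAt ℝ φ ((∂_{m} φ) x) x m := by
  rw [SchwartzMap.lineDerivOp_apply_eq_fderiv]
  exact φ.differentiableAt.hasFDerivAt.hasLineDerivAt m

theorem integrable_mul_schwartz {g : R3 → ℂ} (hg : Continuous g) {C : ℝ} (hC : ∀ x, ‖g x‖ ≤ C)
    (φ : 𝓢(R3, ℂ)) : Integrable fun x => g x * φ x :=
  φ.integrable.bdd_mul hg.aestronglyMeasurable (Filter.Eventually.of_forall hC)

theorem integral_mul_lineDeriv {g g' : R3 → ℂ} (hg : Continuous g) {C : ℝ} (hC : ∀ x, ‖g x‖ ≤ C)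
    (hg' : Continuous g') {C' : ℝ} (hC' : ∀ x, ‖g' x‖ ≤ C') {m : R3}
    (hd : ∀ x, HasLineDerivAt ℝ g (g' x) x m) (φ : 𝓢(R3, ℂ)) :
    ∫ x, g x * (∂_{m} φ) x = -∫ x, g' x * φ x :=
  integral_bilinear_hasLineDerivAt_right_eq_neg_left_of_integrable
    (B := ContinuousLinearMap.mul ℝ ℂ) (integrable_mul_schwartz hg' hC' φ)
    (integrable_mul_schwartz hg hC (∂_{m} φ)) (integrable_mul_schwartz hg hC φ)
    (fun x _ => hd x) (fun x _ => hasLineDerivAt_schwartz φ x m)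

/-- `∑ j, ∂_j ∂_j φ`. -/
def lap (φ : 𝓢(R3, ℂ)) : 𝓢(R3, ℂ) := ∑ j : Fin 3, ∂_{axis j} (∂_{axis j} φ)

/-- With ρ² = |x-y|² + ε², the Laplacian of G(ρ) is |x-y|² G₂(ρ) - 3 G₁(ρ), while the radial
equation contains ρ² G₂(ρ). The mismatch ε² G₂(ρ) is an approximate delta function. All functions
involved are bounded for fixed ε, so the integrations by parts have no boundary terms. -/
theorem integral_regularized {κ : ℂ} (hκ : 0 ≤ κ.re) {ε : ℝ} (hε : 0 < ε) (y : R3)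
    (φ : 𝓢(R3, ℂ)) :
    ∫ x, greenFn κ (regDist ε y x) * (κ ^ 2 • φ - lap φ) x =
      ∫ x, ε ^ 2 * greenFnTwo κ (regDist ε y x) * φ x := by
  set ρ := regDist ε y with hρ
  have hpos : ∀ x, 0 < ρ x := fun x => hε.trans_le (le_regDist hε x)
  have hinv : ∀ x, (ρ x)⁻¹ ≤ ε⁻¹ := fun x => inv_anti₀ hε (le_regDist hε x)
  have hinv0 : ∀ x, 0 ≤ (ρ x)⁻¹ := fun x => (inv_pos.2 (hpos x)).le
  have hcoord : ∀ x (j : Fin 3), ‖(((x - y) j : ℝ) : ℂ)‖ * (ρ x)⁻¹ ≤ 1 := by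
    intro x j
    rw [Complex.norm_real, ← div_eq_mul_inv, div_le_one (hpos x)]
    exact (abs_coord_le (x - y) j).trans (norm_le_regDist x)
  have c0 : Continuous fun x => greenFn κ (ρ x) :=
    continuous_comp_regDist (fun r hr => hasDerivAt_greenFn κ hr) hε
  have c1 : Continuous fun x => greenFnOne κ (ρ x) :=
    continuous_comp_regDist (fun r hr => hasDerivAt_greenFnOne κ hr) hε
  have c2 : Continuous fun x => greenFnTwo κ (ρ x) := by
    rw [continuous_iff_continuousAt]
    exact fun x => ContinuousAt.comp (f := ρ) (continuous_greenFnTwo κ (hpos x))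
      continuous_regDist.continuousAt
  have cc : ∀ j : Fin 3, Continuous fun x : R3 => (((x - y) j : ℝ) : ℂ) := by
    intro j; fun_prop
  have b0 : ∀ x, ‖greenFn κ (ρ x)‖ ≤ ε⁻¹ := fun x =>
    (norm_greenFn_le hκ (hpos x).le).trans (hinv x)
  have b1 : ∀ x, ‖greenFnOne κ (ρ x)‖ ≤ ‖κ‖ * ε⁻¹ ^ 2 + ε⁻¹ ^ 3 := fun x =>
    (norm_greenFnOne_le hκ (hpos x).le).trans
      (by have := hinv x; have := hinv0 x; gcongr)
  -- The coordinate factor is absorbed by one power of ρ⁻¹, since |(x-y)_j| ≤ ρ.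
  have b1' : ∀ (j : Fin 3) x, ‖(((x - y) j : ℝ) : ℂ) * greenFnOne κ (ρ x)‖ ≤
      ‖κ‖ * ε⁻¹ + ε⁻¹ ^ 2 := by
    intro j x
    rw [norm_mul]
    have h1 := hinv x
    have h2 := hinv0 x
    calc _ ≤ ‖(((x - y) j : ℝ) : ℂ)‖ * (‖κ‖ * (ρ x)⁻¹ ^ 2 + (ρ x)⁻¹ ^ 3) := by
          gcongr; exact norm_greenFnOne_le hκ (hpos x).le
      _ = (‖(((x - y) j : ℝ) : ℂ)‖ * (ρ x)⁻¹) * (‖κ‖ * (ρ x)⁻¹ + (ρ x)⁻¹ ^ 2) := by ring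
      _ ≤ 1 * (‖κ‖ * (ρ x)⁻¹ + (ρ x)⁻¹ ^ 2) := by gcongr; exact hcoord x j
      _ ≤ _ := by rw [one_mul]; gcongr
  have b2' : ∀ (j : Fin 3) x, ‖(((x - y) j : ℝ) : ℂ) ^ 2 * greenFnTwo κ (ρ x)‖ ≤
      ‖κ‖ ^ 2 * ε⁻¹ + 3 * ‖κ‖ * ε⁻¹ ^ 2 + 3 * ε⁻¹ ^ 3 := by
    intro j x
    rw [norm_mul, norm_pow]
    have h1 := hinv x
    have h2 := hinv0 x
    have h3 := hcoord x j
    calc _ ≤ ‖(((x - y) j : ℝ) : ℂ)‖ ^ 2 * (‖κ‖ ^ 2 * (ρ x)⁻¹ ^ 3 + 3 * ‖κ‖ * (ρ x)⁻¹ ^ 4 +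
          3 * (ρ x)⁻¹ ^ 5) := by
          gcongr; exact norm_greenFnTwo_le hκ (hpos x).le
      _ = (‖(((x - y) j : ℝ) : ℂ)‖ * (ρ x)⁻¹) ^ 2 * (‖κ‖ ^ 2 * (ρ x)⁻¹ +
          3 * ‖κ‖ * (ρ x)⁻¹ ^ 2 + 3 * (ρ x)⁻¹ ^ 3) := by ring
      _ ≤ 1 ^ 2 * (‖κ‖ ^ 2 * (ρ x)⁻¹ + 3 * ‖κ‖ * (ρ x)⁻¹ ^ 2 + 3 * (ρ x)⁻¹ ^ 3) := by gcongr
      _ ≤ _ := by rw [one_pow, one_mul]; gcongr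
  have key : ∀ j : Fin 3, ∫ x, greenFn κ (ρ x) * (∂_{axis j} (∂_{axis j} φ)) x =
      -∫ x, (greenFnOne κ (ρ x) - (((x - y) j : ℝ) : ℂ) ^ 2 * greenFnTwo κ (ρ x)) * φ x := by
    intro j
    rw [integral_mul_lineDeriv (g' := fun x => -((((x - y) j : ℝ) : ℂ) * greenFnOne κ (ρ x)))
      c0 b0 ((cc j).mul c1).neg (fun x => by rw [norm_neg]; exact b1' j x)
      (fun x => hasLineDerivAt_comp_regDist (fun r hr => hasDerivAt_greenFn κ hr) hε x j)]
    simp_rw [neg_mul, integral_neg]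
    rw [neg_neg, integral_mul_lineDeriv (g := fun x => (((x - y) j : ℝ) : ℂ) * greenFnOne κ (ρ x))
      (g' := fun x => greenFnOne κ (ρ x) - (((x - y) j : ℝ) : ℂ) ^ 2 * greenFnTwo κ (ρ x))
      ((cc j).mul c1) (b1' j) (c1.sub (((cc j).pow 2).mul c2)) (fun x => (norm_sub_le _ _).trans
        (add_le_add (b1 x) (b2' j x)))
      (fun x => hasLineDerivAt_coord_mul (fun r hr => hasDerivAt_greenFnOne κ hr) hε x j)]
  have i1 := integrable_mul_schwartz c0 b0 (κ ^ 2 • φ)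
  have i2 : ∀ j ∈ (Finset.univ : Finset (Fin 3)), Integrable fun x =>
      greenFn κ (ρ x) * (∂_{axis j} (∂_{axis j} φ)) x :=
    fun j _ => integrable_mul_schwartz c0 b0 _
  have i3 : ∀ j ∈ (Finset.univ : Finset (Fin 3)), Integrable fun x =>
      (greenFnOne κ (ρ x) - (((x - y) j : ℝ) : ℂ) ^ 2 * greenFnTwo κ (ρ x)) * φ x :=
    fun j _ => integrable_mul_schwartz (c1.sub (((cc j).pow 2).mul c2))
      (fun x => (norm_sub_le _ _).trans (add_le_add (b1 x) (b2' j x))) φ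
  have e1 : ∀ x, greenFn κ (ρ x) * (κ ^ 2 • φ - lap φ) x =
      greenFn κ (ρ x) * (κ ^ 2 • φ) x -
        ∑ j, greenFn κ (ρ x) * (∂_{axis j} (∂_{axis j} φ)) x := by
    intro x
    rw [sub_apply, mul_sub, lap, sum_apply, Finset.mul_sum]
  simp_rw [e1]
  rw [integral_sub i1 (integrable_finsetSum _ i2), integral_finsetSum _ i2]
  simp_rw [key]
  rw [Finset.sum_neg_distrib, sub_neg_eq_add, ← integral_finsetSum _ i3,
    ← integral_add i1 (integrable_finsetSum _ i3)]
  refine integral_congr_ae (Filter.Eventually.of_forall fun x => ?_)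
  have e2 := green_equation κ (hpos x)
  have e3 := sum_sq_coord (x - y)
  have e4 := regDist_sq ε y x
  have e5 : ∑ j : Fin 3, (greenFnOne κ (ρ x) -
      (((x - y) j : ℝ) : ℂ) ^ 2 * greenFnTwo κ (ρ x)) * φ x =
      (3 * greenFnOne κ (ρ x) - (‖x - y‖ : ℂ) ^ 2 * greenFnTwo κ (ρ x)) * φ x := by
    rw [← Finset.sum_mul, Finset.sum_sub_distrib, ← Finset.sum_mul]
    congr 2
    · simp
    · rw [e3]; push_cast; rfl
  have e6 : ((ρ x : ℝ) : ℂ) ^ 2 = (‖x - y‖ : ℂ) ^ 2 + (ε : ℂ) ^ 2 := by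
    exact_mod_cast congrArg (fun t : ℝ => (t : ℂ)) e4
  simp only [e5, smul_apply, smul_eq_mul]
  rw [e6] at e2
  linear_combination φ x * e2

/-! ### The limit to the delta function -/

theorem integral_bracket_neg_five : ∫ w : R3, bracket (-5) w = 4 * Real.pi / 3 := by
  have h := integral_fun_norm_addHaar (volume : Measure R3)
    (fun r : ℝ => (1 + r ^ 2) ^ (-5 / 2 : ℝ))
  have h1 : (∫ r in Set.Ioi (0 : ℝ), r ^ 2 * (1 + r ^ 2) ^ (-5 / 2 : ℝ)) = 1 / 3 - 0 := by
    -- The radial integrand has the explicit antiderivative r³ (1 + r²)^(-3/2) / 3, which vanishes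
    -- at 0 and tends to 1/3.
    have hd : ∀ r ∈ Set.Ici (0 : ℝ), HasDerivAt
        (fun r : ℝ => r ^ 3 * (1 + r ^ 2) ^ (-3 / 2 : ℝ) / 3) (r ^ 2 * (1 + r ^ 2) ^ (-5 / 2 : ℝ)) r := by
      intro r _
      have hp : (0 : ℝ) < 1 + r ^ 2 := by positivity
      have h2 := (((hasDerivAt_id r).pow 2).const_add 1).rpow_const (p := (-3 / 2 : ℝ))
        (Or.inl (by simpa using hp.ne'))
      have h3 := (((hasDerivAt_id r).pow 3).mul h2).div_const 3
      refine h3.congr_deriv ?_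
      simp only [id_eq]
      have h4 : (1 + r ^ 2) ^ (-3 / 2 : ℝ) = (1 + r ^ 2) * (1 + r ^ 2) ^ (-5 / 2 : ℝ) := by
        rw [← Real.rpow_one_add' hp.le (by norm_num)]; norm_num
      rw [Pi.pow_apply, Pi.pow_apply, id_eq, h4, show (-3 / 2 - 1 : ℝ) = -5 / 2 by norm_num]
      push_cast
      ring
    have ht : Filter.Tendsto (fun r : ℝ => r ^ 3 * (1 + r ^ 2) ^ (-3 / 2 : ℝ) / 3) Filter.atTop
        (𝓝 (1 / 3)) := by
      have h5 : Filter.Tendsto (fun r : ℝ => (1 + (r⁻¹) ^ 2) ^ (-3 / 2 : ℝ) / 3) Filter.atTop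
          (𝓝 ((1 + (0 : ℝ) ^ 2) ^ (-3 / 2 : ℝ) / 3)) := by
        refine ((((tendsto_inv_atTop_zero.pow 2).const_add 1).rpow_const
          (Or.inl (by norm_num)))).div_const 3
      have h6 : ((1 + (0 : ℝ) ^ 2) ^ (-3 / 2 : ℝ) / 3) = 1 / 3 := by norm_num
      rw [h6] at h5
      refine h5.congr' ?_
      filter_upwards [Filter.eventually_gt_atTop (0 : ℝ)] with r hr
      have h7 : (r : ℝ) ^ 3 = (r ^ 2) ^ (3 / 2 : ℝ) := by
        rw [← Real.rpow_natCast r 2, ← Real.rpow_mul hr.le, ← Real.rpow_natCast]; norm_num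
      have h8 : (1 + r⁻¹ ^ 2) = (1 + r ^ 2) / r ^ 2 := by field_simp; ring
      rw [h8, Real.div_rpow (by positivity) (by positivity), h7,
        show (-3 / 2 : ℝ) = -(3 / 2) by norm_num, Real.rpow_neg (by positivity : (0:ℝ) ≤ r ^ 2)]
      field_simp
    rw [integral_Ioi_of_hasDerivAt_of_nonneg' hd (fun r _ => by positivity) ht]
    norm_num
  have hv : (volume : Measure R3).real (Metric.ball 0 1) = Real.pi * 4 / 3 := by
    rw [Measure.real, EuclideanSpace.volume_ball_fin_three]
    simp [ENNReal.toReal_ofReal (by positivity : (0 : ℝ) ≤ Real.pi * 4 / 3)]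
  have h0 : ∫ w : R3, bracket (-5) w = ∫ w : R3, (1 + ‖w‖ ^ 2) ^ (-5 / 2 : ℝ) := rfl
  rw [h0, h, hv]
  simp only [finrank_euclideanSpace, Fintype.card_fin, smul_eq_mul, Nat.add_one_sub_one]
  rw [h1]
  simp
  ring

theorem schwartz_bound (φ : 𝓢(R3, ℂ)) : ∃ M : ℝ, 0 ≤ M ∧ ∀ x, ‖φ x‖ ≤ M ∧ ‖x‖ * ‖φ x‖ ≤ M := by
  obtain ⟨C, hC⟩ := φ.decay 0 0
  obtain ⟨D, hD⟩ := φ.decay 1 0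
  have h0 := hC.2 0
  have h1 := hD.2 0
  simp only [pow_zero, one_mul, pow_one, norm_iteratedFDeriv_zero] at *
  refine ⟨max C D, hC.1.le.trans (le_max_left _ _), fun x => ⟨(hC.2 x).trans (le_max_left _ _),
    (hD.2 x).trans (le_max_right _ _)⟩⟩

theorem integral_greenFnTwo_scaled (κ : ℂ) {ε : ℝ} (hε : 0 < ε) (y : R3) (φ : 𝓢(R3, ℂ)) :
    ∫ x, ε ^ 2 * greenFnTwo κ (regDist ε y x) * φ x =
      ∫ w, ε ^ 5 * greenFnTwo κ (ε * bracket 1 w) * φ (y + ε • w) := by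
  have h1 := integral_add_left_eq_self (μ := (volume : Measure R3))
    (fun x => ε ^ 2 * greenFnTwo κ (regDist ε y x) * φ x) y
  have h2 := Measure.integral_comp_smul (volume : Measure R3)
    (fun x => ε ^ 2 * greenFnTwo κ (regDist ε y (y + x)) * φ (y + x)) ε
  rw [h1, finrank_euclideanSpace, Fintype.card_fin, abs_of_pos (by positivity)] at h2
  have h3 : ∀ w : R3, regDist ε y (y + ε • w) = ε * bracket 1 w := by
    intro w
    rw [regDist, bracket, ← Real.sqrt_eq_rpow, ← Real.sqrt_sq hε.le,
      ← Real.sqrt_mul (by positivity), Real.sqrt_sq hε.le]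
    congr 1
    rw [add_sub_cancel_left, norm_smul, Real.norm_of_nonneg hε.le]
    ring
  simp_rw [h3] at h2
  have h4 : (∫ x, ε ^ 2 * greenFnTwo κ (regDist ε y x) * φ x) =
      (ε : ℂ) ^ 3 * ((ε ^ 3)⁻¹ • ∫ x, ε ^ 2 * greenFnTwo κ (regDist ε y x) * φ x) := by
    have : (ε : ℂ) ≠ 0 := by exact_mod_cast hε.ne'
    rw [Complex.real_smul]
    push_cast
    field_simp
  rw [h4, ← h2, ← integral_const_mul]
  congr 1
  ext w
  ring

theorem tendsto_greenFnTwo_scaled (κ : ℂ) {s : ℝ} (hs : 0 < s) :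
    Filter.Tendsto (fun ε : ℝ => (ε : ℂ) ^ 5 * greenFnTwo κ (ε * s)) (𝓝[>] 0)
      (𝓝 (3 * (s : ℂ)⁻¹ ^ 5 / (4 * Real.pi))) := by
  have hs0 : (s : ℂ) ≠ 0 := by exact_mod_cast hs.ne'
  have hc : Continuous fun ε : ℝ => Complex.exp (-(κ * (ε * s : ℝ))) *
      (κ ^ 2 * ε ^ 2 * (s : ℂ)⁻¹ ^ 3 + 3 * κ * ε * (s : ℂ)⁻¹ ^ 4 + 3 * (s : ℂ)⁻¹ ^ 5) /
        (4 * Real.pi) := by fun_prop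
  have h1 := (hc.tendsto 0).mono_left (nhdsWithin_le_nhds (s := Set.Ioi 0))
  have h2 : Complex.exp (-(κ * ((0 : ℝ) * s : ℝ))) *
      (κ ^ 2 * ((0 : ℝ) : ℂ) ^ 2 * (s : ℂ)⁻¹ ^ 3 + 3 * κ * ((0 : ℝ) : ℂ) * (s : ℂ)⁻¹ ^ 4 +
        3 * (s : ℂ)⁻¹ ^ 5) / (4 * Real.pi) = 3 * (s : ℂ)⁻¹ ^ 5 / (4 * Real.pi) := by simp
  rw [h2] at h1
  refine h1.congr' ?_
  filter_upwards [self_mem_nhdsWithin] with ε hε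
  have hε0 : (ε : ℂ) ≠ 0 := by exact_mod_cast (ne_of_gt hε)
  rw [greenFnTwo]
  push_cast
  field_simp

/-- The κ² term is κ² ε² s⁻³, and ⟨w⟩⁻³ is not integrable on ℝ³. It is therefore written as κ² ε (ε
s) s⁻⁴, where ε s will be absorbed by the decay of the test function. -/
theorem norm_greenFnTwo_scaled_le {κ : ℂ} (hκ : 0 ≤ κ.re) {ε s : ℝ} (hε : 0 < ε) (hs : 0 < s) :
    ‖(ε : ℂ) ^ 5 * greenFnTwo κ (ε * s)‖ ≤
      ‖κ‖ ^ 2 * ε * (ε * s) * s⁻¹ ^ 4 + 3 * ‖κ‖ * ε * s⁻¹ ^ 4 + 3 * s⁻¹ ^ 5 := by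
  rw [norm_mul, norm_pow, Complex.norm_real, Real.norm_of_nonneg hε.le]
  refine (mul_le_mul_of_nonneg_left (norm_greenFnTwo_le hκ (by positivity))
    (by positivity)).trans (le_of_eq ?_)
  field_simp

theorem bracket_one_inv_pow (n : ℕ) (w : R3) : (bracket 1 w)⁻¹ ^ n = bracket (-n) w := by
  have h : (bracket 1 w)⁻¹ = bracket (-1) w := by
    exact inv_eq_of_mul_eq_one_right (bracket_mul_neg 1 w)
  rw [h, ← Real.rpow_natCast, bracket_rpow]
  congr 1; ring

/-- After the substitution x = y + ε w the kernel tends pointwise to 3 ⟨w⟩⁻⁵ / (4π), which has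
integral one, and dominated convergence applies. -/
theorem tendsto_integral_greenFnTwo {κ : ℂ} (hκ : 0 ≤ κ.re) (y : R3) (φ : 𝓢(R3, ℂ)) :
    Filter.Tendsto (fun ε : ℝ => ∫ x, (ε : ℂ) ^ 2 * greenFnTwo κ (regDist ε y x) * φ x) (𝓝[>] 0)
      (𝓝 (φ y)) := by
  obtain ⟨M, hM, hφ⟩ := schwartz_bound φ
  have hlim : φ y = ∫ w : R3, 3 * ((bracket 1 w : ℝ) : ℂ)⁻¹ ^ 5 / (4 * Real.pi) * φ y := by
    rw [integral_mul_const]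
    have h1 : ∀ w : R3, (3 * ((bracket 1 w : ℝ) : ℂ)⁻¹ ^ 5 / (4 * Real.pi) : ℂ) =
        ((3 / (4 * Real.pi) * bracket (-5) w : ℝ) : ℂ) := by
      intro w
      have := bracket_one_inv_pow 5 w
      push_cast at this ⊢
      rw [← this]
      push_cast
      ring
    simp_rw [h1]
    rw [integral_complex_ofReal, integral_const_mul, integral_bracket_neg_five]
    have : Real.pi ≠ 0 := Real.pi_ne_zero
    rw [show 3 / (4 * Real.pi) * (4 * Real.pi / 3) = 1 by field_simp]
    simp
  have key : Filter.Tendsto (fun ε : ℝ => ∫ w, (ε : ℂ) ^ 5 * greenFnTwo κ (ε * bracket 1 w) *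
      φ (y + ε • w)) (𝓝[>] 0) (𝓝 (φ y)) := by
    rw [hlim]
    have hev : ∀ᶠ ε : ℝ in 𝓝[>] 0, 0 < ε ∧ ε < 1 := by
      have := Ioo_mem_nhdsGT (zero_lt_one' ℝ)
      filter_upwards [this] with ε h using h
    refine tendsto_integral_filter_of_dominated_convergence
      (fun w => (‖κ‖ ^ 2 * ((2 + ‖y‖) * M) + 3 * ‖κ‖ * M + 3 * M) * bracket (-4) w) ?_ ?_ ?_ ?_
    · filter_upwards [hev] with ε hε
      refine Continuous.aestronglyMeasurable ?_
      refine (continuous_const.mul ?_).mul (φ.continuous.comp (by fun_prop))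
      rw [continuous_iff_continuousAt]
      intro w
      exact ContinuousAt.comp (f := fun w => ε * bracket 1 w)
        (continuous_greenFnTwo κ (mul_pos hε.1 (bracket_pos 1 w)))
        ((continuous_bracket 1).const_mul ε |>.continuousAt)
    · filter_upwards [hev] with ε hε
      refine Filter.Eventually.of_forall fun w => ?_
      have hs := bracket_pos 1 w
      have hs1 := one_le_bracket (s := 1) zero_le_one w
      rw [norm_mul]
      have hp := hφ (y + ε • w)
      -- Since ε|w| ≤ |y| + |y + ε w|, the growing factor is paid for by the bound on |z| |φ(z)| at
      -- z = y + ε w.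
      have hb : ε * bracket 1 w * ‖φ (y + ε • w)‖ ≤ (2 + ‖y‖) * M := by
        have h1 : bracket 1 w ≤ 1 + ‖w‖ := by
          have e := bracket_two w
          have e' : bracket 1 w * bracket 1 w = bracket 2 w := by rw [bracket_mul]; norm_num
          nlinarith [norm_nonneg w]
        have h2 : ε * ‖w‖ ≤ ‖y‖ + ‖y + ε • w‖ := by
          have := norm_sub_le (y + ε • w) y
          rw [add_sub_cancel_left, norm_smul, Real.norm_of_nonneg hε.1.le] at this
          linarith
        have h3 : ε * bracket 1 w ≤ 1 + ‖y‖ + ‖y + ε • w‖ := by nlinarith [hε.1, hε.2]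
        calc _ ≤ (1 + ‖y‖ + ‖y + ε • w‖) * ‖φ (y + ε • w)‖ := by gcongr
          _ = (1 + ‖y‖) * ‖φ (y + ε • w)‖ + ‖y + ε • w‖ * ‖φ (y + ε • w)‖ := by ring
          _ ≤ (1 + ‖y‖) * M + M := by
              have := hp.1
              have := hp.2
              gcongr
          _ = _ := by ring
      have h5 : (bracket 1 w)⁻¹ ^ 5 ≤ (bracket 1 w)⁻¹ ^ 4 :=
        pow_le_pow_of_le_one (by positivity) (inv_le_one_of_one_le₀ hs1) (by norm_num)
      have h4 := bracket_one_inv_pow 4 w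
      push_cast at h4
      rw [← h4]
      have hε1 := hε.2.le
      have hε0 := hε.1
      calc _ ≤ (‖κ‖ ^ 2 * ε * (ε * bracket 1 w) * (bracket 1 w)⁻¹ ^ 4 +
            3 * ‖κ‖ * ε * (bracket 1 w)⁻¹ ^ 4 + 3 * (bracket 1 w)⁻¹ ^ 5) * ‖φ (y + ε • w)‖ := by
            gcongr; exact norm_greenFnTwo_scaled_le hκ hε.1 hs
        _ ≤ (‖κ‖ ^ 2 * 1 * (ε * bracket 1 w) * (bracket 1 w)⁻¹ ^ 4 +
            3 * ‖κ‖ * 1 * (bracket 1 w)⁻¹ ^ 4 + 3 * (bracket 1 w)⁻¹ ^ 4) * ‖φ (y + ε • w)‖ := by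
            gcongr
        _ = (‖κ‖ ^ 2 * (ε * bracket 1 w * ‖φ (y + ε • w)‖) + 3 * ‖κ‖ * ‖φ (y + ε • w)‖ +
            3 * ‖φ (y + ε • w)‖) * (bracket 1 w)⁻¹ ^ 4 := by ring
        _ ≤ _ := by
            have := hp.1
            gcongr
    · exact (integrable_bracket (by norm_num)).const_mul _
    · refine Filter.Eventually.of_forall fun w => ?_
      refine (tendsto_greenFnTwo_scaled κ (bracket_pos 1 w)).mul ?_
      have hc : Continuous fun ε : ℝ => φ (y + ε • w) := φ.continuous.comp (by fun_prop)
      have := (hc.tendsto 0).mono_left (nhdsWithin_le_nhds (s := Set.Ioi 0))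
      simpa using this
  refine key.congr' ?_
  filter_upwards [self_mem_nhdsWithin] with ε hε
  exact (integral_greenFnTwo_scaled κ hε y φ).symm

theorem integrable_norm_inv_mul_schwartz (y : R3) (φ : 𝓢(R3, ℂ)) :
    Integrable fun x => ‖x - y‖⁻¹ * ‖φ x‖ := by
  have h1 : Integrable fun x : R3 => ‖x‖⁻¹ ^ 2 * bracket (-2) x :=
    integrable_norm_inv_sq_mul_bracket (by norm_num)
  have h2 : Integrable fun x : R3 => ‖x - y‖⁻¹ ^ 2 * bracket (-2) (x - y) :=
    h1.comp_sub_right y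
  have h3 : Integrable fun x : R3 => bracket 2 (x - y) * ‖φ x‖ * ‖φ x‖ := by
    have ht : Function.HasTemperateGrowth fun x : R3 => weight 2 (x - y) :=
      (hasTemperateGrowth_weight 2).comp (by fun_prop)
    have h4 : Integrable (SchwartzMap.smulLeftCLM ℂ (fun x : R3 => weight 2 (x - y)) φ) :=
      SchwartzMap.integrable _
    obtain ⟨M, hM, hφ⟩ := schwartz_bound φ
    refine (h4.norm.mul_const M).mono' ?_ (Filter.Eventually.of_forall fun x => ?_)
    · have : Continuous fun x : R3 => bracket 2 (x - y) := (continuous_bracket 2).comp (by fun_prop)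
      exact ((this.mul φ.continuous.norm).mul φ.continuous.norm).aestronglyMeasurable
    · have hb := bracket_pos 2 (x - y)
      rw [SchwartzMap.smulLeftCLM_apply_apply ht, norm_smul, norm_weight,
        Real.norm_of_nonneg (by positivity)]
      gcongr
      exact (hφ x).1
  refine (h2.add h3).mono' ?_ (Filter.Eventually.of_forall fun x => ?_)
  · exact ((continuous_id.sub continuous_const).norm.measurable.inv.mul
      φ.continuous.norm.measurable).aestronglyMeasurable
  · have hb := bracket_pos 2 (x - y)
    have hb' := bracket_pos (-2) (x - y)
    have hbb := bracket_neg_mul 2 (x - y)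
    have hb1 := bracket_pos 1 (x - y)
    have hb1' := bracket_pos (-1) (x - y)
    have e1 : bracket (-2) (x - y) = bracket (-1) (x - y) ^ 2 := by rw [bracket_sq]; norm_num
    have e2 : bracket 2 (x - y) = bracket 1 (x - y) ^ 2 := by rw [bracket_sq]; norm_num
    have e3 := bracket_neg_mul 1 (x - y)
    rw [Real.norm_of_nonneg (by positivity), Pi.add_apply, e1, e2]
    -- The integrand is the product of |x-y|⁻¹ ⟨x-y⟩⁻¹ and ⟨x-y⟩ |φ|, both square integrable.
    have h := two_mul_le_add_sq (‖x - y‖⁻¹ * bracket (-1) (x - y)) (bracket 1 (x - y) * ‖φ x‖)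
    have e4 : 2 * (‖x - y‖⁻¹ * bracket (-1) (x - y)) * (bracket 1 (x - y) * ‖φ x‖) =
        2 * (‖x - y‖⁻¹ * ‖φ x‖) * (bracket (-1) (x - y) * bracket 1 (x - y)) := by ring
    rw [e4, e3, mul_one] at h
    have : 0 ≤ ‖x - y‖⁻¹ * ‖φ x‖ := by positivity
    nlinarith

theorem measurable_greenFn (κ : ℂ) : Measurable (greenFn κ) := by
  unfold greenFn; fun_prop

/-- `greenFn` is the fundamental solution of `-Δ + κ²`. -/
theorem integral_greenFn {κ : ℂ} (hκ : 0 ≤ κ.re) (y : R3) (φ : 𝓢(R3, ℂ)) :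
    ∫ x, greenFn κ ‖x - y‖ * (κ ^ 2 • φ - lap φ) x = φ y := by
  refine tendsto_nhds_unique ?_ (tendsto_integral_greenFnTwo hκ y φ)
  set ψ := κ ^ 2 • φ - lap φ
  have key : Filter.Tendsto (fun ε : ℝ => ∫ x, greenFn κ (regDist ε y x) * ψ x) (𝓝[>] 0)
      (𝓝 (∫ x, greenFn κ ‖x - y‖ * ψ x)) := by
    refine tendsto_integral_filter_of_dominated_convergence (fun x => ‖x - y‖⁻¹ * ‖ψ x‖)
      ?_ ?_ (integrable_norm_inv_mul_schwartz y ψ) ?_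
    · refine Filter.Eventually.of_forall fun ε => ?_
      exact (((measurable_greenFn κ).comp continuous_regDist.measurable).mul
        ψ.continuous.measurable).aestronglyMeasurable
    · filter_upwards [self_mem_nhdsWithin] with ε hε
      have : ∀ᵐ x : R3, x ≠ y := by simp [ae_iff, measure_singleton]
      filter_upwards [this] with x hx
      rw [norm_mul]
      gcongr
      refine (norm_greenFn_le hκ (Real.sqrt_nonneg _)).trans (inv_anti₀ ?_ (norm_le_regDist x))
      exact norm_pos_iff.2 (sub_ne_zero.2 hx)
    · have : ∀ᵐ x : R3, x ≠ y := by simp [ae_iff, measure_singleton]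
      filter_upwards [this] with x hx
      refine Filter.Tendsto.mul_const _ ?_
      have hpos : 0 < ‖x - y‖ := norm_pos_iff.2 (sub_ne_zero.2 hx)
      have h1 : Filter.Tendsto (fun ε : ℝ => regDist ε y x) (𝓝[>] 0) (𝓝 ‖x - y‖) := by
        have hc : Continuous fun ε : ℝ => regDist ε y x := by unfold regDist; fun_prop
        have := (hc.tendsto 0).mono_left (nhdsWithin_le_nhds (s := Set.Ioi 0))
        simpa [regDist] using this
      exact (hasDerivAt_greenFn κ hpos).continuousAt.tendsto.comp h1
  refine key.congr' ?_
  filter_upwards [self_mem_nhdsWithin] with ε hε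
  exact integral_regularized hκ hε y φ

/-! ### Integral operators between weighted spaces, as distributions -/

/-- The kernel `⟨x⟩ ^ b E(x, y) ⟨y⟩ ^ (-a)`. -/
def sandwich (E : R3 → R3 → ℂ) (b a : ℝ) (x y : R3) : ℂ := weight b x * E x y * weight (-a) y

theorem continuous_weight (s : ℝ) : Continuous (weight s) :=
  (hasTemperateGrowth_weight s).1.continuous

theorem measurable_sandwich {E : R3 → R3 → ℂ} (hE : Measurable (Function.uncurry E)) (b a : ℝ) :
    Measurable (Function.uncurry (sandwich E b a)) :=
  (((continuous_weight b).measurable.comp measurable_fst).mul hE).mul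
    ((continuous_weight (-a)).measurable.comp measurable_snd)

theorem weight_neg_mul (s : ℝ) (x : R3) : weight (-s) x * weight s x = 1 := by
  rw [← Pi.mul_apply, weight_mul, neg_add_cancel, weight_zero]

theorem wt_ofL2_apply (r : ℝ) (g : L2) (φ : 𝓢(R3, ℂ)) :
    wt r (ofL2 g) φ = ∫ x, φ x • (weight r x • g x) := by
  rw [wt, smulLeftCLM_apply_apply, ofL2_apply]
  refine integral_congr_ae (Filter.Eventually.of_forall fun x => ?_)
  simp only [SchwartzMap.smulLeftCLM_apply_apply (hasTemperateGrowth_weight r), smul_eq_mul]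
  rw [mul_comm, mul_smul]

section

variable {E : R3 → R3 → ℂ} {b a : ℝ}

theorem weight_smul_hsOp_ae_eq (hE : Measurable (Function.uncurry E))
    (h : hsNorm (sandwich E b a) < ∞) (g : L2) :
    (fun x => weight (-b) x • hsOp (sandwich E b a) g x) =ᵐ[volume]
      fun x => ∫ y, E x y • (weight (-a) y • g y) := by
  filter_upwards [hsOp_ae_eq (measurable_sandwich hE b a) h g] with x hx
  rw [hx, ← integral_smul]
  refine integral_congr_ae (Filter.Eventually.of_forall fun y => ?_)
  simp only [sandwich, smul_smul]
  congr 1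
  linear_combination (E x y * weight (-a) y) * weight_neg_mul b x

theorem wt_hsOp_apply (hE : Measurable (Function.uncurry E))
    (h : hsNorm (sandwich E b a) < ∞) (g : L2) (φ : 𝓢(R3, ℂ)) :
    wt (-b) (ofL2 (hsOp (sandwich E b a) g)) φ =
      ∫ x, φ x • ∫ y, E x y • (weight (-a) y • g y) := by
  rw [wt_ofL2_apply]
  refine integral_congr_ae ?_
  filter_upwards [weight_smul_hsOp_ae_eq hE h g] with x hx
  rw [hx]

/-- Cauchy-Schwarz in y and then in x; this is the absolute convergence needed for Fubini. -/
theorem integrable_mul_kernel {k : R3 → R3 → ℂ} (hk : Measurable (Function.uncurry k))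
    (h : hsNorm k < ∞) (g : L2) (ψ : 𝓢(R3, ℂ)) :
    Integrable (fun p : R3 × R3 => ψ p.1 • k p.1 p.2 • g p.2)
      ((volume : Measure R3).prod volume) := by
  have hkm : Measurable fun p : R3 × R3 => k p.1 p.2 := hk
  have hg : AEStronglyMeasurable (fun p : R3 × R3 => g p.2) ((volume : Measure R3).prod volume) :=
    (Lp.aestronglyMeasurable g).comp_quasiMeasurePreserving Measure.quasiMeasurePreserving_snd
  have hψ : Measurable fun p : R3 × R3 => ψ p.1 := ψ.continuous.measurable.comp measurable_fst
  have hm : AEStronglyMeasurable (fun p : R3 × R3 => ψ p.1 • k p.1 p.2 • g p.2)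
      ((volume : Measure R3).prod volume) :=
    hψ.aestronglyMeasurable.smul (hkm.aestronglyMeasurable.smul hg)
  refine ⟨hm, ?_⟩
  have hI : AEMeasurable (fun x => ∫⁻ y, ‖k x y‖ₑ * ‖g y‖ₑ) (volume : Measure R3) :=
    AEMeasurable.lintegral_prod_right' (f := fun p : R3 × R3 => ‖k p.1 p.2‖ₑ * ‖g p.2‖ₑ)
      (hkm.enorm.aemeasurable.mul hg.enorm)
  have hψ2 : ∫⁻ x, ‖ψ x‖ₑ ^ 2 < ∞ := by
    have := (ψ.memLp 2 volume).2
    rw [eLpNorm_lt_top_iff_lintegral_rpow_enorm_lt_top (by norm_num) (by norm_num)] at this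
    simpa using this
  rw [hasFiniteIntegral_iff_enorm, lintegral_prod _ hm.enorm]
  have h1 : ∫⁻ x, ∫⁻ y, ‖ψ x • k x y • g y‖ₑ =
      ∫⁻ x, ‖ψ x‖ₑ * ∫⁻ y, ‖k x y‖ₑ * ‖g y‖ₑ := by
    refine lintegral_congr fun x => ?_
    rw [← lintegral_const_mul' _ _ enorm_ne_top]
    simp_rw [enorm_smul]
  change ∫⁻ x, ∫⁻ y, ‖ψ x • k x y • g y‖ₑ < ∞
  rw [h1]
  have h2 := lintegral_mul_sq_le ψ.continuous.enorm.measurable.aemeasurable hI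
  have h3 : ∫⁻ x, (∫⁻ y, ‖k x y‖ₑ * ‖g y‖ₑ) ^ 2 ≤ hsNorm k * ‖g‖ₑ ^ 2 := by
    rw [hsNorm, ← lintegral_mul_const' _ _ (by simp)]
    refine lintegral_mono fun x => ?_
    rw [← lintegral_enorm_sq]
    exact lintegral_mul_sq_le (hk.comp measurable_prodMk_left).enorm.aemeasurable
      (Lp.aestronglyMeasurable g).enorm
  have h4 := h2.trans_lt (ENNReal.mul_lt_top hψ2
    (h3.trans_lt (ENNReal.mul_lt_top h (by simp))))
  exact (ENNReal.pow_lt_top_iff.1 h4).resolve_right (by norm_num)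

/-- The outer weight cancels the x-weight of the kernel. Fubini then moves E onto the test function,
where the fundamental solution property can be used. -/
theorem wt_hsOp_apply_swap (hE : Measurable (Function.uncurry E))
    (h : hsNorm (sandwich E b a) < ∞) (g : L2) (φ : 𝓢(R3, ℂ)) :
    wt (-b) (ofL2 (hsOp (sandwich E b a) g)) φ =
      ∫ y, (∫ x, E x y * φ x) • (weight (-a) y • g y) := by
  have hw := hasTemperateGrowth_weight (-b)
  have hint := integrable_mul_kernel (measurable_sandwich hE b a) h g
    (SchwartzMap.smulLeftCLM ℂ (weight (-b)) φ)
  have hfun : ∀ x y, (SchwartzMap.smulLeftCLM ℂ (weight (-b)) φ) x • sandwich E b a x y • g y =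
      (E x y * φ x) • (weight (-a) y • g y) := by
    intro x y
    rw [SchwartzMap.smulLeftCLM_apply_apply hw, smul_smul, smul_smul, sandwich, smul_eq_mul]
    congr 1
    linear_combination (φ x * E x y * weight (-a) y) * weight_neg_mul b x
  simp_rw [hfun] at hint
  rw [wt_hsOp_apply hE h]
  have h1 : ∀ x, φ x • ∫ y, E x y • (weight (-a) y • g y) =
      ∫ y, (E x y * φ x) • (weight (-a) y • g y) := by
    intro x
    rw [← integral_smul]
    refine integral_congr_ae (Filter.Eventually.of_forall fun y => ?_)
    simp only [smul_smul]
    congr 1; ring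
  simp_rw [h1]
  rw [integral_integral_swap hint]
  exact integral_congr_ae (Filter.Eventually.of_forall fun y => integral_smul_const _ _)

end

/-! ### Functions as distributions -/

/-- The function ⟨x⟩⁻² is in L²(ℝ³) because 4 > 3, so its product with an L² function is integrable.
-/
theorem integrable_bracket_smul (r : ℝ) (g : L2) :
    Integrable (fun x => bracket (-r - 2) x • (weight r x • g x)) := by
  have h1 : ∀ x, bracket (-r - 2) x • (weight r x • g x) = weight (-2) x • g x := by
    intro x
    rw [show (bracket (-r - 2) x • (weight r x • g x) : Spinor) =
      weight (-r - 2) x • (weight r x • g x) from (Complex.coe_smul _ _).symm, smul_smul,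
      ← Pi.mul_apply, weight_mul]
    congr 2; ring
  simp_rw [h1]
  have hm : MemLp (weight (-2)) 2 (volume : Measure R3) := by
    refine ⟨(continuous_weight _).aestronglyMeasurable, ?_⟩
    rw [eLpNorm_lt_top_iff_lintegral_rpow_enorm_lt_top (by norm_num) (by norm_num)]
    have h2 := (integrable_bracket (p := 4) (by norm_num)).lintegral_lt_top
    refine lt_of_le_of_lt (le_of_eq (lintegral_congr fun x => ?_)) h2
    simp only [weight]
    rw [ENNReal.toReal_ofNat, ENNReal.rpow_ofNat, enorm_sq_ofReal, bracket_sq]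
    norm_num
  have := MemLp.smul (r := 1) (Lp.memLp g) hm
  exact memLp_one_iff_integrable.1 this

theorem isRep_wt_ofL2 (r : ℝ) (g : L2) : IsRep (fun x => weight r x • g x) (wt r (ofL2 g)) :=
  ⟨⟨_, integrable_bracket_smul r g⟩, wt_ofL2_apply r g⟩

theorem IsRep.congr {f f' : R3 → Spinor} {u : Dist} (h : IsRep f u) (hf : f =ᵐ[volume] f') :
    IsRep f' u := by
  obtain ⟨⟨m, hm⟩, h2⟩ := h
  refine ⟨⟨m, hm.congr ?_⟩, fun φ => (h2 φ).trans (integral_congr_ae ?_)⟩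
  · filter_upwards [hf] with x hx; rw [hx]
  · filter_upwards [hf] with x hx; rw [hx]

/-- A function represents at most one distribution up to null sets, and conversely. -/
theorem IsRep.ae_eq {f f' : R3 → Spinor} {u : Dist} (h : IsRep f u) (h' : IsRep f' u) :
    f =ᵐ[volume] f' := by
  have key : ∀ {f : R3 → Spinor} {m : ℝ}, Integrable (fun x => bracket m x • f x) →
      LocallyIntegrable f volume := by
    intro f m hm
    have h1 : f = fun x => bracket (-m) x • (bracket m x • f x) := by
      ext1 x; rw [smul_smul, bracket_neg_mul, one_smul]
    rw [h1]
    exact hm.locallyIntegrable.continuous_smul (continuous_bracket (-m))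
  obtain ⟨⟨m, hm⟩, h2⟩ := h
  obtain ⟨⟨m', hm'⟩, h2'⟩ := h'
  have hl := key hm
  have hl' := key hm'
  have h3 : ∀ᵐ x, f x - f' x = 0 := by
    refine ae_eq_zero_of_integral_contDiff_smul_eq_zero (hl.sub hl') ?_
    intro χ hχ hc
    have hχ' : HasCompactSupport (fun x => (χ x : ℂ)) := hc.comp_left Complex.ofReal_zero
    have hd : ContDiff ℝ ((⊤ : ℕ∞) : WithTop ℕ∞) (fun x => (χ x : ℂ)) :=
      Complex.ofRealCLM.contDiff.comp hχ
    have h4 := (h2 (hχ'.toSchwartzMap hd)).symm.trans (h2' (hχ'.toSchwartzMap hd))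
    simp only [HasCompactSupport.toSchwartzMap_toFun, Complex.coe_smul] at h4
    have i1 := hl.integrable_smul_left_of_hasCompactSupport hχ.continuous hc
    have i2 := hl'.integrable_smul_left_of_hasCompactSupport hχ.continuous hc
    simp only [smul_sub]
    rw [integral_sub i1 i2, h4, sub_self]
  filter_upwards [h3] with x hx using sub_eq_zero.1 hx

theorem isRep_hsOp {E : R3 → R3 → ℂ} (hE : Measurable (Function.uncurry E)) {b a : ℝ}
    (h : hsNorm (sandwich E b a) < ∞) {g : L2} {F : R3 → Spinor}
    (hF : IsRep F (wt (-a) (ofL2 g))) :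
    IsRep (fun x => ∫ y, E x y • F y) (wt (-b) (ofL2 (hsOp (sandwich E b a) g))) := by
  refine (isRep_wt_ofL2 (-b) _).congr ((weight_smul_hsOp_ae_eq hE h g).trans ?_)
  have h1 := (isRep_wt_ofL2 (-a) g).ae_eq hF
  refine Filter.Eventually.of_forall fun x => ?_
  refine integral_congr_ae ?_
  filter_upwards [h1] with y hy
  rw [hy]

theorem IsRep.dist_eq {f : R3 → Spinor} {u v : Dist} (hu : IsRep f u) (hv : IsRep f v) : u = v := by
  ext1 φ
  rw [hu.2, hv.2]

/-- Once the weights are removed, both sides are the function ∫ E(x,y) F(y) dy with the same F. -/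
theorem wt_hsOp_compat {E : R3 → R3 → ℂ} (hE : Measurable (Function.uncurry E)) {b a b' a' : ℝ}
    (h : hsNorm (sandwich E b a) < ∞) (h' : hsNorm (sandwich E b' a') < ∞) {g g' : L2}
    (hg : wt (-a) (ofL2 g) = wt (-a') (ofL2 g')) :
    wt (-b) (ofL2 (hsOp (sandwich E b a) g)) = wt (-b') (ofL2 (hsOp (sandwich E b' a') g')) :=
  (isRep_hsOp hE h (isRep_wt_ofL2 (-a) g)).dist_eq
    (isRep_hsOp hE h' (hg ▸ isRep_wt_ofL2 (-a) g))

/-! ### The free resolvent -/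

theorem momentum_apply (j : Fin 3) (u : Dist) (φ : 𝓢(R3, ℂ)) :
    momentum j u φ = Complex.I • u (∂_{axis j} φ) := by
  rw [momentum]
  change (-Complex.I) • (∂_{axis j} u) φ = _
  rw [lineDerivOp_apply_apply, map_neg, smul_neg, neg_smul, neg_neg]

/-- `(-Δ + κ²) u`. -/
def helm (κ : ℂ) (u : Dist) : Dist := bes 2 u + (κ ^ 2 - 1) • u

theorem helm_eq (κ : ℂ) (u : Dist) :
    helm κ u = κ ^ 2 • u + ∑ j, momentum j (momentum j u) := by
  rw [helm, bes_two_eq]; module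

theorem helm_add (κ : ℂ) (u v : Dist) : helm κ (u + v) = helm κ u + helm κ v := by
  simp only [helm, map_add, smul_add]; abel

theorem helm_smul (κ c : ℂ) (u : Dist) : helm κ (c • u) = c • helm κ u := by
  rw [helm, helm, map_smul, smul_add, smul_comm]

theorem helm_sub (κ : ℂ) (u v : Dist) : helm κ (u - v) = helm κ u - helm κ v := by
  simp only [helm, map_sub, smul_sub]; abel

theorem helm_bes (κ : ℂ) (k : ℝ) (u : Dist) : helm κ (bes k u) = bes k (helm κ u) := by
  simp only [helm, map_add, map_smul, bes_bes, add_comm]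

theorem helm_apply (κ : ℂ) (u : Dist) (φ : 𝓢(R3, ℂ)) :
    helm κ u φ = u (κ ^ 2 • φ - lap φ) := by
  rw [helm_eq, add_apply, smul_apply, sum_apply, map_sub, map_smul, lap, map_sum]
  simp only [momentum_apply, smul_smul, Complex.I_mul_I]
  simp [sub_eq_add_neg]

/-- The kernel of `(-Δ + κ²)⁻¹`. -/
def greenE (κ : ℂ) (x y : R3) : ℂ := greenFn κ ‖x - y‖

theorem measurable_greenE (κ : ℂ) : Measurable (Function.uncurry (greenE κ)) :=
  (measurable_greenFn κ).comp (by fun_prop : Measurable fun p : R3 × R3 => ‖p.1 - p.2‖)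

theorem norm_sandwich (E : R3 → R3 → ℂ) (b a : ℝ) (x y : R3) :
    ‖sandwich E b a x y‖ = bracket b x * ‖E x y‖ * bracket (-a) y := by
  rw [sandwich, norm_mul, norm_mul, norm_weight, norm_weight]

theorem norm_newtonKernel (b a : ℝ) (x y : R3) :
    ‖newtonKernel b a x y‖ = bracket b x * ‖x - y‖⁻¹ * bracket (-a) y := by
  have h1 := bracket_pos b x
  have h2 := bracket_pos (-a) y
  rw [newtonKernel, Complex.norm_real, Real.norm_of_nonneg (by positivity), mul_assoc]

theorem norm_constKernel (b a : ℝ) (x y : R3) :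
    ‖constKernel b a x y‖ = bracket b x * bracket (-a) y := by
  have h1 := bracket_pos b x
  have h2 := bracket_pos (-a) y
  rw [constKernel, Complex.norm_real, Real.norm_of_nonneg (by positivity)]

/-- The exponents for which the free resolvent maps `H^{-1,a}` to `H^{1,b}` uniformly. -/
structure Admissible (a b : ℝ) : Prop where
  left : 1 / 2 < a
  right : b < -1 / 2
  diff : 2 < a - b

section

variable {κ : ℂ} {a b : ℝ}

theorem norm_sandwich_greenE_le (hκ : 0 ≤ κ.re) (x y : R3) :
    ‖sandwich (greenE κ) b a x y‖ ≤ 1 * ‖newtonKernel b a x y‖ := by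
  have h1 := bracket_pos b x
  have h2 := bracket_pos (-a) y
  rw [norm_sandwich, norm_newtonKernel, one_mul]
  gcongr
  exact norm_greenFn_le hκ (norm_nonneg _)

theorem hsNorm_greenE (hκ : 0 ≤ κ.re) (h : Admissible a b) :
    hsNorm (sandwich (greenE κ) b a) < ∞ :=
  (hsNorm_le_of_norm_le (norm_sandwich_greenE_le hκ)).trans_lt
    (ENNReal.mul_lt_top ENNReal.ofReal_lt_top (hsNorm_newtonKernel h.left h.right h.diff))

variable (κ a b) in
/-- The operator with kernel `⟨x⟩ ^ b exp (-κ |x - y|) / (4 π |x - y|) ⟨y⟩ ^ (-a)`. -/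
def greenOp : L2 →L[ℂ] L2 := hsOp (sandwich (greenE κ) b a)

theorem isCompactOperator_greenOp (hκ : 0 ≤ κ.re) (h : Admissible a b) :
    IsCompactOperator (greenOp κ a b) :=
  isCompactOperator_hsOp (measurable_sandwich (measurable_greenE κ) b a) (hsNorm_greenE hκ h)

/-- Tested against φ and after Fubini, the inner integral is the fundamental solution property
`integral_greenFn`. -/
theorem helm_greenOp (hκ : 0 ≤ κ.re) (h : Admissible a b) (g : L2) :
    helm κ (wt (-b) (ofL2 (greenOp κ a b g))) = wt (-a) (ofL2 g) := by
  ext1 φ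
  rw [helm_apply, greenOp, wt_hsOp_apply_swap (measurable_greenE κ) (hsNorm_greenE hκ h),
    wt_ofL2_apply]
  refine integral_congr_ae (Filter.Eventually.of_forall fun y => ?_)
  simp only [greenE]
  rw [integral_greenFn hκ]

theorem exists_wtOp {r : ℝ} (hr : r ≤ 0) : ∃ T : L2 →L[ℂ] L2, ∀ g, ofL2 (T g) = wt r (ofL2 g) :=
  exists_clm_of_rangeL2 (wt r) fun g =>
    smulLeft_mem_rangeL2 (hasTemperateGrowth_weight r)
      (fun x => (norm_weight r x).trans_le (bracket_le_one hr x)) (ofL2_mem g)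

/-- Multiplication by `⟨x⟩ ^ r`, `r ≤ 0`, on `L²`. -/
def wtOp (r : ℝ) : L2 →L[ℂ] L2 :=
  open Classical in if h : r ≤ 0 then (exists_wtOp h).choose else 0

theorem ofL2_wtOp {r : ℝ} (hr : r ≤ 0) (g : L2) : ofL2 (wtOp r g) = wt r (ofL2 g) := by
  rw [wtOp, dif_pos hr]
  exact (exists_wtOp hr).choose_spec g

variable (κ a b) in
/-- The operator `(-Δ + κ²)⁻¹` from `H^{-1,a}` to `H^{1,b}`. -/
def free : H (-1) a →L[ℂ] H 1 b := H.conj _ _ _ _ (wtOp (b - a) + (1 - κ ^ 2) • greenOp κ a b)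

/-- The definition of `free` encodes (1 - Δ) R = I + (1 - κ²) R for R = (-Δ + κ²)⁻¹, with one factor
(1 - Δ)^(1/2) on each side of R. Between the weights ⟨x⟩^b and ⟨x⟩^(-a) the identity becomes
multiplication by ⟨x⟩^(b-a), bounded because b ≤ a. -/
theorem dist_free (hκ : 0 ≤ κ.re) (h : Admissible a b) (f : H (-1) a) :
    (free κ a b f).dist = bes 1 (wt (-b) (ofL2 (greenOp κ a b (H.toL2 f)))) := by
  have h1 := helm_greenOp hκ h (H.toL2 f)
  rw [free, H.dist_conj, add_apply, map_add, map_add, ofL2_wtOp (by linarith [h.diff]), wt_wt,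
    show b - a + -b = -a by ring, ← h1, helm]
  set v := wt (-b) (ofL2 (greenOp κ a b (H.toL2 f))) with hv
  have h2 : wt (-b) (ofL2 (((1 - κ ^ 2) • greenOp κ a b) (H.toL2 f))) = (1 - κ ^ 2) • v := by
    rw [smul_apply, map_smul, map_smul]
  rw [h2, show bes 2 v + (κ ^ 2 - 1) • v + (1 - κ ^ 2) • v = bes 2 v by module, bes_bes]
  norm_num

theorem helm_free (hκ : 0 ≤ κ.re) (h : Admissible a b) (f : H (-1) a) :
    helm κ (free κ a b f).dist = f.dist := by
  rw [dist_free hκ h, helm_bes, helm_greenOp hκ h, H.dist_eq f, neg_neg]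

/-- The free resolvent depends only on the distribution, not on the spaces chosen. This includes κ =
0, where `helm` is not known to be injective; the kernel, rather than the equation, is what
identifies the two sides. -/
theorem free_compat (hκ : 0 ≤ κ.re) {a' b' : ℝ} (h : Admissible a b) (h' : Admissible a' b')
    {f : H (-1) a} {f' : H (-1) a'} (hf : f.dist = f'.dist) :
    (free κ a b f).dist = (free κ a' b' f').dist := by
  rw [dist_free hκ h, dist_free hκ h', greenOp, greenOp,
    wt_hsOp_compat (measurable_greenE κ) (hsNorm_greenE hκ h) (hsNorm_greenE hκ h')]
  rw [← H.bes_dist, ← H.bes_dist, hf]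

/-- The kernel of `G_1` off the diagonal. -/
def oneE (x y : R3) : ℂ := -(‖x - y‖ * ‖x - y‖⁻¹ : ℝ) / (4 * Real.pi)

theorem measurable_oneE : Measurable (Function.uncurry oneE) := by
  unfold oneE
  simp only [Function.uncurry_def]
  fun_prop

theorem norm_sandwich_oneE_le (x y : R3) :
    ‖sandwich oneE b a x y‖ ≤ 1 * ‖constKernel b a x y‖ := by
  have h1 := bracket_pos b x
  have h2 := bracket_pos (-a) y
  have h3 : ‖oneE x y‖ ≤ 1 := by
    refine (norm_div_four_pi_le _).trans ?_
    rw [norm_neg, Complex.norm_real, Real.norm_of_nonneg (by positivity)]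
    exact mul_inv_le_one
  rw [norm_sandwich, norm_constKernel, one_mul]
  gcongr
  exact mul_le_of_le_one_right h1.le h3

theorem hsNorm_oneE (ha : 3 / 2 < a) (hb : b < -3 / 2) : hsNorm (sandwich oneE b a) < ∞ :=
  (hsNorm_le_of_norm_le norm_sandwich_oneE_le).trans_lt
    (ENNReal.mul_lt_top ENNReal.ofReal_lt_top (hsNorm_constKernel ha hb))

variable (a b) in
/-- The operator with kernel `-⟨x⟩ ^ b ⟨y⟩ ^ (-a) / (4 π)`. -/
def oneOp : L2 →L[ℂ] L2 := hsOp (sandwich oneE b a)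

variable (a b) in
/-- The operator `G_1` from `H^{-1,a}` to `H^{1,b}`. -/
def freeOne : H (-1) a →L[ℂ] H 1 b := H.conj _ _ _ _ (oneOp a b)

theorem freeOne_compat {a' b' : ℝ} (ha : 3 / 2 < a) (hb : b < -3 / 2) (ha' : 3 / 2 < a')
    (hb' : b' < -3 / 2) {f : H (-1) a} {f' : H (-1) a'} (hf : f.dist = f'.dist) :
    (freeOne a b f).dist = (freeOne a' b' f').dist := by
  rw [freeOne, freeOne, H.dist_conj, H.dist_conj, oneOp, oneOp,
    wt_hsOp_compat measurable_oneE (hsNorm_oneE ha hb) (hsNorm_oneE ha' hb')]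
  rw [← H.bes_dist, ← H.bes_dist, hf]

end

/-! ### Invertibility of `-Δ + κ²` on tempered distributions -/

/-- Since Re κ > 0, κ² avoids (-∞, 0] and |2πξ|² + κ² has no zero. Temperate growth of the inverse
comes from explicit formulas. For real κ² it is a rescaled ⟨·⟩⁻². Otherwise (q + ic)⁻¹ = (q - ic)
c⁻² (1 + (q/c)²)⁻¹ with q real and c = Im κ² ≠ 0. -/
theorem exists_resolventSymbol {κ : ℂ} (hκ : 0 < κ.re) : ∃ (m : R3 → ℂ) (C : ℝ),
    m.HasTemperateGrowth ∧ (∀ ξ, ‖m ξ‖ ≤ C) ∧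
      ∀ ξ, m ξ * (besselSymbol 2 ξ + (κ ^ 2 - 1)) = 1 := by
  have hof : (fun t : ℝ => (t : ℂ)).HasTemperateGrowth :=
    Function.RCLike.hasTemperateGrowth_ofReal (𝕜 := ℂ)
  have hinv : (fun t : ℝ => (((1 + ‖t‖ ^ 2) ^ (-1 : ℝ) : ℝ) : ℂ)).HasTemperateGrowth :=
    hof.comp (Function.hasTemperateGrowth_one_add_norm_sq_rpow ℝ (-1))
  have hb : (fun ξ : R3 => bracket 2 ((2 * Real.pi) • ξ)).HasTemperateGrowth :=
    (Function.hasTemperateGrowth_one_add_norm_sq_rpow R3 (2 / 2)).comp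
      ((2 * Real.pi) • ContinuousLinearMap.id ℝ R3).hasTemperateGrowth
  by_cases him : (κ ^ 2).im = 0
  · have hi : κ.im = 0 := by
      rw [sq, Complex.mul_im] at him
      have : κ.re * κ.im = 0 := by linarith
      rcases mul_eq_zero.1 this with h | h
      · exact absurd h hκ.ne'
      · exact h
    obtain ⟨c, rfl⟩ : ∃ c : ℝ, κ = c := ⟨κ.re, by apply Complex.ext <;> simp [hi]⟩
    have hc : 0 < c := by simpa using hκ
    have hlin : (fun ξ : R3 => (2 * Real.pi / c) • ξ).HasTemperateGrowth :=
      ((2 * Real.pi / c) • ContinuousLinearMap.id ℝ R3).hasTemperateGrowth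
    have h1 : (fun ξ : R3 => ((bracket (-2) ((2 * Real.pi / c) • ξ) : ℝ) : ℂ)).HasTemperateGrowth :=
      (hasTemperateGrowth_weight (-2)).comp hlin
    refine ⟨fun ξ => ((c ^ 2)⁻¹ : ℝ) * ((bracket (-2) ((2 * Real.pi / c) • ξ) : ℝ) : ℂ),
      ‖(((c ^ 2)⁻¹ : ℝ) : ℂ)‖ * 1, (Function.HasTemperateGrowth.const _).mul h1, fun ξ => ?_,
      fun ξ => ?_⟩
    · rw [norm_mul, Complex.norm_real (bracket _ _), Real.norm_of_nonneg (bracket_pos _ _).le]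
      gcongr
      exact bracket_le_one (by norm_num) _
    · have h2 : besselSymbol 2 ξ + ((c : ℂ) ^ 2 - 1) =
          ((c ^ 2 * bracket 2 ((2 * Real.pi / c) • ξ) : ℝ) : ℂ) := by
        rw [besselSymbol, weight, bracket_two, bracket_two, norm_smul, norm_smul, Real.norm_eq_abs,
          Real.norm_eq_abs, abs_div, abs_of_pos hc]
        have : (c : ℂ) ≠ 0 := by exact_mod_cast hc.ne'
        push_cast
        field_simp
        ring
      rw [h2]
      have h3 := bracket_neg_mul 2 ((2 * Real.pi / c) • ξ)
      change (((c ^ 2)⁻¹ : ℝ) : ℂ) * ((bracket (-2) ((2 * Real.pi / c) • ξ) : ℝ) : ℂ) * _ = 1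
      rw [← Complex.ofReal_mul, ← Complex.ofReal_mul]
      rw [show (c ^ 2)⁻¹ * bracket (-2) ((2 * Real.pi / c) • ξ) *
        (c ^ 2 * bracket 2 ((2 * Real.pi / c) • ξ)) = ((c ^ 2)⁻¹ * c ^ 2) *
        (bracket (-2) ((2 * Real.pi / c) • ξ) * bracket 2 ((2 * Real.pi / c) • ξ)) by ring, h3,
        inv_mul_cancel₀ (by positivity), mul_one, Complex.ofReal_one]
  · set c := (κ ^ 2).im with hc
    set q : R3 → ℝ := fun ξ => bracket 2 ((2 * Real.pi) • ξ) + ((κ ^ 2).re - 1) with hq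
    have hqt : q.HasTemperateGrowth := hb.add (Function.HasTemperateGrowth.const _)
    have hqc : (fun ξ => q ξ * c⁻¹).HasTemperateGrowth :=
      hqt.mul (Function.HasTemperateGrowth.const _)
    have h1 := hinv.comp hqc
    have hp : ∀ ξ, besselSymbol 2 ξ + (κ ^ 2 - 1) = q ξ + c * Complex.I := by
      intro ξ
      have := Complex.re_add_im (κ ^ 2)
      rw [← hc] at this
      simp only [hq, besselSymbol, weight]
      rw [← this]
      push_cast
      simp
      ring
    have hne : ∀ ξ, (q ξ : ℂ) + c * Complex.I ≠ 0 := by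
      intro ξ h
      have := congrArg Complex.im h
      simp at this
      exact him this
    have heq : ∀ ξ, ((q ξ : ℂ) - c * Complex.I) * (((c ^ 2)⁻¹ : ℝ) : ℂ) *
        (((1 + ‖q ξ * c⁻¹‖ ^ 2) ^ (-1 : ℝ) : ℝ) : ℂ) * (besselSymbol 2 ξ + (κ ^ 2 - 1)) = 1 := by
      intro ξ
      rw [hp, Real.rpow_neg_one, Real.norm_eq_abs, sq_abs]
      have e0 : c ^ 2 + q ξ ^ 2 ≠ 0 := by positivity
      have e1 : (c ^ 2)⁻¹ * (1 + (q ξ * c⁻¹) ^ 2)⁻¹ = (c ^ 2 + q ξ ^ 2)⁻¹ := by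
        rw [← mul_inv]; congr 1; field_simp
      have e2 : ((q ξ : ℂ) - c * Complex.I) * (q ξ + c * Complex.I) =
          ((c ^ 2 + q ξ ^ 2 : ℝ) : ℂ) := by
        push_cast
        linear_combination (-(c : ℂ) ^ 2) * Complex.I_sq
      calc _ = (((q ξ : ℂ) - c * Complex.I) * (q ξ + c * Complex.I)) *
            (((c ^ 2)⁻¹ * (1 + (q ξ * c⁻¹) ^ 2)⁻¹ : ℝ) : ℂ) := by push_cast; ring
        _ = 1 := by
            rw [e1, e2, ← Complex.ofReal_mul, mul_inv_cancel₀ e0, Complex.ofReal_one]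
    refine ⟨fun ξ => ((q ξ : ℂ) - c * Complex.I) * (((c ^ 2)⁻¹ : ℝ) : ℂ) *
      (((1 + ‖q ξ * c⁻¹‖ ^ 2) ^ (-1 : ℝ) : ℝ) : ℂ), |c|⁻¹, (((hof.comp hqt).sub (Function.HasTemperateGrowth.const (c * Complex.I))).mul
      (Function.HasTemperateGrowth.const (((c ^ 2)⁻¹ : ℝ) : ℂ))).mul h1, fun ξ => ?_, heq⟩
    have h2 := heq ξ
    rw [hp] at h2
    beta_reduce
    rw [eq_inv_of_mul_eq_one_left h2, norm_inv]
    refine inv_anti₀ (abs_pos.2 him) ?_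
    have := Complex.abs_im_le_norm ((q ξ : ℂ) + c * Complex.I)
    simpa using this

theorem fm_eq_helm (κ : ℂ) (u : Dist) :
    fm (fun ξ => besselSymbol 2 ξ + (κ ^ 2 - 1)) u = helm κ u := by
  have h : (fun ξ => besselSymbol 2 ξ + (κ ^ 2 - 1)) =
      besselSymbol 2 + (κ ^ 2 - 1) • besselSymbol 0 := by
    ext ξ; simp [besselSymbol_zero]
  rw [h, fm_add (hasTemperateGrowth_besselSymbol 2)
    (hasTemperateGrowth_const_smul (hasTemperateGrowth_besselSymbol 0) _),
    fm_smul (hasTemperateGrowth_besselSymbol 0), ← bes, ← bes, bes_zero, helm]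

/-- `-Δ + κ²` is invertible on tempered distributions and its inverse is bounded on `L²`. -/
theorem exists_inverse_helm {κ : ℂ} (hκ : 0 < κ.re) : ∃ Φ : Dist →L[ℂ] Dist,
    (∀ u, Φ (helm κ u) = u) ∧ (∀ u, helm κ (Φ u) = u) ∧ ∀ g : L2, Φ (ofL2 g) ∈ rangeL2 := by
  obtain ⟨m, C, hm, hC, h⟩ := exists_resolventSymbol hκ
  have hp : (fun ξ => besselSymbol 2 ξ + (κ ^ 2 - 1)).HasTemperateGrowth :=
    (hasTemperateGrowth_besselSymbol 2).add (Function.HasTemperateGrowth.const _)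
  have h1 : m * (fun ξ => besselSymbol 2 ξ + (κ ^ 2 - 1)) = besselSymbol 0 := by
    ext ξ; rw [besselSymbol_zero]; exact h ξ
  refine ⟨fm m, fun u => ?_, fun u => ?_, fun g => fm_mem_rangeL2 hm hC (ofL2_mem g)⟩
  · rw [← fm_eq_helm, fm_fm hp hm, mul_comm, h1, ← bes, bes_zero]
  · rw [← fm_eq_helm, fm_fm hm hp, h1, ← bes, bes_zero]

theorem helm_injective {κ : ℂ} (hκ : 0 < κ.re) : Function.Injective (helm κ) := by
  obtain ⟨Φ, h, -⟩ := exists_inverse_helm hκ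
  exact Function.LeftInverse.injective h

/-- The free resolvent without weights. -/
theorem exists_free_unweighted {κ : ℂ} (hκ : 0 < κ.re) :
    ∃ R : H (-1) 0 →L[ℂ] H 1 0, ∀ f, helm κ (R f).dist = f.dist := by
  obtain ⟨Φ, h1, h2, h3⟩ := exists_inverse_helm hκ
  obtain ⟨T, hT⟩ := exists_clm_of_rangeL2 Φ h3
  refine ⟨H.conj _ _ _ _ (ContinuousLinearMap.id ℂ L2 + (1 - κ ^ 2) • T), fun f => ?_⟩
  rw [H.dist_conj, add_apply, smul_apply, map_add, map_smul, hT, ContinuousLinearMap.id_apply,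
    helm_bes, neg_zero, wt_zero, helm_add, helm_smul, h2, helm]
  rw [show ∀ w : Dist, bes 2 w + (κ ^ 2 - 1) • w + (1 - κ ^ 2) • w = bes 2 w from
    fun w => by module, bes_bes, H.dist_eq f, neg_zero, wt_zero]
  norm_num

/-! ### Expansion of the free resolvent at zero -/

theorem norm_exp_neg_sub_one_le {z : ℂ} (hz : 0 ≤ z.re) : ‖Complex.exp (-z) - 1‖ ≤ ‖z‖ := by
  have hd : ∀ t : ℝ, HasDerivAt (fun t : ℝ => Complex.exp (-(z * t)))
      (Complex.exp (-(z * t)) * -z) t := hasDerivAt_exp_neg_mul z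
  have h := norm_image_sub_le_of_norm_deriv_le_segment_01' (C := ‖z‖)
    (fun t _ => (hd t).hasDerivWithinAt) (fun t ht => by
      rw [norm_mul, norm_neg]
      exact mul_le_of_le_one_left (norm_nonneg _) (norm_exp_neg_mul_le hz ht.1))
  simpa using h

/-- Mean value inequality for t ↦ exp(-zt) + zt on [0,1]; its derivative -z (exp(-zt) - 1) is
controlled by the first order estimate. -/
theorem norm_exp_neg_sub_one_add_le {z : ℂ} (hz : 0 ≤ z.re) :
    ‖Complex.exp (-z) - 1 + z‖ ≤ ‖z‖ ^ 2 := by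
  have hd : ∀ t : ℝ, HasDerivAt (fun t : ℝ => Complex.exp (-(z * t)) + z * t)
      (Complex.exp (-(z * t)) * -z + z * 1) t := fun t =>
    (hasDerivAt_exp_neg_mul z t).add ((hasDerivAt_id t).ofReal_comp.const_mul z)
  have h := norm_image_sub_le_of_norm_deriv_le_segment_01' (C := ‖z‖ ^ 2)
    (fun t _ => (hd t).hasDerivWithinAt) (fun t ht => by
      have h1 : ‖Complex.exp (-(z * t)) - 1‖ ≤ ‖z * t‖ := by
        refine norm_exp_neg_sub_one_le ?_
        simpa using mul_nonneg hz ht.1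
      have h2 : ‖z * t‖ ≤ ‖z‖ := by
        rw [norm_mul, Complex.norm_real, Real.norm_of_nonneg ht.1]
        exact mul_le_of_le_one_right (norm_nonneg _) ht.2.le
      rw [show Complex.exp (-(z * t)) * -z + z * 1 = -z * (Complex.exp (-(z * t)) - 1) by ring,
        norm_mul, norm_neg, sq]
      exact mul_le_mul_of_nonneg_left (h1.trans h2) (norm_nonneg _))
  have h3 : Complex.exp (-z) - 1 + z = Complex.exp (-(z * (1 : ℝ))) + z * (1 : ℝ) -
      (Complex.exp (-(z * (0 : ℝ))) + z * (0 : ℝ)) := by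
    simp; ring
  rw [h3]
  exact h

theorem measurable_uncurry_sub_sub {k₁ k₂ k₃ : R3 → R3 → ℂ} (c : ℂ)
    (m₁ : Measurable (Function.uncurry k₁)) (m₂ : Measurable (Function.uncurry k₂))
    (m₃ : Measurable (Function.uncurry k₃)) :
    Measurable (Function.uncurry fun x y => k₁ x y - k₂ x y - c * k₃ x y) :=
  (m₁.sub m₂).sub (m₃.const_mul c)

theorem hsOp_sub_sub {k₁ k₂ k₃ : R3 → R3 → ℂ} (c : ℂ) (m₁ : Measurable (Function.uncurry k₁))
    (m₂ : Measurable (Function.uncurry k₂)) (m₃ : Measurable (Function.uncurry k₃))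
    (h₁ : hsNorm k₁ < ∞) (h₂ : hsNorm k₂ < ∞) (h₃ : hsNorm k₃ < ∞)
    (h : hsNorm (fun x y => k₁ x y - k₂ x y - c * k₃ x y) < ∞) :
    hsOp k₁ - hsOp k₂ - c • hsOp k₃ = hsOp fun x y => k₁ x y - k₂ x y - c * k₃ x y := by
  ext1 g
  ext1
  simp only [sub_apply, smul_apply]
  filter_upwards [hsOp_ae_eq m₁ h₁ g, hsOp_ae_eq m₂ h₂ g, hsOp_ae_eq m₃ h₃ g,
    hsOp_ae_eq (measurable_uncurry_sub_sub c m₁ m₂ m₃) h g, ae_lintegral_kernel_lt_top m₁ h₁,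
    ae_lintegral_kernel_lt_top m₂ h₂, ae_lintegral_kernel_lt_top m₃ h₃,
    Lp.coeFn_sub (hsOp k₁ g - hsOp k₂ g) (c • hsOp k₃ g), Lp.coeFn_sub (hsOp k₁ g) (hsOp k₂ g),
    Lp.coeFn_smul c (hsOp k₃ g)] with x e₁ e₂ e₃ e f₁ f₂ f₃ l1 l2 l3
  rw [l1, Pi.sub_apply, l2, Pi.sub_apply, l3, Pi.smul_apply, e₁, e₂, e₃, e]
  have i₁ := integrable_kernel_smul m₁ g f₁
  have i₂ := integrable_kernel_smul m₂ g f₂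
  have i₃ := integrable_kernel_smul m₃ g f₃
  simp_rw [sub_smul, mul_smul]
  have i₄ : Integrable fun y => k₁ x y • g y - k₂ x y • g y := i₁.sub i₂
  have i₅ : Integrable fun y => c • k₃ x y • g y := i₃.smul c
  rw [integral_sub i₄ i₅, integral_sub i₁ i₂, integral_smul]

/-- Second order Taylor estimate for exp(-κr), divided by r. It also holds on the diagonal, where
the factor r r⁻¹ in `oneE` is 0, as is r⁻¹ in `greenFn`. -/
theorem norm_greenE_expansion_le {κ : ℂ} (hκ : 0 ≤ κ.re) (x y : R3) :
    ‖greenE κ x y - greenE 0 x y - κ * oneE x y‖ ≤ ‖κ‖ ^ 2 * ‖x - y‖ := by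
  set r := ‖x - y‖ with hr
  have hr0 : 0 ≤ r := norm_nonneg _
  have h1 : greenE κ x y - greenE 0 x y - κ * oneE x y =
      (Complex.exp (-(κ * r)) - 1 + κ * r) * (r : ℂ)⁻¹ / (4 * Real.pi) := by
    rw [greenE, greenE, oneE, greenFn, greenFn, ← hr]
    push_cast
    simp
    ring
  rw [h1]
  refine (norm_div_four_pi_le _).trans ?_
  rw [norm_mul, norm_inv, Complex.norm_real, Real.norm_of_nonneg hr0]
  rcases hr0.eq_or_lt with h0 | h0
  · rw [← h0]; simp
  · have h2 : ‖Complex.exp (-(κ * r)) - 1 + κ * r‖ ≤ ‖κ * r‖ ^ 2 :=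
      norm_exp_neg_sub_one_add_le (by simpa using mul_nonneg hκ hr0)
    rw [norm_mul, Complex.norm_real, Real.norm_of_nonneg hr0] at h2
    calc _ ≤ (‖κ‖ * r) ^ 2 * r⁻¹ := by gcongr
      _ = _ := by field_simp

theorem admissible_neg {s : ℝ} (hs : 1 < s) : Admissible s (-s) :=
  ⟨by linarith, by linarith, by linarith⟩

/-- The remainder |κ|² |x-y| ≤ 2 |κ|² ⟨x⟩ ⟨y⟩ costs one power of each weight, and ⟨x⟩^(1-s)
⟨y⟩^(1-s) is Hilbert-Schmidt if s - 1 > 3/2. This is the origin of the threshold 5/2. -/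
theorem exists_norm_greenOp_expansion_le {s : ℝ} (hs : 5 / 2 < s) : ∃ C : ℝ, 0 ≤ C ∧
    ∀ κ : ℂ, 0 ≤ κ.re →
      ‖greenOp κ s (-s) - greenOp 0 s (-s) - κ • oneOp s (-s)‖ ≤ C * ‖κ‖ ^ 2 := by
  have hc := hsNorm_constKernel (a := s - 1) (b := 1 - s) (by linarith) (by linarith)
  refine ⟨2 * Real.sqrt (hsNorm (constKernel (1 - s) (s - 1))).toReal, by positivity,
    fun κ hκ => ?_⟩
  have hadm : Admissible s (-s) := admissible_neg (by linarith)
  have hle : ∀ x y, ‖sandwich (greenE κ) (-s) s x y - sandwich (greenE 0) (-s) s x y -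
      κ * sandwich oneE (-s) s x y‖ ≤ (2 * ‖κ‖ ^ 2) * ‖constKernel (1 - s) (s - 1) x y‖ := by
    intro x y
    have e : sandwich (greenE κ) (-s) s x y - sandwich (greenE 0) (-s) s x y -
        κ * sandwich oneE (-s) s x y =
        sandwich (fun x y => greenE κ x y - greenE 0 x y - κ * oneE x y) (-s) s x y := by
      simp only [sandwich]; ring
    have h1 := norm_greenE_expansion_le hκ x y
    have h2 := norm_sub_le_bracket x y
    have p1 := bracket_pos (-s) x
    have p2 := bracket_pos (-s) y
    rw [e, norm_sandwich, norm_constKernel, show 1 - s = -s + 1 by ring,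
      show -(s - 1) = -s + 1 by ring, ← bracket_mul, ← bracket_mul]
    calc _ ≤ bracket (-s) x * (‖κ‖ ^ 2 * (2 * (bracket 1 x * bracket 1 y))) * bracket (-s) y := by
          gcongr; exact h1.trans (by gcongr)
      _ = _ := by ring
  have m1 := fun κ => measurable_sandwich (measurable_greenE κ) (-s) s
  have m2 := measurable_sandwich measurable_oneE (-s) s
  rw [greenOp, greenOp, oneOp, hsOp_sub_sub κ (m1 κ) (m1 0) m2 (hsNorm_greenE hκ hadm)
    (hsNorm_greenE le_rfl hadm) (hsNorm_oneE (by linarith) (by linarith))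
    ((hsNorm_le_of_norm_le hle).trans_lt (ENNReal.mul_lt_top ENNReal.ofReal_lt_top hc))]
  refine (norm_hsOp_le_of_norm_le (measurable_uncurry_sub_sub κ (m1 κ) (m1 0) m2) hc (by positivity)
    hle).trans (le_of_eq (by ring))

/-- The multiplication part of `free` does not depend on κ and cancels. The factor 1 - κ² adds only
κ² times an operator bounded uniformly for |κ| ≤ 1. No such factor occurs in `freeOne`: the kernel
of G_1 is constant, so Δ annihilates it. -/
theorem exists_norm_free_expansion_le {s : ℝ} (hs : 5 / 2 < s) : ∃ C : ℝ, 0 ≤ C ∧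
    ∀ κ : ℂ, 0 ≤ κ.re → ‖κ‖ ≤ 1 →
      ‖free κ s (-s) - free 0 s (-s) - κ • freeOne s (-s)‖ ≤ C * ‖κ‖ ^ 2 := by
  obtain ⟨C, hC, h⟩ := exists_norm_greenOp_expansion_le hs
  set K₀ := greenOp 0 s (-s)
  set K₁ := oneOp s (-s)
  refine ⟨C + (C + ‖K₀‖ + ‖K₁‖), by positivity, fun κ hκ hκ1 => ?_⟩
  set K := greenOp κ s (-s) with hK
  have h1 : free κ s (-s) - free 0 s (-s) - κ • freeOne s (-s) =
      H.conj _ _ _ _ ((K - K₀ - κ • K₁) - κ ^ 2 • K) := by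
    ext1 u
    apply H.toL2_injective
    simp only [free, freeOne, sub_apply, smul_apply, map_sub, map_smul, H.toL2_conj, add_apply]
    rw [← hK]
    simp only [ne_eq, OfNat.ofNat_ne_zero, not_false_eq_true, zero_pow, sub_zero, one_smul]
    change wtOp _ _ + (1 - κ ^ 2) • K _ - (wtOp _ _ + K₀ _) - κ • K₁ _ = _
    module
  have h2 : ‖K‖ ≤ C + ‖K₀‖ + ‖K₁‖ := by
    have e : K = (K - K₀ - κ • K₁) + K₀ + κ • K₁ := by abel
    rw [e]
    refine (norm_add₃_le).trans ?_
    have h3 := h κ hκ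
    have h4 : C * ‖κ‖ ^ 2 ≤ C * 1 := by gcongr; exact pow_le_one₀ (norm_nonneg _) hκ1
    have h5 : ‖κ • K₁‖ ≤ ‖K₁‖ := by
      rw [norm_smul]; exact mul_le_of_le_one_left (norm_nonneg _) hκ1
    linarith
  rw [h1]
  refine (H.norm_conj_le _).trans ((norm_sub_le _ _).trans ?_)
  rw [norm_smul, norm_pow]
  calc _ ≤ C * ‖κ‖ ^ 2 + ‖κ‖ ^ 2 * (C + ‖K₀‖ + ‖K₁‖) := by gcongr; exact h κ hκ
    _ = _ := by ring

/-! ### The integral kernels of `G_0` and `G_1` -/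

theorem continuous_dist {k s : ℝ} : Continuous (H.dist : H k s → Dist) := by
  have h : (H.dist : H k s → Dist) = fun u => bes (-k) (wt (-s) (ofL2 (H.iso k s u))) := by
    ext1 u; exact H.dist_eq u
  rw [h]
  exact (bes (-k)).continuous.comp ((wt (-s)).continuous.comp
    (ofL2.continuous.comp (H.iso k s).continuous))

/-- The coefficients of an expansion are limits, so an identity known for t > 0 passes to both
coefficients. -/
theorem tendsto_of_expansion {X : Type*} [NormedAddCommGroup X] [NormedSpace ℂ X] {F : ℝ → X}
    {a b : X} {C : ℝ}
    (h : ∀ t : ℝ, 0 < t → t ≤ 1 → ‖F t - a - (t : ℂ) • b‖ ≤ C * t ^ 2) :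
    Filter.Tendsto F (𝓝[>] 0) (𝓝 a) ∧
      Filter.Tendsto (fun t : ℝ => (t : ℂ)⁻¹ • (F t - a)) (𝓝[>] 0) (𝓝 b) := by
  have hev : ∀ᶠ t : ℝ in 𝓝[>] 0, 0 < t ∧ t ≤ 1 := by
    filter_upwards [Ioo_mem_nhdsGT (zero_lt_one' ℝ)] with t ht using ⟨ht.1, ht.2.le⟩
  have h0 : ∀ f : ℝ → ℝ, Continuous f → f 0 = 0 → Filter.Tendsto f (𝓝[>] 0) (𝓝 0) := by
    intro f hf hf0
    have := (hf.tendsto 0).mono_left (nhdsWithin_le_nhds (s := Set.Ioi 0))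
    rwa [hf0] at this
  constructor
  · rw [tendsto_iff_norm_sub_tendsto_zero]
    refine squeeze_zero' (Filter.Eventually.of_forall fun _ => norm_nonneg _) ?_
      (h0 (fun t => C * t ^ 2 + t * ‖b‖) (by fun_prop) (by simp))
    filter_upwards [hev] with t ht
    have e : F t - a = (F t - a - (t : ℂ) • b) + (t : ℂ) • b := by abel
    rw [e]
    refine (norm_add_le _ _).trans (add_le_add (h t ht.1 ht.2) ?_)
    rw [norm_smul, Complex.norm_real, Real.norm_of_nonneg ht.1.le]
  · rw [tendsto_iff_norm_sub_tendsto_zero]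
    refine squeeze_zero' (Filter.Eventually.of_forall fun _ => norm_nonneg _) ?_
      (h0 (fun t => C * t) (by fun_prop) (by simp))
    filter_upwards [hev] with t ht
    have ht0 : (t : ℂ) ≠ 0 := by exact_mod_cast ht.1.ne'
    have e : (t : ℂ)⁻¹ • (F t - a) - b = (t : ℂ)⁻¹ • (F t - a - (t : ℂ) • b) := by
      rw [smul_sub _ (F t - a), smul_smul, inv_mul_cancel₀ ht0, one_smul]
    rw [e, norm_smul, norm_inv, Complex.norm_real, Real.norm_of_nonneg ht.1.le,
      inv_mul_le_iff₀ ht.1]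
    exact (h t ht.1 ht.2).trans (le_of_eq (by ring))

theorem exists_wt_ofL2_of_isRep_schwartz (s : ℝ) {φ : 𝓢(R3, Spinor)} {u : Dist} (h : IsRep φ u) :
    ∃ g : L2, wt (-s) (ofL2 g) = u := by
  have hw := hasTemperateGrowth_weight s
  set ψ := SchwartzMap.smulLeftCLM Spinor (weight s) φ with hψ
  refine ⟨ψ.toLp 2, (isRep_wt_ofL2 (-s) _).dist_eq (h.congr ?_)⟩
  filter_upwards [ψ.coeFn_toLp 2 (volume : Measure R3)] with x hx
  rw [hx, hψ, SchwartzMap.smulLeftCLM_apply_apply hw, smul_smul, weight_neg_mul, one_smul]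

/-- `free` reaches f through (1 - Δ)^(-1/2) f, so its kernel is not visible. For t > 0 it agrees
with the kernel operator applied to ⟨x⟩⁻³ g because both solve the same equation and -Δ + t² is
injective. Letting t → 0 gives G_0 and G_1. Any weight above 5/2 could replace 3. -/
theorem free_eq_of_wt_eq {f : H (-1) 3} {g : L2}
    (hg : wt (-3) (ofL2 g) = f.dist) :
    (free 0 3 (-3) f).dist = wt 3 (ofL2 (greenOp 0 3 (-3) g)) ∧
      (freeOne 3 (-3) f).dist = wt 3 (ofL2 (oneOp 3 (-3) g)) := by
  have hadm : Admissible 3 (-3) := admissible_neg (by norm_num)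
  obtain ⟨C, -, hC⟩ := exists_norm_greenOp_expansion_le (s := 3) (by norm_num)
  obtain ⟨D, -, hD⟩ := exists_norm_free_expansion_le (s := 3) (by norm_num)
  have hre : ∀ t : ℝ, 0 < t → 0 ≤ (t : ℂ).re := fun t ht => by simpa using ht.le
  have hn : ∀ t : ℝ, 0 < t → ‖(t : ℂ)‖ = t := fun t ht => by
    rw [Complex.norm_real, Real.norm_of_nonneg ht.le]
  obtain ⟨a1, a2⟩ := tendsto_of_expansion (F := fun t : ℝ => greenOp t 3 (-3) g)
    (a := greenOp 0 3 (-3) g) (b := oneOp 3 (-3) g) (C := C * ‖g‖) fun t ht ht1 => by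
      have := (hC t (hre t ht))
      rw [hn t ht] at this
      exact (ContinuousLinearMap.le_of_opNorm_le _ this g).trans (le_of_eq (by ring))
  obtain ⟨b1, b2⟩ := tendsto_of_expansion (F := fun t : ℝ => free t 3 (-3) f)
    (a := free 0 3 (-3) f) (b := freeOne 3 (-3) f) (C := D * ‖f‖) fun t ht ht1 => by
      have := (hD t (hre t ht) (by rwa [hn t ht]))
      rw [hn t ht] at this
      exact (ContinuousLinearMap.le_of_opNorm_le _ this f).trans (le_of_eq (by ring))
  have heq : ∀ t : ℝ, 0 < t → (free t 3 (-3) f).dist = wt 3 (ofL2 (greenOp t 3 (-3) g)) := by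
    intro t ht
    apply helm_injective (κ := t) (by simpa using ht)
    have h1 := helm_greenOp (hre t ht) hadm g
    rw [neg_neg] at h1
    rw [helm_free (hre t ht) hadm, h1, hg]
  have hc : Continuous fun g : L2 => wt 3 (ofL2 g) := (wt 3).continuous.comp ofL2.continuous
  have e0 : (free 0 3 (-3) f).dist = wt 3 (ofL2 (greenOp 0 3 (-3) g)) := by
    refine tendsto_nhds_unique ((continuous_dist.tendsto _).comp b1)
      (((hc.tendsto _).comp a1).congr' ?_)
    filter_upwards [self_mem_nhdsWithin] with t ht
    exact (heq t ht).symm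
  refine ⟨e0, tendsto_nhds_unique ((continuous_dist.tendsto _).comp b2)
      (((hc.tendsto _).comp a2).congr' ?_)⟩
  filter_upwards [self_mem_nhdsWithin] with t ht
  simp only [Function.comp_apply]
  have l1 : ((t : ℂ)⁻¹ • (free t 3 (-3) f - free 0 3 (-3) f)).dist =
    (t : ℂ)⁻¹ • ((free t 3 (-3) f).dist - (free 0 3 (-3) f).dist) := rfl
  rw [l1, heq t ht, e0, map_smul, map_smul, map_sub, map_sub]

theorem exists_dist_eq_of_isRep_schwartz (s : ℝ) {φ : 𝓢(R3, Spinor)} {u : Dist}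
    (h : IsRep φ u) : ∃ f : H (-1) s, f.dist = u := by
  obtain ⟨g, hg⟩ := exists_wt_ofL2_of_isRep_schwartz s h
  exact ⟨⟨u, mem_sobolevSubmodule.2 ((isStable s).bes_mem _ (hg ▸ wt_neg_ofL2_mem_LW s g))⟩, rfl⟩

theorem isFree_zero_free {a b : ℝ} (h : Admissible a b) : IsFree 0 (free 0 a b) := by
  intro φ f hf
  obtain ⟨f', hf'⟩ := exists_dist_eq_of_isRep_schwartz 3 hf
  obtain ⟨g, hg⟩ := exists_wt_ofL2_of_isRep_schwartz 3 hf
  have hadm : Admissible 3 (-3) := admissible_neg (by norm_num)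
  rw [free_compat le_rfl h hadm hf'.symm,
    (free_eq_of_wt_eq (f := f') (hg.trans hf'.symm)).1]
  have h1 := isRep_hsOp (F := φ) (measurable_greenE 0) (hsNorm_greenE le_rfl hadm) (hg ▸ hf)
  rw [neg_neg] at h1
  refine h1.congr (Filter.Eventually.of_forall fun x => ?_)
  refine integral_congr_ae (Filter.Eventually.of_forall fun y => ?_)
  simp only
  rw [← Complex.coe_smul]
  congr 1
  simp [greenE, greenFn, freeKernel]

theorem isFree_one_freeOne {a b : ℝ} (ha : 3 / 2 < a) (hb : b < -3 / 2) :
    IsFree 1 (freeOne a b) := by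
  intro φ f hf
  obtain ⟨f', hf'⟩ := exists_dist_eq_of_isRep_schwartz 3 hf
  obtain ⟨g, hg⟩ := exists_wt_ofL2_of_isRep_schwartz 3 hf
  rw [freeOne_compat ha hb (a' := 3) (b' := -3) (by norm_num) (by norm_num) hf'.symm,
    (free_eq_of_wt_eq (f := f') (hg.trans hf'.symm)).2]
  have h1 := isRep_hsOp (F := φ) (b := -3) measurable_oneE (hsNorm_oneE (by norm_num)
    (by norm_num)) (hg ▸ hf)
  rw [neg_neg] at h1
  refine h1.congr (Filter.Eventually.of_forall fun x => ?_)
  refine integral_congr_ae ?_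
  -- The kernels `oneE` and `freeKernel 1` differ on the diagonal, which is a null set for each x.
  have : ∀ᵐ y : R3, y ≠ x := by simp [ae_iff, measure_singleton]
  filter_upwards [this] with y hy
  rw [← Complex.coe_smul]
  congr 1
  have hxy : ‖x - y‖ ≠ 0 := norm_ne_zero_iff.2 (sub_ne_zero.2 hy.symm)
  simp [oneE, freeKernel, mul_inv_cancel₀ hxy]

/-! ### Operators on `L²` defined by operators on distributions -/

/-- The restriction to `L²` of an operator on distributions that leaves `L²` invariant. -/
def distOp (Φ : Dist →L[ℂ] Dist) : L2 →L[ℂ] L2 :=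
  open Classical in
  if h : ∀ g : L2, Φ (ofL2 g) ∈ rangeL2 then (exists_clm_of_rangeL2 Φ h).choose else 0

theorem ofL2_distOp {Φ : Dist →L[ℂ] Dist} (h : ∀ g : L2, Φ (ofL2 g) ∈ rangeL2) (g : L2) :
    ofL2 (distOp Φ g) = Φ (ofL2 g) := by
  rw [distOp, dif_pos h]
  exact (exists_clm_of_rangeL2 Φ h).choose_spec g

/-- `⟨x⟩ ^ a Φ ⟨x⟩ ^ b` on `L²`. -/
def wtConj (a b : ℝ) (Φ : Dist →L[ℂ] Dist) : L2 →L[ℂ] L2 := distOp (wt a ∘L Φ ∘L wt b)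

theorem ofL2_wtConj {a b : ℝ} {Φ : Dist →L[ℂ] Dist} (h : ∀ u ∈ LW (-b), Φ u ∈ LW a) (g : L2) :
    ofL2 (wtConj a b Φ g) = wt a (Φ (wt b (ofL2 g))) := by
  rw [wtConj, ofL2_distOp]
  · rfl
  · intro g
    refine h _ ?_
    have := wt_neg_ofL2_mem_LW (-b) g
    rwa [neg_neg] at this

theorem wtConj_bes_mem {a b : ℝ} (hab : a + b ≤ 0) (u : Dist) (hu : u ∈ LW (-b)) :
    bes (-1) u ∈ LW a := (isStable a).bes_mem _ (LW_mono (by linarith) hu)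

theorem wtConj_dir_mem (j : Fin 3) {a b : ℝ} (hab : a + b ≤ 0) (u : Dist) (hu : u ∈ LW (-b)) :
    fm (dirSymbol j) u ∈ LW a := (isStable a).dir_mem j _ (LW_mono (by linarith) hu)

/-- For S = (1 - Δ)^(-1/2) ⟨x⟩^(-γ) the operator S* S = ⟨x⟩^(-γ) (1 - Δ)⁻¹ ⟨x⟩^(-γ) is the Green
operator at κ = 1, which is Hilbert-Schmidt for γ > 1. -/
theorem isCompactOperator_bes_wt {γ : ℝ} (hγ : 1 < γ) :
    IsCompactOperator (wtConj 0 (-γ) (bes (-1))) := by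
  have hadm : Admissible γ (-γ) := admissible_neg hγ
  refine isCompactOperator_of_inner
    (isCompactOperator_greenOp (κ := 1) (by simp) hadm) fun g => ?_
  set f := wtConj 0 (-γ) (bes (-1)) g with hf
  have hS : ofL2 f = bes (-1) (ofL2 (wtOp (-γ) g)) := by
    rw [hf, ofL2_wtConj (wtConj_bes_mem (by linarith)), wt_zero, ofL2_wtOp (by linarith)]
  obtain ⟨f', hf'⟩ := mem_rangeL2.1 (fm_mem_rangeL2 (hasTemperateGrowth_besselSymbol (-1))
    (norm_besselSymbol_le (by norm_num : (-1 : ℝ) ≤ 0)) (ofL2_mem f))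
  rw [← inner_bes_comm (by norm_num) hf' hS]
  symm
  refine inner_wt_comm ?_ (ofL2_wtOp (by linarith) g)
  have h1 := helm_greenOp (κ := 1) (by simp) hadm g
  have hone : ∀ u : Dist, helm 1 u = bes 2 u := fun u => by
    rw [helm, one_pow, sub_self]; module
  rw [hone] at h1
  rw [hf', hS, ofL2_wtOp (by linarith)]
  change _ = wt (-γ) (bes (-1) (bes (-1) _))
  rw [← h1, bes_bes, bes_bes, show (2 : ℝ) + (-1 + -1) = 0 by norm_num, bes_zero, neg_neg,
    wt_neg_wt]

/-- The operator is (1 - Δ)^(-1/2) ⟨x⟩^(a+b), compact by the previous lemma, times the bounded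
operator ⟨x⟩^(-(a+b)) (1 - Δ)^(1/2) ⟨x⟩^a (1 - Δ)^(-1/2) ⟨x⟩^b. The latter is bounded since
multiplication by ⟨x⟩^a maps H^{1,-b} to H^{1,-(a+b)}. -/
theorem isCompactOperator_wtConj_bes {a b : ℝ} (hab : a + b < -1) :
    IsCompactOperator (wtConj a b (bes (-1))) := by
  have hmem : ∀ u ∈ LW (-b), (bes 1 ∘L wt a ∘L bes (-1)) u ∈ LW (-(a + b)) := by
    intro u hu
    have h1 : bes (-1) u ∈ sobolevSubmodule 1 (a + -(a + b)) := by
      rw [mem_sobolevSubmodule, bes_bes_neg]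
      rwa [show a + -(a + b) = -b by ring]
    exact mem_sobolevSubmodule.1 (wt_mem_sobolev_one h1)
  have h : wtConj a b (bes (-1)) = wtConj 0 (a + b) (bes (-1)) ∘L
      wtConj (-(a + b)) b (bes 1 ∘L wt a ∘L bes (-1)) := by
    ext1 g
    apply ofL2_injective
    rw [ContinuousLinearMap.comp_apply, ofL2_wtConj (wtConj_bes_mem (by linarith)),
      ofL2_wtConj (wtConj_bes_mem (by linarith)), ofL2_wtConj hmem, wt_zero, wt_wt_neg]
    change _ = bes (-1) (bes 1 _)
    rw [bes_neg_bes]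
    rfl
  rw [h]
  have hc := isCompactOperator_bes_wt (γ := -(a + b)) (by linarith)
  rw [neg_neg] at hc
  exact hc.comp_clm _

/-! ### Multiplication by decaying matrix-valued functions -/

/-- Multiplication by a bounded matrix-valued function on `L²`. -/
def mulOp (M : R3 → Spinor →L[ℂ] Spinor) : L2 →L[ℂ] L2 :=
  open Classical in
  if h : AEStronglyMeasurable M volume ∧ ∃ C : ℝ, ∀ x, ‖M x‖ ≤ C then
    (exists_mulOp h.1 h.2.choose_spec).choose else 0

/-- Measurable matrix-valued functions that decay like `⟨x⟩ ^ (-β)`. -/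
structure Decays (β : ℝ) (M : R3 → Spinor →L[ℂ] Spinor) : Prop where
  meas : AEStronglyMeasurable M (volume : Measure R3)
  bound : ∃ C : ℝ, ∀ x, ‖M x‖ ≤ C * bracket (-β) x

/-- `⟨x⟩ ^ β M`. -/
def scaled (β : ℝ) (M : R3 → Spinor →L[ℂ] Spinor) (x : R3) : Spinor →L[ℂ] Spinor :=
  weight β x • M x

section

variable {β : ℝ} {M : R3 → Spinor →L[ℂ] Spinor}

theorem mulOp_scaled_ae_eq (h : Decays β M) (g : L2) :
    mulOp (scaled β M) g =ᵐ[volume] fun x => weight β x • M x (g x) := by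
  have h1 : AEStronglyMeasurable (scaled β M) volume ∧ ∃ C : ℝ, ∀ x, ‖scaled β M x‖ ≤ C := by
    obtain ⟨C, hC⟩ := h.bound
    refine ⟨(continuous_weight β).aestronglyMeasurable.smul h.meas, C, fun x => ?_⟩
    rw [scaled, norm_smul, norm_weight]
    have := bracket_pos β x
    calc _ ≤ bracket β x * (C * bracket (-β) x) := by gcongr; exact hC x
      _ = C * (bracket β x * bracket (-β) x) := by ring
      _ = C := by rw [bracket_mul_neg, mul_one]
  rw [mulOp, dif_pos h1]
  exact (exists_mulOp h1.1 h1.2.choose_spec).choose_spec g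

theorem isMul_wt_ofL2 (h : Decays β M) (a : ℝ) (g : L2) :
    IsMul M (wt (-a) (ofL2 g)) (wt (-(a + β)) (ofL2 (mulOp (scaled β M) g))) := by
  refine ⟨_, isRep_wt_ofL2 (-a) g, (isRep_wt_ofL2 _ _).congr ?_⟩
  filter_upwards [mulOp_scaled_ae_eq h g] with x hx
  rw [hx, smul_smul, ← Pi.mul_apply, weight_mul, map_smul]
  congr 2; ring

theorem wt_mulOp_comm (h : Decays β M) {r : ℝ} (hr : r ≤ 0) (g : L2) :
    wt r (ofL2 (mulOp (scaled β M) g)) = ofL2 (mulOp (scaled β M) (wtOp r g)) := by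
  symm
  rw [ofL2_eq_wt_iff]
  filter_upwards [mulOp_scaled_ae_eq h g, mulOp_scaled_ae_eq h (wtOp r g),
    ofL2_eq_wt_iff.1 (ofL2_wtOp hr g)] with x h1 h2 h3
  rw [h2, h1, h3, map_smul, smul_comm]

end

/-- A product is determined by its factors. -/
theorem IsMul.eq {M : R3 → Spinor →L[ℂ] Spinor} {u v v' : Dist} (h : IsMul M u v)
    (h' : IsMul M u v') : v = v' := by
  obtain ⟨f, hf, hv⟩ := h
  obtain ⟨f', hf', hv'⟩ := h'
  refine hv.dist_eq (hv'.congr ?_)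
  filter_upwards [hf.ae_eq hf'] with x hx
  rw [hx]

/-! ### First order perturbations of the Laplacian -/

section

variable {β : ℝ} {α : Fin 3 → R3 → Spinor →L[ℂ] Spinor} {c : R3 → Spinor →L[ℂ] Spinor}

variable (β α c) in
/-- The operator `-∑ P_j α_j - ∑ α_j P_j + c` from `H^{1,a}` to `H^{-1,a+β}`, conjugated to an
operator on `L²`. -/
def firstOrderOp (a : ℝ) : L2 →L[ℂ] L2 :=
  -(∑ j, wtConj (a + β) (-(a + β)) (fm (dirSymbol j)) ∘L mulOp (scaled β (α j)) ∘L
      wtConj a (-a) (bes (-1))) -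
    (∑ j, wtConj (a + β) (-(a + β)) (bes (-1)) ∘L mulOp (scaled β (α j)) ∘L
      wtConj a (-a) (fm (dirSymbol j))) +
    wtConj (a + β) (-(a + β)) (bes (-1)) ∘L mulOp (scaled β c) ∘L wtConj a (-a) (bes (-1))

variable (β α c) in
/-- The operator `-∑ P_j α_j - ∑ α_j P_j + c` from `H^{1,a}` to `H^{-1,a+β}`. -/
def firstOrder (a : ℝ) : H 1 a →L[ℂ] H (-1) (a + β) := H.conj _ _ _ _ (firstOrderOp β α c a)

theorem wtConj_bes_toL2 {a : ℝ} (u : H 1 a) :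
    wt (-a) (ofL2 (wtConj a (-a) (bes (-1)) (H.toL2 u))) = u.dist := by
  rw [ofL2_wtConj (wtConj_bes_mem (by linarith)), wt_neg_wt, H.dist_eq u]

theorem wtConj_dir_toL2 {a : ℝ} (j : Fin 3) (u : H 1 a) :
    wt (-a) (ofL2 (wtConj a (-a) (fm (dirSymbol j)) (H.toL2 u))) = momentum j u.dist := by
  rw [ofL2_wtConj (wtConj_dir_mem j (by linarith)), wt_neg_wt, ← momentum_bes_neg_one, H.dist_eq u]

/-- Each P_j is shared with the factor (1 - Δ)^(±1/2) coming from H^{1,a} or H^{-1,a+β}, leaving the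
order-zero operators of `firstOrderOp`. -/
theorem exists_firstOrder (hα : ∀ j, Decays β (α j)) (hc : Decays β c) {a : ℝ} (u : H 1 a) :
    ∃ (p q : Fin 3 → Dist) (r : Dist), (∀ j, IsMul (α j) u.dist (p j)) ∧
      (∀ j, IsMul (α j) (momentum j u.dist) (q j)) ∧ IsMul c u.dist r ∧
      (firstOrder β α c a u).dist = -(∑ j, momentum j (p j)) - ∑ j, q j + r := by
  set g := H.toL2 u with hg
  refine ⟨fun j => wt (-(a + β)) (ofL2 (mulOp (scaled β (α j)) (wtConj a (-a) (bes (-1)) g))),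
    fun j => wt (-(a + β)) (ofL2 (mulOp (scaled β (α j)) (wtConj a (-a) (fm (dirSymbol j)) g))),
    wt (-(a + β)) (ofL2 (mulOp (scaled β c) (wtConj a (-a) (bes (-1)) g))), fun j => ?_,
    fun j => ?_, ?_, ?_⟩
  · have := isMul_wt_ofL2 (hα j) a (wtConj a (-a) (bes (-1)) g)
    rwa [hg, wtConj_bes_toL2] at this
  · have := isMul_wt_ofL2 (hα j) a (wtConj a (-a) (fm (dirSymbol j)) g)
    rwa [hg, wtConj_dir_toL2] at this
  · have := isMul_wt_ofL2 hc a (wtConj a (-a) (bes (-1)) g)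
    rwa [hg, wtConj_bes_toL2] at this
  · have e1 : ∀ (j : Fin 3) (h : L2), bes 1 (wt (-(a + β))
        (ofL2 (wtConj (a + β) (-(a + β)) (fm (dirSymbol j)) h))) =
        momentum j (wt (-(a + β)) (ofL2 h)) := by
      intro j h
      rw [ofL2_wtConj (wtConj_dir_mem j (by linarith)), wt_neg_wt, ← bes_neg_one_momentum,
        bes_bes_neg]
    have e2 : ∀ h : L2, bes 1 (wt (-(a + β)) (ofL2 (wtConj (a + β) (-(a + β)) (bes (-1)) h))) =
        wt (-(a + β)) (ofL2 h) := by
      intro h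
      rw [ofL2_wtConj (wtConj_bes_mem (by linarith)), wt_neg_wt, bes_bes_neg]
    rw [firstOrder, H.dist_conj, neg_neg, firstOrderOp, ← hg]
    simp only [add_apply, sub_apply, neg_apply, sum_apply, map_add, map_sub, map_neg, map_sum,
      ContinuousLinearMap.comp_apply, e1, e2]

theorem isCompactOperator_sum {ι : Type*} (s : Finset ι) {T : ι → L2 →L[ℂ] L2}
    (h : ∀ i ∈ s, IsCompactOperator (T i)) : IsCompactOperator (∑ i ∈ s, T i : L2 →L[ℂ] L2) := by
  classical
  induction s using Finset.induction_on with
  | empty => simpa using (isCompactOperator_zero : IsCompactOperator (0 : L2 → L2))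
  | insert i s hi ih =>
    rw [Finset.sum_insert hi]
    exact (h i (Finset.mem_insert_self i s)).add
      (ih fun k hk => h k (Finset.mem_insert_of_mem hk))

/-- Every term contains a factor (1 - Δ)^(-1/2). The additional ⟨x⟩^(-β) can be brought next to it,
because it commutes with multiplication by matrix functions and otherwise only merges with
neighbouring weights. Then β > 1 gives compactness. -/
theorem isCompactOperator_wtOp_firstOrderOp (hβ : 1 < β) (hα : ∀ j, Decays β (α j))
    (a : ℝ) : IsCompactOperator (wtOp (-β) ∘L firstOrderOp β α c a) := by
  have h1 : wtOp (-β) ∘L firstOrderOp β α c a =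
      -(∑ j, wtConj a (-a) (fm (dirSymbol j)) ∘L mulOp (scaled β (α j)) ∘L
        wtConj (a - β) (-a) (bes (-1))) -
      (∑ j, wtConj a (-(a + β)) (bes (-1)) ∘L mulOp (scaled β (α j)) ∘L
        wtConj a (-a) (fm (dirSymbol j))) +
      wtConj a (-(a + β)) (bes (-1)) ∘L mulOp (scaled β c) ∘L wtConj a (-a) (bes (-1)) := by
    ext1 g
    apply ofL2_injective
    have e2 : ∀ h : L2, wt (-β) (ofL2 (wtConj (a + β) (-(a + β)) (bes (-1)) h)) =
        ofL2 (wtConj a (-(a + β)) (bes (-1)) h) := by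
      intro h
      rw [ofL2_wtConj (wtConj_bes_mem (by linarith)), ofL2_wtConj (wtConj_bes_mem (by linarith)),
        wt_wt]
      congr 2; ring
    have e1 : ∀ (j : Fin 3) (h : L2), wt (-β) (ofL2 (wtConj (a + β) (-(a + β)) (fm (dirSymbol j))
        (mulOp (scaled β (α j)) (wtConj a (-a) (bes (-1)) h)))) =
        ofL2 (wtConj a (-a) (fm (dirSymbol j)) (mulOp (scaled β (α j))
          (wtConj (a - β) (-a) (bes (-1)) h))) := by
      intro j h
      have e3 : wtConj (a - β) (-a) (bes (-1)) h = wtOp (-β) (wtConj a (-a) (bes (-1)) h) := by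
        apply ofL2_injective
        rw [ofL2_wtConj (wtConj_bes_mem (by linarith)), ofL2_wtOp (by linarith),
          ofL2_wtConj (wtConj_bes_mem (by linarith)), wt_wt]
        congr 2
      rw [e3, ofL2_wtConj (wtConj_dir_mem j (by linarith)),
        ofL2_wtConj (wtConj_dir_mem j (by linarith)), ← wt_mulOp_comm (hα j) (by linarith),
        wt_wt, wt_wt]
      congr 2
      · ring
      · congr 2; ring
    simp only [add_apply, sub_apply, neg_apply, sum_apply, map_add, map_sub, map_neg, map_sum,
      ContinuousLinearMap.comp_apply, firstOrderOp, ofL2_wtOp (by linarith : -β ≤ 0), e1, e2]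
  rw [h1]
  refine IsCompactOperator.add (IsCompactOperator.sub (IsCompactOperator.neg ?_) ?_) ?_
  · refine isCompactOperator_sum _ fun j _ => ?_
    exact ((isCompactOperator_wtConj_bes (by linarith)).clm_comp _).clm_comp _
  · refine isCompactOperator_sum _ fun j _ => ?_
    exact (isCompactOperator_wtConj_bes (by linarith)).comp_clm _
  · exact (isCompactOperator_wtConj_bes (by linarith)).comp_clm _

/-- The operator `G_0 W` is compact on `H^{1,-t}`. -/
theorem isCompactOperator_free_firstOrder (hβ : 1 < β) (hα : ∀ j, Decays β (α j)) {κ : ℂ}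
    (hκ : 0 ≤ κ.re) {a : ℝ} (h : Admissible (a + β) a) :
    IsCompactOperator (free κ (a + β) a ∘L firstOrder β α c a) := by
  rw [free, firstOrder, H.conj_comp]
  refine H.isCompactOperator_conj ?_
  rw [ContinuousLinearMap.add_comp, show a - (a + β) = -β by ring, ContinuousLinearMap.smul_comp]
  exact (isCompactOperator_wtOp_firstOrderOp hβ hα a).add
    (((isCompactOperator_greenOp hκ h).comp_clm _).smul _)

end

/-! ### Calculus of distributions given by functions -/

theorem IsRep.aestronglyMeasurable {f : R3 → Spinor} {u : Dist} (h : IsRep f u) :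
    AEStronglyMeasurable f (volume : Measure R3) := by
  obtain ⟨⟨m, hm⟩, -⟩ := h
  have h1 : f = fun x => bracket (-m) x • (bracket m x • f x) := by
    ext1 x; rw [smul_smul, bracket_neg_mul, one_smul]
  rw [h1]
  exact (continuous_bracket (-m)).aestronglyMeasurable.smul hm.1

theorem integrable_bracket_mono {f : R3 → Spinor} {m m' : ℝ} (h : m' ≤ m)
    (hf : Integrable fun x => bracket m x • f x) : Integrable fun x => bracket m' x • f x := by
  have h1 : (fun x => bracket m' x • f x) =
      fun x => bracket (m' - m) x • (bracket m x • f x) := by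
    ext1 x; rw [smul_smul, bracket_mul, sub_add_cancel]
  rw [h1]
  refine hf.bdd_smul 1 (continuous_bracket _).aestronglyMeasurable
    (Filter.Eventually.of_forall fun x => ?_)
  rw [Real.norm_of_nonneg (bracket_pos _ _).le]
  exact bracket_le_one (by linarith) x

theorem IsRep.integrable_smul {f : R3 → Spinor} {u : Dist} (h : IsRep f u) (φ : 𝓢(R3, ℂ)) :
    Integrable fun x => φ x • f x := by
  obtain ⟨⟨m, hm⟩, -⟩ := h
  have hw := hasTemperateGrowth_weight (-m)
  obtain ⟨M, hM, hb⟩ := schwartz_bound (SchwartzMap.smulLeftCLM ℂ (weight (-m)) φ)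
  have h1 : (fun x => φ x • f x) =
      fun x => (SchwartzMap.smulLeftCLM ℂ (weight (-m)) φ) x • (bracket m x • f x) := by
    ext1 x
    rw [SchwartzMap.smulLeftCLM_apply_apply hw, ← Complex.coe_smul, smul_smul, smul_eq_mul]
    congr 1
    have := weight_neg_mul m x
    change φ x = weight (-m) x * φ x * weight m x
    linear_combination (-φ x) * this
  rw [h1]
  exact hm.bdd_smul M (SchwartzMap.continuous _).aestronglyMeasurable
    (Filter.Eventually.of_forall fun x => (hb x).1)

theorem IsRep.add {f f' : R3 → Spinor} {u u' : Dist} (h : IsRep f u) (h' : IsRep f' u') :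
    IsRep (fun x => f x + f' x) (u + u') := by
  refine ⟨?_, fun φ => ?_⟩
  · obtain ⟨⟨m, hm⟩, -⟩ := h
    obtain ⟨⟨m', hm'⟩, -⟩ := h'
    refine ⟨min m m', ?_⟩
    simp_rw [smul_add]
    exact (integrable_bracket_mono (min_le_left _ _) hm).add
      (integrable_bracket_mono (min_le_right _ _) hm')
  · rw [add_apply, h.2, h'.2, ← integral_add (h.integrable_smul φ) (h'.integrable_smul φ)]
    simp_rw [smul_add]

theorem IsRep.smul {f : R3 → Spinor} {u : Dist} (h : IsRep f u) (c : ℂ) :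
    IsRep (fun x => c • f x) (c • u) := by
  refine ⟨?_, fun φ => ?_⟩
  · obtain ⟨⟨m, hm⟩, -⟩ := h
    refine ⟨m, ?_⟩
    simp_rw [smul_comm _ c]
    exact hm.smul c
  · rw [smul_apply, h.2, ← integral_smul]
    simp_rw [smul_comm c]

theorem IsRep.zero : IsRep (fun _ => 0) 0 := ⟨⟨0, by simp⟩, fun φ => by simp⟩

theorem IsRep.neg {f : R3 → Spinor} {u : Dist} (h : IsRep f u) : IsRep (fun x => -f x) (-u) := by
  have := h.smul (-1)
  rw [show (-1 : ℂ) • u = -u by module] at this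
  simpa using this

theorem IsRep.sum {ι : Type*} {s : Finset ι} {f : ι → R3 → Spinor} {u : ι → Dist}
    (h : ∀ i ∈ s, IsRep (f i) (u i)) : IsRep (fun x => ∑ i ∈ s, f i x) (∑ i ∈ s, u i) := by
  classical
  induction s using Finset.induction_on with
  | empty => simpa using IsRep.zero
  | insert i s hi ih =>
    simp_rw [Finset.sum_insert hi]
    exact (h i (Finset.mem_insert_self i s)).add
      (ih fun k hk => h k (Finset.mem_insert_of_mem hk))

theorem spinAct_apply (T : Spinor →L[ℂ] Spinor) (u : Dist) (φ : 𝓢(R3, ℂ)) :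
    spinAct T u φ = T (u φ) := rfl

theorem IsRep.spinAct {f : R3 → Spinor} {u : Dist} (h : IsRep f u) (T : Spinor →L[ℂ] Spinor) :
    IsRep (fun x => T (f x)) (spinAct T u) := by
  refine ⟨?_, fun φ => ?_⟩
  · obtain ⟨⟨m, hm⟩, -⟩ := h
    refine ⟨m, ?_⟩
    have := T.integrable_comp hm
    refine this.congr (Filter.Eventually.of_forall fun x => ?_)
    simp only [← Complex.coe_smul, map_smul]
  · rw [spinAct_apply, h.2, ← T.integral_comp_comm (h.integrable_smul φ)]
    simp_rw [map_smul]

theorem exists_isRep_of_mem_LW {s : ℝ} {u : Dist} (h : u ∈ LW s) : ∃ f, IsRep f u := by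
  obtain ⟨g, rfl⟩ := mem_LW_iff_exists.1 h
  exact ⟨_, isRep_wt_ofL2 _ g⟩

theorem IsRep.locallyIntegrable {f : R3 → Spinor} {u : Dist} (h : IsRep f u) :
    LocallyIntegrable f (volume : Measure R3) := by
  obtain ⟨⟨m, hm⟩, -⟩ := h
  have h1 : f = fun x => bracket (-m) x • (bracket m x • f x) := by
    ext1 x; rw [smul_smul, bracket_neg_mul, one_smul]
  rw [h1]
  exact hm.locallyIntegrable.continuous_smul (continuous_bracket (-m))

/-! ### Integration by parts against compactly supported `C¹` functions -/

/-- A sequence of bump functions concentrating at the origin. -/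
def shrinkingBump (n : ℕ) : ContDiffBump (0 : R3) where
  rIn := 1 / (2 * (n + 1))
  rOut := 1 / (n + 1)
  rIn_pos := by positivity
  rIn_lt_rOut := by
    apply one_div_lt_one_div_of_lt (by positivity)
    have : (0 : ℝ) < n + 1 := by positivity
    linarith

theorem shrinkingBump_rOut_le (n : ℕ) : (shrinkingBump n).rOut ≤ 1 := by
  change (1 : ℝ) / (n + 1) ≤ 1
  rw [div_le_one (by positivity)]
  have : (0 : ℝ) ≤ n := by positivity
  linarith

/-- Mollification. -/
def mollify (n : ℕ) (h : R3 → ℂ) : R3 → ℂ :=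
  convolution ((shrinkingBump n).normed volume) h (ContinuousLinearMap.lsmul ℝ ℝ) volume

theorem tendsto_mollify {h : R3 → ℂ} (hc : Continuous h) (x : R3) :
    Filter.Tendsto (fun n => mollify n h x) Filter.atTop (𝓝 (h x)) :=
  ContDiffBump.convolution_tendsto_right_of_continuous
    (tendsto_one_div_add_atTop_nhds_zero_nat (𝕜 := ℝ)) hc x

theorem exists_norm_mollify_le {h : R3 → ℂ} (hc : Continuous h) (hs : HasCompactSupport h) :
    ∃ (M R : ℝ), ∀ n x, ‖mollify n h x‖ ≤ (Metric.closedBall (0 : R3) R).indicator (fun _ => M) x := by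
  -- The bumps live in the unit ball, so R + 1 serves for all n. The bound 3M is |h| ≤ M plus the
  -- oscillation bound 2M.
  obtain ⟨M, hM⟩ := hs.exists_bound_of_continuous hc
  obtain ⟨R, hR⟩ := hs.isCompact.isBounded.subset_closedBall (0 : R3)
  refine ⟨3 * M, R + 1, fun n x => ?_⟩
  have hm := hc.aestronglyMeasurable (μ := (volume : Measure R3))
  by_cases hx : x ∈ Metric.closedBall (0 : R3) (R + 1)
  · rw [Set.indicator_of_mem hx]
    have h1 := ContDiffBump.dist_normed_convolution_le (φ := shrinkingBump n) (x₀ := x)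
      (ε := 2 * M) hm (fun y _ => by
        rw [dist_eq_norm]
        refine (norm_sub_le _ _).trans ?_
        linarith [hM x, hM y])
    rw [dist_eq_norm] at h1
    have h2 : mollify n h x = (mollify n h x - h x) + h x := by abel
    rw [h2]
    refine (norm_add_le _ _).trans ?_
    have h3 : ‖mollify n h x - h x‖ ≤ 2 * M := h1
    linarith [hM x]
  · rw [Set.indicator_of_notMem hx]
    have hz : ∀ y ∈ Metric.ball x (shrinkingBump n).rOut, h y = 0 := by
      intro y hy
      by_contra hne
      have h1 := hR (subset_tsupport h hne)
      apply hx
      rw [mem_closedBall_zero_iff] at h1 ⊢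
      have h2 := (Metric.mem_ball.1 hy).le.trans (shrinkingBump_rOut_le n)
      rw [dist_eq_norm] at h2
      have h3 : ‖x‖ ≤ ‖y‖ + ‖y - x‖ := by
        have := norm_sub_le y (y - x); simpa using this
      linarith
    have h1 := ContDiffBump.dist_normed_convolution_le (φ := shrinkingBump n) (x₀ := x)
      (ε := 0) hm (fun y hy => by
        rw [hz y hy, hz x (Metric.mem_ball_self (shrinkingBump n).rOut_pos), dist_self])
    have h2 := dist_le_zero.1 h1
    change ‖mollify n h x‖ ≤ 0
    rw [mollify, h2, hz x (Metric.mem_ball_self (shrinkingBump n).rOut_pos), norm_zero]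

theorem tendsto_integral_mollify {h : R3 → ℂ} (hc : Continuous h) (hs : HasCompactSupport h)
    {f : R3 → Spinor} {u : Dist} (hf : IsRep f u) :
    Filter.Tendsto (fun n => ∫ x, mollify n h x • f x) Filter.atTop (𝓝 (∫ x, h x • f x)) := by
  obtain ⟨M, R, hb⟩ := exists_norm_mollify_le hc hs
  have hmeas : ∀ n, AEStronglyMeasurable (mollify n h) (volume : Measure R3) := fun n =>
    (hs.continuous_convolution_right _ ((shrinkingBump n).integrable_normed.locallyIntegrable)
      hc).aestronglyMeasurable
  refine tendsto_integral_of_dominated_convergence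
    (fun x => (Metric.closedBall (0 : R3) R).indicator (fun x => M * ‖f x‖) x) (fun n =>
      (hmeas n).smul hf.aestronglyMeasurable) ?_ (fun n => Filter.Eventually.of_forall fun x => ?_)
    (Filter.Eventually.of_forall fun x => (tendsto_mollify hc x).smul_const _)
  · rw [integrable_indicator_iff Metric.isClosed_closedBall.measurableSet]
    exact ((hf.locallyIntegrable.integrableOn_isCompact
      (isCompact_closedBall 0 R)).norm.const_mul M)
  · rw [norm_smul]
    refine (mul_le_mul_of_nonneg_right (hb n x) (norm_nonneg _)).trans (le_of_eq ?_)
    by_cases hx : x ∈ Metric.closedBall (0 : R3) R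
    · rw [Set.indicator_of_mem hx, Set.indicator_of_mem hx]
    · rw [Set.indicator_of_notMem hx, Set.indicator_of_notMem hx, zero_mul]

/-- Distributional derivatives are tested on smooth functions, but products with a C¹ vector
potential are only C¹. Mollification commutes with the derivative, and both sides converge by
dominated convergence. -/
theorem integral_smul_momentum {f f' : R3 → Spinor} {u : Dist} {j : Fin 3} (hf : IsRep f u)
    (hf' : IsRep f' (momentum j u)) {ψ : R3 → ℂ} (hψ : ContDiff ℝ 1 ψ) (hs : HasCompactSupport ψ) :
    ∫ x, ψ x • f' x = Complex.I • ∫ x, fderiv ℝ ψ x (axis j) • f x := by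
  have hsd : HasCompactSupport fun x => fderiv ℝ ψ x (axis j) := hs.fderiv_apply ℝ (axis j)
  have hcd : Continuous fun x => fderiv ℝ ψ x (axis j) :=
    (hψ.continuous_fderiv one_ne_zero).clm_apply continuous_const
  refine tendsto_nhds_unique (tendsto_integral_mollify hψ.continuous hs hf')
    (((tendsto_integral_mollify hcd hsd hf).const_smul Complex.I).congr fun n => ?_)
  have hli : LocallyIntegrable ((shrinkingBump n).normed volume) (volume : Measure R3) :=
    (shrinkingBump n).integrable_normed.locallyIntegrable
  have hcs : HasCompactSupport (mollify n ψ) :=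
    HasCompactSupport.convolution _ (shrinkingBump n).hasCompactSupport_normed hs
  have hcd' : ContDiff ℝ ((⊤ : ℕ∞) : WithTop ℕ∞) (mollify n ψ) :=
    (shrinkingBump n).hasCompactSupport_normed.contDiff_convolution_left _
      (shrinkingBump n).contDiff_normed hψ.continuous.locallyIntegrable
  have h1 := hf'.2 (hcs.toSchwartzMap hcd')
  rw [momentum_apply, hf.2] at h1
  have h2 : ∀ x, (∂_{axis j} (hcs.toSchwartzMap hcd')) x =
      mollify n (fun x => fderiv ℝ ψ x (axis j)) x := by
    intro x
    rw [SchwartzMap.lineDerivOp_apply_eq_fderiv]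
    have h3 := hs.hasFDerivAt_convolution_right (ContinuousLinearMap.lsmul ℝ ℝ) hli hψ x
    have h4 : fderiv ℝ (hcs.toSchwartzMap hcd') x = _ := h3.fderiv
    rw [h4, convolution_precompR_apply _ hli (hs.fderiv ℝ) (hψ.continuous_fderiv one_ne_zero)]
    rfl
  simp_rw [h2] at h1
  exact h1

/-! ### Cutoffs -/

/-- A smooth function which is `1` near the origin. -/
def plateau : ContDiffBump (0 : R3) := ⟨1, 2, one_pos, one_lt_two⟩

/-- The cutoff function at radius `n + 1`. -/
def cutoff (n : ℕ) (x : R3) : ℂ := (plateau (((n : ℝ) + 1)⁻¹ • x) : ℝ)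

theorem contDiff_cutoff (n : ℕ) {m : ℕ∞} : ContDiff ℝ m (cutoff n) :=
  Complex.ofRealCLM.contDiff.comp (plateau.contDiff.comp (contDiff_const_smul _))

theorem hasCompactSupport_cutoff (n : ℕ) : HasCompactSupport (cutoff n) := by
  have h1 : HasCompactSupport fun x : R3 => plateau (((n : ℝ) + 1)⁻¹ • x) :=
    plateau.hasCompactSupport.comp_homeomorph (Homeomorph.smulOfNeZero (((n : ℝ) + 1)⁻¹)
      (by positivity))
  exact h1.comp_left Complex.ofReal_zero

theorem norm_cutoff_le (n : ℕ) (x : R3) : ‖cutoff n x‖ ≤ 1 := by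
  rw [cutoff, Complex.norm_real, Real.norm_of_nonneg plateau.nonneg]
  exact plateau.le_one

theorem tendsto_inv_smul (x : R3) :
    Filter.Tendsto (fun n : ℕ => ((n : ℝ) + 1)⁻¹ • x) Filter.atTop (𝓝 0) := by
  have h := (tendsto_one_div_add_atTop_nhds_zero_nat (𝕜 := ℝ)).smul_const x
  simpa using h

theorem tendsto_cutoff (x : R3) : Filter.Tendsto (fun n => cutoff n x) Filter.atTop (𝓝 1) := by
  have h1 := (plateau.continuous.tendsto 0).comp (tendsto_inv_smul x)
  have h2 := (Complex.continuous_ofReal.tendsto _).comp h1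
  rw [plateau.one_of_mem_closedBall (by simp [plateau])] at h2
  exact h2

theorem fderiv_cutoff (n : ℕ) (x v : R3) : fderiv ℝ (cutoff n) x v =
    ((((n : ℝ) + 1)⁻¹ * fderiv ℝ plateau (((n : ℝ) + 1)⁻¹ • x) v : ℝ) : ℂ) := by
  have h1 : HasFDerivAt (fun x : R3 => ((n : ℝ) + 1)⁻¹ • x)
      (((n : ℝ) + 1)⁻¹ • ContinuousLinearMap.id ℝ R3) x :=
    (((n : ℝ) + 1)⁻¹ • ContinuousLinearMap.id ℝ R3).hasFDerivAt
  have h2 : HasFDerivAt plateau (fderiv ℝ plateau (((n : ℝ) + 1)⁻¹ • x)) (((n : ℝ) + 1)⁻¹ • x) :=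
    ((plateau.contDiff (n := 1)).differentiable one_ne_zero _).hasFDerivAt
  have h3 := Complex.ofRealCLM.hasFDerivAt.comp x (h2.comp x h1)
  have h4 : fderiv ℝ (cutoff n) x = _ := h3.fderiv
  rw [h4]
  simp

theorem exists_norm_fderiv_cutoff_le (v : R3) : ∃ C : ℝ, ∀ n x,
    ‖fderiv ℝ (cutoff n) x v‖ ≤ ((n : ℝ) + 1)⁻¹ * C := by
  have hc : Continuous fun x => fderiv ℝ plateau x v :=
    ((plateau.contDiff (n := 1)).continuous_fderiv one_ne_zero).clm_apply continuous_const
  obtain ⟨C, hC⟩ := (plateau.hasCompactSupport.fderiv_apply ℝ v).exists_bound_of_continuous hc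
  refine ⟨C, fun n x => ?_⟩
  rw [fderiv_cutoff, Complex.norm_real, norm_mul, Real.norm_of_nonneg (by positivity)]
  gcongr
  exact hC _

theorem contDiff_cutoff_mul (n : ℕ) (φ : 𝓢(R3, ℂ)) :
    ContDiff ℝ ((⊤ : ℕ∞) : WithTop ℕ∞) fun x => cutoff n x * φ x :=
  (contDiff_cutoff n).mul φ.smooth'

theorem fderiv_cutoff_mul (n : ℕ) (φ : 𝓢(R3, ℂ)) (x v : R3) :
    fderiv ℝ (fun x => cutoff n x * φ x) x v =
      cutoff n x * (∂_{v} φ) x + fderiv ℝ (cutoff n) x v * φ x := by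
  have h1 : HasFDerivAt (cutoff n) (fderiv ℝ (cutoff n) x) x :=
    ((contDiff_cutoff n (m := 1)).differentiable one_ne_zero _).hasFDerivAt
  have h2 : HasFDerivAt φ (fderiv ℝ φ x) x := φ.differentiableAt.hasFDerivAt
  have h3 : HasFDerivAt (fun x => cutoff n x * φ x) _ x := h1.mul h2
  rw [h3.fderiv, SchwartzMap.lineDerivOp_apply_eq_fderiv]
  simp [mul_comm]

theorem continuous_fderiv_cutoff_mul (n : ℕ) (φ : 𝓢(R3, ℂ)) (v : R3) :
    Continuous fun x => fderiv ℝ (fun x => cutoff n x * φ x) x v := by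
  have h : ContDiff ℝ 1 fun x => cutoff n x * φ x :=
    (contDiff_cutoff_mul n φ).of_le (by exact_mod_cast le_top)
  exact (h.continuous_fderiv one_ne_zero).clm_apply continuous_const

theorem tendsto_integral_cutoff_mul (φ : 𝓢(R3, ℂ)) {f : R3 → Spinor} {u : Dist} (hf : IsRep f u) :
    Filter.Tendsto (fun n => ∫ x, (cutoff n x * φ x) • f x) Filter.atTop (𝓝 (u φ)) := by
  rw [hf.2]
  refine tendsto_integral_of_dominated_convergence (fun x => ‖φ x • f x‖) (fun n =>
      ((contDiff_cutoff_mul n φ).continuous.aestronglyMeasurable).smul hf.aestronglyMeasurable)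
      (hf.integrable_smul φ).norm (fun n => Filter.Eventually.of_forall fun x => ?_)
      (Filter.Eventually.of_forall fun x => ?_)
  · rw [norm_smul, norm_smul, norm_mul]
    gcongr
    exact mul_le_of_le_one_left (norm_nonneg _) (norm_cutoff_le n x)
  · have := ((tendsto_cutoff x).mul_const (φ x)).smul_const (f x)
    simpa using this

theorem exists_norm_fderiv_cutoff_mul_le (φ : 𝓢(R3, ℂ)) (v : R3) : ∃ C : ℝ, ∀ n x,
    ‖fderiv ℝ (fun x => cutoff n x * φ x) x v‖ ≤ ‖(∂_{v} φ) x‖ + C * ‖φ x‖ := by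
  obtain ⟨C, hC⟩ := exists_norm_fderiv_cutoff_le v
  have hC0 : 0 ≤ C := by
    have := (norm_nonneg _).trans (hC 0 0)
    simpa using this
  refine ⟨C, fun n x => ?_⟩
  have hinv : ((n : ℝ) + 1)⁻¹ ≤ 1 :=
    inv_le_one_of_one_le₀ (le_add_of_nonneg_left n.cast_nonneg)
  rw [fderiv_cutoff_mul]
  refine (norm_add_le _ _).trans (add_le_add ?_ ?_)
  · rw [norm_mul]
    exact mul_le_of_le_one_left (norm_nonneg _) (norm_cutoff_le n x)
  · rw [norm_mul]
    exact mul_le_mul_of_nonneg_right ((hC n x).trans (mul_le_of_le_one_left hC0 hinv))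
      (norm_nonneg _)

theorem tendsto_fderiv_cutoff_mul (φ : 𝓢(R3, ℂ)) (v x : R3) :
    Filter.Tendsto (fun n => fderiv ℝ (fun x => cutoff n x * φ x) x v) Filter.atTop
      (𝓝 ((∂_{v} φ) x)) := by
  obtain ⟨C, hC⟩ := exists_norm_fderiv_cutoff_le v
  have h0 : Filter.Tendsto (fun n : ℕ => ((n : ℝ) + 1)⁻¹ * C) Filter.atTop (𝓝 0) := by
    have h := (tendsto_one_div_add_atTop_nhds_zero_nat (𝕜 := ℝ)).mul_const C
    simpa using h
  have h1 : Filter.Tendsto (fun n => fderiv ℝ (cutoff n) x v) Filter.atTop (𝓝 0) :=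
    squeeze_zero_norm (fun n => hC n x) h0
  have h2 := ((tendsto_cutoff x).mul_const ((∂_{v} φ) x)).add (h1.mul_const (φ x))
  rw [one_mul, zero_mul, add_zero] at h2
  exact h2.congr fun n => (fderiv_cutoff_mul n φ x v).symm

/-- The derivative of the cutoff is O(1/n) uniformly in x, so the term in which it appears vanishes
in the limit. -/
theorem tendsto_integral_fderiv_cutoff_mul (φ : 𝓢(R3, ℂ)) (v : R3) {f : R3 → Spinor} {u : Dist}
    (hf : IsRep f u) :
    Filter.Tendsto (fun n => ∫ x, fderiv ℝ (fun x => cutoff n x * φ x) x v • f x)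
      Filter.atTop (𝓝 (u (∂_{v} φ))) := by
  obtain ⟨C, hC⟩ := exists_norm_fderiv_cutoff_mul_le φ v
  have hlim := tendsto_fderiv_cutoff_mul φ v
  have hcont := fun n => continuous_fderiv_cutoff_mul n φ v
  generalize hF : (fun (n : ℕ) x => fderiv ℝ (fun x => cutoff n x * φ x) x v) = F
  have hF' : ∀ n x, fderiv ℝ (fun x => cutoff n x * φ x) x v = F n x := fun n x => by rw [← hF]
  simp only [hF'] at hC hlim hcont ⊢
  have h1 := hf.integrable_smul (∂_{v} φ)
  have h2 := hf.integrable_smul φ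
  have h3 := hf.aestronglyMeasurable
  rw [hf.2]
  clear hf
  generalize (∂_{v} φ) = φ' at *
  have hm : ∀ n, AEStronglyMeasurable (fun x => F n x • f x) volume := fun n =>
    (hcont n).aestronglyMeasurable.smul h3
  have hb : ∀ n, ∀ᵐ x, ‖F n x • f x‖ ≤ ‖φ' x • f x‖ + C * ‖φ x • f x‖ := fun n =>
    Filter.Eventually.of_forall fun x => by
      rw [norm_smul, norm_smul, norm_smul, ← mul_assoc, ← add_mul]
      exact mul_le_mul_of_nonneg_right (hC n x) (norm_nonneg _)
  have hl : ∀ᵐ x, Filter.Tendsto (fun n => F n x • f x) Filter.atTop (𝓝 (φ' x • f x)) :=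
    Filter.Eventually.of_forall fun x => (hlim x).smul_const (f x)
  exact tendsto_integral_of_dominated_convergence _ hm (h1.norm.add (h2.norm.const_mul C)) hb hl

/-! ### The commutator of two covariant derivatives -/

theorem norm_coord_le (y : R3) (j : Fin 3) : ‖((y j : ℝ) : ℂ)‖ ≤ ‖y‖ := by
  rw [Complex.norm_real]; exact abs_coord_le y j

/-- Product rule for the antisymmetrized derivative of A u. No growth bound is available for the
single derivatives ∂_j A_k, only for the curl. Hence the product rule is applied with compactly
supported test functions, the two expressions are subtracted, and only then is the cutoff removed.
-/
theorem momentum_curl {A : R3 → R3} (hA : ContDiff ℝ 1 A) {f : R3 → Spinor}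
    {f' : Fin 3 → R3 → Spinor} {u : Dist} (hf : IsRep f u)
    (hf' : ∀ j, IsRep (f' j) (momentum j u)) {p : Fin 3 → Dist} {q : Fin 3 → Fin 3 → Dist} {b : Dist}
    (hp : ∀ j, IsRep (fun x => (A x j : ℂ) • f x) (p j))
    (hq : ∀ j k, IsRep (fun x => (A x j : ℂ) • f' k x) (q j k)) (j k : Fin 3)
    (hb : IsRep (fun x => ((partialD A j k x - partialD A k j x : ℝ) : ℂ) • f x) b) :
    momentum j (p k) - momentum k (p j) = q k j - q j k - Complex.I • b := by
  have hcoord : ∀ i : Fin 3, ContDiff ℝ 1 fun x => ((A x i : ℝ) : ℂ) := fun i =>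
    Complex.ofRealCLM.contDiff.comp
      ((EuclideanSpace.proj i : R3 →L[ℝ] ℝ).contDiff.comp hA)
  have hpart : ∀ (i l : Fin 3) (x : R3),
      fderiv ℝ (fun x => ((A x i : ℝ) : ℂ)) x (axis l) = (partialD A l i x : ℂ) := by
    intro i l x
    have h1 : HasFDerivAt A (fderiv ℝ A x) x := (hA.differentiable one_ne_zero x).hasFDerivAt
    have h2 := Complex.ofRealCLM.hasFDerivAt.comp x
      ((EuclideanSpace.proj i : R3 →L[ℝ] ℝ).hasFDerivAt.comp x h1)
    have h3 : fderiv ℝ (fun x => ((A x i : ℝ) : ℂ)) x = _ := h2.fderiv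
    rw [h3]
    rfl
  ext1 φ
  have key : ∀ n, (∫ x, fderiv ℝ (fun x => cutoff n x * φ x) x (axis j) • ((A x k : ℂ) • f x)) -
      (∫ x, fderiv ℝ (fun x => cutoff n x * φ x) x (axis k) • ((A x j : ℂ) • f x)) =
      -Complex.I • ((∫ x, (cutoff n x * φ x) • ((A x k : ℂ) • f' j x)) -
        ∫ x, (cutoff n x * φ x) • ((A x j : ℂ) • f' k x)) -
      ∫ x, (cutoff n x * φ x) • (((partialD A j k x - partialD A k j x : ℝ) : ℂ) • f x) := by
    intro n
    set ψ : R3 → ℂ := fun x => cutoff n x * φ x with hψ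
    have hψ1 : ContDiff ℝ 1 ψ := (contDiff_cutoff_mul n φ).of_le (by exact_mod_cast le_top)
    have hψs : HasCompactSupport ψ := (hasCompactSupport_cutoff n).mul_right
    have hfd : ∀ (i l : Fin 3) x, fderiv ℝ (fun x => ψ x * ((A x i : ℝ) : ℂ)) x (axis l) =
        fderiv ℝ ψ x (axis l) * (A x i : ℂ) + ψ x * (partialD A l i x : ℂ) := by
      intro i l x
      have h1 : HasFDerivAt ψ (fderiv ℝ ψ x) x := (hψ1.differentiable one_ne_zero x).hasFDerivAt
      have h2 := ((hcoord i).differentiable one_ne_zero x).hasFDerivAt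
      have h3 : HasFDerivAt (fun x => ψ x * ((A x i : ℝ) : ℂ)) _ x := h1.mul h2
      rw [h3.fderiv, ← hpart]
      simp
      ring
    have ibp : ∀ i l : Fin 3, ∫ x, ψ x • ((A x i : ℂ) • f' l x) = Complex.I •
        ∫ x, (fderiv ℝ ψ x (axis l) * (A x i : ℂ) + ψ x * (partialD A l i x : ℂ)) • f x := by
      intro i l
      have h1 := integral_smul_momentum hf (hf' l) (hψ1.mul (hcoord i)) hψs.mul_right
      simp_rw [hfd] at h1
      rw [← h1]
      simp_rw [mul_smul]
    have hint : ∀ g : R3 → ℂ, Continuous g → HasCompactSupport g → Integrable fun x => g x • f x :=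
      fun g hg hgs => hf.locallyIntegrable.integrable_smul_left_of_hasCompactSupport hg hgs
    have hcd : ∀ i l : Fin 3, Continuous fun x => fderiv ℝ ψ x (axis l) * (A x i : ℂ) := fun i l =>
      ((hψ1.continuous_fderiv one_ne_zero).clm_apply continuous_const).mul (hcoord i).continuous
    have hcp : ∀ i l : Fin 3, Continuous fun x => ψ x * (partialD A l i x : ℂ) := fun i l => by
      refine hψ1.continuous.mul ?_
      simp_rw [← hpart]
      exact ((hcoord i).continuous_fderiv one_ne_zero).clm_apply continuous_const
    have hs1 : ∀ i l : Fin 3, HasCompactSupport fun x => fderiv ℝ ψ x (axis l) * (A x i : ℂ) :=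
      fun i l => (hψs.fderiv_apply ℝ (axis l)).mul_right
    have hs2 : ∀ i l : Fin 3, HasCompactSupport fun x => ψ x * (partialD A l i x : ℂ) :=
      fun i l => hψs.mul_right
    have e1 : ∀ i l : Fin 3,
        ∫ x, (fderiv ℝ ψ x (axis l) * (A x i : ℂ) + ψ x * (partialD A l i x : ℂ)) • f x =
        (∫ x, (fderiv ℝ ψ x (axis l) * (A x i : ℂ)) • f x) +
          ∫ x, (ψ x * (partialD A l i x : ℂ)) • f x := by
      intro i l
      rw [← integral_add (hint _ (hcd i l) (hs1 i l)) (hint _ (hcp i l) (hs2 i l))]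
      simp_rw [add_smul]
    have e2 : ∫ x, ψ x • (((partialD A j k x - partialD A k j x : ℝ) : ℂ) • f x) =
        (∫ x, (ψ x * (partialD A j k x : ℂ)) • f x) -
          ∫ x, (ψ x * (partialD A k j x : ℂ)) • f x := by
      rw [← integral_sub (hint _ (hcp k j) (hs2 k j)) (hint _ (hcp j k) (hs2 j k))]
      refine integral_congr_ae (Filter.Eventually.of_forall fun x => ?_)
      simp only [← sub_smul, smul_smul]
      push_cast
      congr 1; ring
    rw [ibp, ibp, e1, e1, e2, ← smul_sub, smul_smul]
    simp_rw [smul_smul]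
    rw [show -Complex.I * Complex.I = 1 by rw [neg_mul, Complex.I_mul_I, neg_neg]]
    module
  have l1 := (tendsto_integral_fderiv_cutoff_mul φ (axis j) (hp k)).sub
    (tendsto_integral_fderiv_cutoff_mul φ (axis k) (hp j))
  have l2 := (((tendsto_integral_cutoff_mul φ (hq k j)).sub
    (tendsto_integral_cutoff_mul φ (hq j k))).const_smul (-Complex.I)).sub
    (tendsto_integral_cutoff_mul φ hb)
  simp_rw [key] at l1
  have h := tendsto_nhds_unique l1 l2
  simp only [sub_apply, smul_apply, momentum_apply]
  rw [← smul_sub, h, smul_sub, smul_smul,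
    show Complex.I * -Complex.I = 1 by rw [mul_neg, Complex.I_mul_I, neg_neg], one_smul]

/-! ### The square of the Pauli-Dirac operator -/

/-- This is σ_j σ_k = δ_jk + i ε_jkl σ_l: the diagonal part of T survives as it is, the rest through
its antisymmetric part. -/
theorem sum_pauliOp (T : Fin 3 → Fin 3 → Spinor) :
    ∑ j, pauliOp j (∑ k, pauliOp k (T j k)) = ∑ j, T j j + Complex.I •
      (pauliOp 0 (T 1 2 - T 2 1) + pauliOp 1 (T 2 0 - T 0 2) + pauliOp 2 (T 0 1 - T 1 0)) := by
  ext i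
  fin_cases i <;>
  · simp [Fin.sum_univ_three, pauliOp, pauli, Matrix.ofLp_toEuclideanCLM, Matrix.mulVec,
      dotProduct]
    ring_nf
    simp only [Complex.I_sq]
    ring

theorem spinAct_map_sub (T : Spinor →L[ℂ] Spinor) (u v : Dist) :
    spinAct T (u - v) = spinAct T u - spinAct T v := by
  ext1 φ; simp only [spinAct_apply, sub_apply, map_sub]

theorem spinAct_map_smul (T : Spinor →L[ℂ] Spinor) (c : ℂ) (u : Dist) :
    spinAct T (c • u) = c • spinAct T u := by
  ext1 φ; simp only [spinAct_apply, smul_apply, map_smul]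

theorem momentum_map_sub (j : Fin 3) (u v : Dist) :
    momentum j (u - v) = momentum j u - momentum j v := by
  ext1 φ; simp only [momentum_apply, sub_apply, smul_sub]

theorem momentum_map_sum {ι : Type*} (s : Finset ι) (j : Fin 3) (u : ι → Dist) :
    momentum j (∑ i ∈ s, u i) = ∑ i ∈ s, momentum j (u i) := by
  ext1 φ; simp only [momentum_apply, sum_apply, Finset.smul_sum]

theorem momentum_spinAct (j : Fin 3) (T : Spinor →L[ℂ] Spinor) (u : Dist) :
    momentum j (spinAct T u) = spinAct T (momentum j u) := by
  ext1 φ; simp only [spinAct_apply, momentum_apply, map_smul]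

theorem momentum_comm (j k : Fin 3) (u : Dist) :
    momentum j (momentum k u) = momentum k (momentum j u) := by
  simp only [momentum_eq_fm]
  rw [fm_fm (hasTemperateGrowth_momSymbol _) (hasTemperateGrowth_momSymbol _),
    fm_fm (hasTemperateGrowth_momSymbol _) (hasTemperateGrowth_momSymbol _), mul_comm]

theorem sum_spinAct_pauliOp (T : Fin 3 → Fin 3 → Dist) :
    ∑ j, spinAct (pauliOp j) (∑ k, spinAct (pauliOp k) (T j k)) = ∑ j, T j j + Complex.I •
      (spinAct (pauliOp 0) (T 1 2 - T 2 1) + spinAct (pauliOp 1) (T 2 0 - T 0 2) +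
        spinAct (pauliOp 2) (T 0 1 - T 1 0)) := by
  ext1 φ
  have h := sum_pauliOp fun j k => T j k φ
  simp only [sum_apply, add_apply, smul_apply, sub_apply, spinAct_apply] at h ⊢
  exact h

theorem IsRep.sub {f f' : R3 → Spinor} {u u' : Dist} (h : IsRep f u) (h' : IsRep f' u') :
    IsRep (fun x => f x - f' x) (u - u') := by
  simp_rw [sub_eq_add_neg]
  exact h.add h'.neg

theorem exists_isRep_mul {β a : ℝ} {M : R3 → Spinor →L[ℂ] Spinor} (h : Decays β M) {u : Dist}
    (hu : u ∈ LW a) {f : R3 → Spinor} (hf : IsRep f u) :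
    ∃ v ∈ LW (a + β), IsRep (fun x => M x (f x)) v := by
  obtain ⟨g, rfl⟩ := mem_LW_iff_exists.1 hu
  obtain ⟨f', hf', hv⟩ := isMul_wt_ofL2 h a g
  refine ⟨_, mem_LW_iff_exists.2 ⟨_, rfl⟩, hv.congr ?_⟩
  filter_upwards [hf.ae_eq hf'] with x hx
  rw [hx]

/-! ### Decay of the potentials and H_P as a perturbation of the Laplacian -/

theorem Decays.scalar {β C : ℝ} {c : R3 → ℝ} (hc : Measurable c)
    (h : ∀ x, |c x| ≤ C * bracket (-β) x) : Decays β (scalar c) := by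
  refine ⟨((Complex.measurable_ofReal.comp hc).aestronglyMeasurable).smul_const _, C, fun x => ?_⟩
  rw [PauliThreshold.scalar, norm_smul, Complex.norm_real, Real.norm_eq_abs]
  exact (mul_le_of_le_one_right (abs_nonneg _) ContinuousLinearMap.norm_id_le).trans (h x)

theorem Decays.sub {β : ℝ} {M N : R3 → Spinor →L[ℂ] Spinor} (hM : Decays β M) (hN : Decays β N) :
    Decays β fun x => M x - N x := by
  obtain ⟨C, hC⟩ := hM.bound
  obtain ⟨D, hD⟩ := hN.bound
  refine ⟨hM.meas.sub hN.meas, C + D, fun x => ?_⟩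
  rw [add_mul]
  exact (norm_sub_le _ _).trans (add_le_add (hC x) (hD x))

theorem Decays.sigmaDot {β C : ℝ} {F : R3 → R3} (hF : Measurable F)
    (h : ∀ x, ‖F x‖ ≤ C * bracket (-β) x) : Decays β (sigmaDot F) := by
  have hm : ∀ j : Fin 3, Measurable fun x => ((F x j : ℝ) : ℂ) := fun j =>
    Complex.measurable_ofReal.comp ((EuclideanSpace.proj j : R3 →L[ℝ] ℝ).measurable.comp hF)
  refine ⟨?_, C * ∑ j, ‖pauliOp j‖, fun x => ?_⟩
  · change AEStronglyMeasurable (fun x => ∑ j, ((F x j : ℝ) : ℂ) • pauliOp j) volume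
    exact Finset.aestronglyMeasurable_fun_sum _ fun j _ =>
      (hm j).aestronglyMeasurable.smul_const _
  · rw [PauliThreshold.sigmaDot]
    refine (norm_sum_le _ _).trans ?_
    calc ∑ j, ‖((F x j : ℝ) : ℂ) • pauliOp j‖ ≤ ∑ j, (C * bracket (-β) x) * ‖pauliOp j‖ := by
          gcongr with j
          rw [norm_smul]
          gcongr
          exact (norm_coord_le _ _).trans (h x)
      _ = _ := by rw [← Finset.mul_sum]; ring

section

variable {β : ℝ} {V : R3 → ℝ} {B A : R3 → R3}

theorem decays_coord (hA : IsVectorPotential β B A) (j : Fin 3) :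
    Decays β (scalar fun x => A x j) := by
  obtain ⟨C, hC⟩ := hA.decay
  exact Decays.scalar ((EuclideanSpace.proj j : R3 →L[ℝ] ℝ).measurable.comp
    hA.contDiff.continuous.measurable) fun x => (abs_coord_le _ _).trans (hC x)

theorem decays_magnetic (hVB : FieldAssumption β V B) : Decays β (sigmaDot B) := by
  obtain ⟨C, hC⟩ := hVB.decay_B
  have hC0 : 0 ≤ C := by
    have h1 := (norm_nonneg _).trans (hC 0)
    exact nonneg_of_mul_nonneg_left h1 (bracket_pos _ _)
  refine Decays.sigmaDot (C := C) hVB.contDiff_B.continuous.measurable fun x => (hC x).trans ?_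
  gcongr
  exact bracket_le_bracket (by linarith) x

theorem decays_potential (hβ : 0 ≤ β) (hVB : FieldAssumption β V B)
    (hA : IsVectorPotential β B A) :
    Decays β fun x => scalar (fun y => ‖A y‖ ^ 2 + V y) x - sigmaDot B x := by
  obtain ⟨C, hC⟩ := hA.decay
  obtain ⟨D, hD⟩ := hVB.decay_V
  refine Decays.sub (Decays.scalar (C := C ^ 2 + D) ?_ fun x => ?_) (decays_magnetic hVB)
  · exact (hA.contDiff.continuous.measurable.norm.pow_const 2).add hVB.measurable_V
  · have h1 : ‖A x‖ ^ 2 ≤ C ^ 2 * bracket (-β) x := by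
      have h2 := pow_le_pow_left₀ (norm_nonneg _) (hC x) 2
      have h3 : bracket (-β) x ^ 2 ≤ bracket (-β) x := by
        have := bracket_le_one (by linarith : -β ≤ 0) x
        have := bracket_pos (-β) x
        nlinarith
      rw [mul_pow] at h2
      exact h2.trans (mul_le_mul_of_nonneg_left h3 (sq_nonneg C))
    refine (abs_add_le _ _).trans ?_
    rw [abs_of_nonneg (sq_nonneg _), add_mul]
    exact add_le_add h1 (hD x)

theorem IsDirac.eq {u v v' : Dist} (h : IsDirac A u v) (h' : IsDirac A u v') : v = v' := by
  obtain ⟨a, ha, rfl⟩ := h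
  obtain ⟨a', ha', rfl⟩ := h'
  rw [ha.eq ha']

theorem IsPauli.eq {u v v' : Dist} (h : IsPauli V A u v) (h' : IsPauli V A u v') : v = v' := by
  obtain ⟨d, e, w, hd, he, hw, rfl⟩ := h
  obtain ⟨d', e', w', hd', he', hw', rfl⟩ := h'
  obtain rfl := hd.eq hd'
  rw [he.eq he', hw.eq hw']

theorem IsPerturbation.eq {u v v' : Dist} (h : IsPerturbation V B A u v)
    (h' : IsPerturbation V B A u v') : v = v' := by
  obtain ⟨a, b, c, ha, hb, hc, rfl⟩ := h
  obtain ⟨a', b', c', ha', hb', hc', rfl⟩ := h'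
  rw [hc.eq hc', funext fun j => (ha j).eq (ha' j), funext fun j => (hb j).eq (hb' j)]

theorem scalar_apply (c : R3 → ℝ) (x : R3) (s : Spinor) : scalar c x s = (c x : ℂ) • s := rfl

theorem sigmaDot_apply (F : R3 → R3) (x : R3) (s : Spinor) :
    sigmaDot F x s = ∑ j, pauliOp j ((F x j : ℂ) • s) := by
  simp [sigmaDot]

/-- The entries (P_j - A_j)(P_k - A_k) u enter the square of σ·(P - A) through their trace, which
gives (P - A)² u, and through their commutators i B_l u, which give -σ·B u since i · i = -1. All
products exist as distributions given by functions because u and P_j u do. -/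
theorem exists_isPerturbation_isPauli (hVB : FieldAssumption β V B)
    (hA : IsVectorPotential β B A) {r : ℝ} {u : Dist} (hu : u ∈ sobolevSubmodule 1 r) :
    ∃ z, IsPerturbation V B A u z ∧ IsPauli V A u (helm 0 u + z) := by
  obtain ⟨hu0, hu1⟩ := mem_sobolev_one_iff.1 hu
  obtain ⟨f, hf⟩ := exists_isRep_of_mem_LW hu0
  choose f' hf' using fun j => exists_isRep_of_mem_LW (hu1 j)
  have hdA := decays_coord hA
  choose p hpm hp using fun j => exists_isRep_mul (hdA j) hu0 hf
  choose q _ hq using fun j k => exists_isRep_mul (hdA j) (hu1 k) (hf' k)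
  choose s _ hs using fun j k => exists_isRep_mul (hdA j) (hpm k) (hp k)
  have hdB : ∀ l : Fin 3, Decays β (scalar fun x => B x l) := by
    obtain ⟨C, hC⟩ := hVB.decay_B
    have hC0 : 0 ≤ C := nonneg_of_mul_nonneg_left ((norm_nonneg _).trans (hC 0)) (bracket_pos _ _)
    refine fun l => Decays.scalar (C := C) ((EuclideanSpace.proj l : R3 →L[ℝ] ℝ).measurable.comp
      hVB.contDiff_B.continuous.measurable) fun x => (abs_coord_le _ _).trans ((hC x).trans ?_)
    gcongr
    exact bracket_le_bracket (by linarith) x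
  choose b _ hb using fun l => exists_isRep_mul (hdB l) hu0 hf
  have hdV : Decays β (scalar V) := by
    obtain ⟨D, hD⟩ := hVB.decay_V
    exact Decays.scalar hVB.measurable_V hD
  obtain ⟨w, -, hw⟩ := exists_isRep_mul hdV hu0 hf
  simp only [scalar_apply] at hp hq hs hb hw
  have hss : ∀ j k, s j k = s k j := fun j k => (hs j k).dist_eq <| (hs k j).congr <|
    Filter.Eventually.of_forall fun x => smul_comm _ _ _
  -- the commutators of the covariant derivatives
  have hcomm : ∀ j k l, (∀ x, partialD A j k x - partialD A k j x = B x l) →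
      momentum j (p k) - momentum k (p j) = q k j - q j k - Complex.I • b l := by
    intro j k l h
    refine momentum_curl hA.contDiff hf hf' hp hq j k ?_
    simp_rw [h]
    exact hb l
  have hc := fun x => hA.curl_eq x
  have hc0 := hcomm 1 2 0 fun x => by rw [← hc]; rfl
  have hc1 := hcomm 2 0 1 fun x => by rw [← hc]; rfl
  have hc2 := hcomm 0 1 2 fun x => by rw [← hc]; rfl
  set c : Dist := ∑ j, s j j + w - ∑ l, spinAct (pauliOp l) (b l) with hcdef
  have hcrep : IsMul (fun x => scalar (fun y => ‖A y‖ ^ 2 + V y) x - sigmaDot B x) u c := by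
    refine ⟨f, hf, (((IsRep.sum fun j _ => hs j j).add hw).sub
      (IsRep.sum fun l _ => (hb l).spinAct (pauliOp l))).congr
      (Filter.Eventually.of_forall fun x => ?_)⟩
    simp only [sub_apply, scalar_apply, sigmaDot_apply]
    congr 1
    simp only [smul_smul, ← Finset.sum_smul, ← add_smul]
    congr 1
    rw [EuclideanSpace.norm_sq_eq]
    push_cast
    congr 1
    refine Finset.sum_congr rfl fun j _ => ?_
    rw [Real.norm_eq_abs, ← Complex.ofReal_pow, sq_abs]
    push_cast; ring
  set z : Dist := -(∑ j, momentum j (p j)) - ∑ j, q j j + c with hz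
  refine ⟨z, ⟨p, fun j => q j j, c, fun j => ⟨f, hf, hp j⟩, fun j => ⟨f' j, hf' j, hq j j⟩,
    hcrep, rfl⟩, ?_⟩
  set d : Dist := ∑ k, spinAct (pauliOp k) (momentum k u) - ∑ k, spinAct (pauliOp k) (p k) with hd
  set a : Dist := ∑ j, spinAct (pauliOp j) (∑ k, spinAct (pauliOp k) (q j k - s j k)) with ha
  set e : Dist := ∑ j, spinAct (pauliOp j) (momentum j d) - a with he
  have hdd : IsDirac A u d := by
    refine ⟨_, ⟨f, hf, (IsRep.sum fun k _ => (hp k).spinAct (pauliOp k)).congr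
      (Filter.Eventually.of_forall fun x => ?_)⟩, rfl⟩
    simp only [sigmaDot_apply]
  have hde : IsDirac A d e := by
    refine ⟨a, ⟨_, (IsRep.sum fun k _ => (hf' k).spinAct (pauliOp k)).sub
      (IsRep.sum fun k _ => (hp k).spinAct (pauliOp k)), ?_⟩, rfl⟩
    refine (IsRep.sum fun j _ => (IsRep.sum fun k _ =>
      ((hq j k).sub (hs j k)).spinAct (pauliOp k)).spinAct (pauliOp j)).congr
      (Filter.Eventually.of_forall fun x => ?_)
    simp only [sigmaDot_apply, map_sub, map_sum, map_smul, Finset.smul_sum,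
      Finset.sum_sub_distrib]
    rw [Finset.sum_comm]
    congr 1
    rw [Finset.sum_comm]
    exact Finset.sum_congr rfl fun j _ => Finset.sum_congr rfl fun k _ => smul_comm _ _ _
  refine ⟨d, e, w, hdd, hde, ⟨f, hf, hw⟩, ?_⟩
  -- `T j k` is (P_j - A_j)(P_k - A_k) u, with q_jk = A_j P_k u and s_jk = A_j A_k u.
  set T : Fin 3 → Fin 3 → Dist := fun j k =>
    momentum j (momentum k u) - momentum j (p k) - (q j k - s j k) with hT
  have heT : e = ∑ j, spinAct (pauliOp j) (∑ k, spinAct (pauliOp k) (T j k)) := by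
    rw [he, ha, hd, ← Finset.sum_sub_distrib]
    refine Finset.sum_congr rfl fun j _ => ?_
    simp only [hT, momentum_map_sub, momentum_map_sum, momentum_spinAct, spinAct_map_sub,
      Finset.sum_sub_distrib]
  have hanti : ∀ j k l, momentum j (p k) - momentum k (p j) = q k j - q j k - Complex.I • b l →
      T j k - T k j = Complex.I • b l := by
    intro j k l h
    simp only [hT]
    rw [momentum_comm j k, hss j k]
    have h1 : momentum j (p k) = momentum k (p j) + (q k j - q j k - Complex.I • b l) := by
      rw [← h]; abel
    rw [h1]
    abel
  rw [heT, sum_spinAct_pauliOp, hanti _ _ _ hc0, hanti _ _ _ hc1, hanti _ _ _ hc2, helm_eq, hz,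
    hcdef]
  simp only [spinAct_map_smul, hT, Finset.sum_sub_distrib, Fin.sum_univ_three]
  match_scalars <;> first | ring1 | linear_combination Complex.I_mul_I | linear_combination -Complex.I_mul_I

theorem isPauli_iff (hVB : FieldAssumption β V B) (hA : IsVectorPotential β B A)
    {r : ℝ} {u : Dist} (hu : u ∈ sobolevSubmodule 1 r) {z v : Dist}
    (hz : IsPerturbation V B A u z) : IsPauli V A u v ↔ v = helm 0 u + z := by
  obtain ⟨z', h1, h2⟩ := exists_isPerturbation_isPauli hVB hA hu
  obtain rfl := hz.eq h1
  exact ⟨fun h => h.eq h2, fun h => h ▸ h2⟩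

variable (β V B A) in
/-- The perturbation `W_P` as an operator from `H^{1,a}` to `H^{-1,a+β}`. -/
def pert (a : ℝ) : H 1 a →L[ℂ] H (-1) (a + β) :=
  firstOrder β (fun j => scalar fun x => A x j)
    (fun x => scalar (fun y => ‖A y‖ ^ 2 + V y) x - sigmaDot B x) a

theorem isPerturbation_pert (hβ : 0 ≤ β) (hVB : FieldAssumption β V B)
    (hA : IsVectorPotential β B A) {a : ℝ} (u : H 1 a) :
    IsPerturbation V B A u.dist (pert β V B A a u).dist :=
  exists_firstOrder (decays_coord hA) (decays_potential hβ hVB hA) u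

theorem pert_compat (hβ : 0 ≤ β) (hVB : FieldAssumption β V B) (hA : IsVectorPotential β B A)
    {a a' : ℝ} {u : H 1 a} {u' : H 1 a'} (h : u.dist = u'.dist) :
    (pert β V B A a u).dist = (pert β V B A a' u').dist := by
  have h1 := isPerturbation_pert hβ hVB hA u
  rw [h] at h1
  exact h1.eq (isPerturbation_pert hβ hVB hA u')

theorem isPauli_pert_iff (hβ : 0 ≤ β) (hVB : FieldAssumption β V B)
    (hA : IsVectorPotential β B A) {a : ℝ} {u : H 1 a} {v : Dist} :
    IsPauli V A u.dist v ↔ v = helm 0 u.dist + (pert β V B A a u).dist :=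
  isPauli_iff hVB hA u.mem (isPerturbation_pert hβ hVB hA u)

end

/-! ### The Lippmann-Schwinger operator at zero energy -/

section

variable {β : ℝ} {V : R3 → ℝ} {B A : R3 → R3}

/-- The exponents for which `H^{1,a} → H^{-1,b} → H^{1,a}` by the perturbation and the free
resolvent. -/
structure Fits (β a b : ℝ) : Prop where
  adm : Admissible b a
  le : b ≤ a + β

variable (V B A) in
/-- The perturbation `W_P` as an operator from `H^{1,a}` to `H^{-1,b}`. -/
def pertTo {a b : ℝ} (h : b ≤ a + β) : H 1 a →L[ℂ] H (-1) b := H.incl h ∘L pert β V B A a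

theorem dist_pertTo {a b : ℝ} (h : b ≤ a + β) (u : H 1 a) :
    (pertTo V B A h u).dist = (pert β V B A a u).dist := rfl

theorem isW_pertTo (hβ : 0 ≤ β) (hVB : FieldAssumption β V B) (hA : IsVectorPotential β B A)
    {a b : ℝ} (h : b ≤ a + β) : IsW V B A (pertTo V B A h) := fun u =>
  isPerturbation_pert hβ hVB hA u

theorem pertTo_compat (hβ : 0 ≤ β) (hVB : FieldAssumption β V B) (hA : IsVectorPotential β B A)
    {a b a' b' : ℝ} (h : b ≤ a + β) (h' : b' ≤ a' + β) {u : H 1 a} {u' : H 1 a'}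
    (hu : u.dist = u'.dist) : (pertTo V B A h u).dist = (pertTo V B A h' u').dist :=
  pert_compat hβ hVB hA hu

variable (V B A) in
/-- The operator `I + (-Δ + κ²)⁻¹ W_P` on `H^{1,a}`. -/
def lippmann (κ : ℂ) {a b : ℝ} (h : b ≤ a + β) : H 1 a →L[ℂ] H 1 a :=
  ContinuousLinearMap.id ℂ (H 1 a) + free κ b a ∘L pertTo V B A h

theorem dist_lippmann (κ : ℂ) {a b : ℝ} (h : b ≤ a + β) (u : H 1 a) :
    (lippmann V B A κ h u).dist = u.dist + (free κ b a (pertTo V B A h u)).dist := rfl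

theorem lippmann_compat (hβ : 0 ≤ β) (hVB : FieldAssumption β V B)
    (hA : IsVectorPotential β B A) {κ : ℂ} (hκ : 0 ≤ κ.re) {a b a' b' : ℝ} (h : Fits β a b)
    (h' : Fits β a' b') {u : H 1 a} {u' : H 1 a'} (hu : u.dist = u'.dist) :
    (lippmann V B A κ h.le u).dist = (lippmann V B A κ h'.le u').dist := by
  rw [dist_lippmann, dist_lippmann, hu,
    free_compat hκ h.adm h'.adm (pertTo_compat hβ hVB hA h.le h'.le hu)]

/-- In u = -G_0 W_P u the perturbation raises the weight from a to a + β, and G_0 may lower it to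
any a' < -1/2 with a + β - a' > 2. Since β > 5, a gain of 3 is always allowed. -/
theorem exists_lippmann_zero_of_le (hβ : 5 < β) (hVB : FieldAssumption β V B)
    (hA : IsVectorPotential β B A) {a b : ℝ} (h : Fits β a b) {u : H 1 a}
    (hu : lippmann V B A 0 h.le u = 0) {a' : ℝ} (ha' : a' < -1 / 2) (hβa : 1 / 2 < a' + β)
    (hle : a' ≤ a + 3) :
    ∃ u' : H 1 a', u'.dist = u.dist ∧
      ∃ h' : Fits β a' (a' + β), lippmann V B A 0 h'.le u' = 0 := by
  have hb := h.le
  have hb1 := h.adm.left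
  have h1 : Admissible (a + β) a := ⟨by linarith, h.adm.right, by linarith⟩
  have h2 : Admissible (a + β) a' := ⟨by linarith, ha', by linarith⟩
  have h' : Fits β a' (a' + β) := ⟨⟨hβa, ha', by linarith⟩, le_rfl⟩
  set u' : H 1 a' := -free 0 (a + β) a' (pert β V B A a u) with hu'
  have hd : u'.dist = u.dist := by
    have e1 : u'.dist = -(free 0 (a + β) a' (pert β V B A a u)).dist := rfl
    have e2 : u.dist + (free 0 b a (pertTo V B A h.le u)).dist = 0 := congrArg H.dist hu
    have e3 : (free 0 (a + β) a' (pert β V B A a u)).dist =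
        (free 0 b a (pertTo V B A h.le u)).dist := free_compat le_rfl h2 h.adm rfl
    rw [e1, e3]
    exact (eq_neg_of_add_eq_zero_left e2).symm
  refine ⟨u', hd, h', H.dist_injective ?_⟩
  rw [lippmann_compat (by linarith) hVB hA le_rfl h' h hd, hu]
  rfl

/-- Induction on the number of steps of length 3 needed to pass -1/2. The case n = 0 is vacuous
because a < -1/2. -/
theorem mem_sobolevSubmodule_of_lippmann_zero (hβ : 5 < β) (hVB : FieldAssumption β V B)
    (hA : IsVectorPotential β B A) (n : ℕ) : ∀ {a b : ℝ} (h : Fits β a b) {u : H 1 a},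
      lippmann V B A 0 h.le u = 0 → -1 / 2 ≤ a + 3 * n → ∀ a' : ℝ, a' < -1 / 2 →
        u.dist ∈ sobolevSubmodule 1 a' := by
  induction n with
  | zero =>
    intro a b h u _ hn
    have := h.adm.right
    norm_num at hn
    linarith
  | succ n ih =>
    intro a b h u hu hn a' ha'
    have hb := h.le
    have hb1 := h.adm.left
    push_cast at hn
    by_cases hle : a' ≤ a
    · exact H.mem_of_le hle u
    push Not at hle
    by_cases hle' : a' ≤ a + 3
    · obtain ⟨u', h1, -⟩ := exists_lippmann_zero_of_le hβ hVB hA h hu ha' (by linarith) hle'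
      exact h1 ▸ u'.mem
    push Not at hle'
    obtain ⟨u', h1, h2, h3⟩ := exists_lippmann_zero_of_le hβ hVB hA h hu (a' := a + 3)
      (by linarith) (by linarith) le_rfl
    rw [← h1]
    exact ih h2 h3 (by linarith) a' ha'

/-- Applying -Δ to u + G_0 W_P u = 0 gives H_P u = 0. Together with the improved decay this puts u
in the generalized null space. -/
theorem eq_zero_of_lippmann_zero (hβ : 5 < β) (hVB : FieldAssumption β V B)
    (hA : IsVectorPotential β B A) (hreg : IsRegularPoint V A) {a b : ℝ} (h : Fits β a b)
    {u : H 1 a} (hu : lippmann V B A 0 h.le u = 0) : u = 0 := by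
  apply H.dist_injective
  refine hreg u.dist ⟨fun r hr => ?_, ?_⟩
  · obtain ⟨n, hn⟩ := exists_nat_gt (-1 / 2 - a)
    have : (0 : ℝ) ≤ n := n.cast_nonneg
    exact mem_sobolevSubmodule_of_lippmann_zero hβ hVB hA n h hu (by linarith) r hr
  · rw [isPauli_pert_iff (by linarith) hVB hA]
    have h1 : u.dist + (free 0 b a (pertTo V B A h.le u)).dist = 0 := congrArg H.dist hu
    have h2 := congrArg (helm 0) h1
    rw [helm_add, helm_free le_rfl h.adm, dist_pertTo] at h2
    rw [h2, helm, map_zero]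
    module

theorem isCompactOperator_free_pertTo (hβ : 5 < β)
    (hA : IsVectorPotential β B A) {κ : ℂ} (hκ : 0 ≤ κ.re) {a b : ℝ} (h : Fits β a b) :
    IsCompactOperator (free κ b a ∘L pertTo V B A h.le) := by
  have hb := h.le
  have hb1 := h.adm.left
  have h1 : Admissible (a + β) a := ⟨by linarith, h.adm.right, by linarith⟩
  -- Compactness is known for the largest intermediate weight a + β. The embedding into a smaller
  -- weight b does not change the composition.
  have h2 : free κ b a ∘L pertTo V B A h.le = free κ (a + β) a ∘L pert β V B A a := by
    ext1 u
    exact H.dist_injective (free_compat hκ h.adm h1 rfl)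
  rw [h2]
  exact isCompactOperator_free_firstOrder (by linarith) (decays_coord hA) hκ h1

/-- Fredholm alternative for the compact operator G_0 W_P: either -1 is an eigenvalue, excluded by
`eq_zero_of_lippmann_zero`, or it lies in the resolvent set. -/
theorem exists_isInverse_lippmann (hβ : 5 < β) (hVB : FieldAssumption β V B)
    (hA : IsVectorPotential β B A) (hreg : IsRegularPoint V A) {a b : ℝ} (h : Fits β a b) :
    ∃ Q, IsInverse Q (lippmann V B A 0 h.le) := by
  have hc := isCompactOperator_free_pertTo (V := V) hβ hA (κ := 0) le_rfl h
  set T := free 0 b a ∘L pertTo V B A h.le with hT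
  rcases hc.hasEigenvalue_or_mem_resolventSet (neg_ne_zero.2 one_ne_zero : (-1 : ℂ) ≠ 0) with h1 | h1
  · obtain ⟨u, hu⟩ := h1.exists_hasEigenvector
    have h2 : T u = (-1 : ℂ) • u := hu.apply_eq_smul
    refine absurd (eq_zero_of_lippmann_zero hβ hVB hA hreg h (u := u) ?_) hu.2
    change u + T u = 0
    rw [h2]
    module
  · obtain ⟨S, hS⟩ := spectrum.mem_resolventSet_iff.1 h1
    have h2 : lippmann V B A 0 h.le = -(S : H 1 a →L[ℂ] H 1 a) := by
      rw [hS, map_neg, map_one]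
      change 1 + T = _
      abel
    refine ⟨-(↑S⁻¹ : H 1 a →L[ℂ] H 1 a), ?_, ?_⟩
    · rw [h2]
      change -(↑S⁻¹ : H 1 a →L[ℂ] H 1 a) * -(S : H 1 a →L[ℂ] H 1 a) = 1
      rw [neg_mul_neg, S.inv_mul]
    · rw [h2]
      change -(S : H 1 a →L[ℂ] H 1 a) * -(↑S⁻¹ : H 1 a →L[ℂ] H 1 a) = 1
      rw [neg_mul_neg, S.mul_inv]

/-- If `Q` inverts `I + G W`, then `I - W Q G` inverts `I + W G`. -/
theorem IsInverse.swap {X Y : Type*} [NormedAddCommGroup X] [NormedSpace ℂ X]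
    [NormedAddCommGroup Y] [NormedSpace ℂ Y] {G : Y →L[ℂ] X} {W : X →L[ℂ] Y} {Q : X →L[ℂ] X}
    (h : IsInverse Q (ContinuousLinearMap.id ℂ X + G ∘L W)) :
    IsInverse (ContinuousLinearMap.id ℂ Y - W ∘L Q ∘L G)
      (ContinuousLinearMap.id ℂ Y + W ∘L G) := by
  have h1 : ∀ x, Q x + Q (G (W x)) = x := fun x => by
    have := congrArg (fun T : X →L[ℂ] X => T x) h.1
    simpa using this
  have h2 : ∀ x, Q x + G (W (Q x)) = x := fun x => by
    have := congrArg (fun T : X →L[ℂ] X => T x) h.2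
    simpa using this
  constructor
  · ext1 y
    simp only [ContinuousLinearMap.comp_apply, sub_apply, add_apply, ContinuousLinearMap.id_apply,
      map_add]
    have h3 := congrArg W (h1 (G y))
    rw [map_add] at h3
    rw [sub_add_sub_comm, h3, add_sub_cancel_right]
  · ext1 y
    simp only [ContinuousLinearMap.comp_apply, sub_apply, add_apply, ContinuousLinearMap.id_apply,
      map_sub]
    have h3 := congrArg W (h2 (G y))
    rw [map_add] at h3
    rw [h3]
    abel

theorem IsInverse.apply_left {X : Type*} [NormedAddCommGroup X] [NormedSpace ℂ X]
    {Q T : X →L[ℂ] X} (h : IsInverse Q T) (x : X) : Q (T x) = x :=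
  congrArg (fun S : X →L[ℂ] X => S x) h.1

theorem IsInverse.apply_right {X : Type*} [NormedAddCommGroup X] [NormedSpace ℂ X]
    {Q T : X →L[ℂ] X} (h : IsInverse Q T) (x : X) : T (Q x) = x :=
  congrArg (fun S : X →L[ℂ] X => S x) h.2

/-- The element with the better weight embeds into the other space, where I + G_0 W_P is injective.
-/
theorem eq_of_lippmann_eq (hβ : 5 < β) (hVB : FieldAssumption β V B)
    (hA : IsVectorPotential β B A) (hreg : IsRegularPoint V A) {a b a' b' : ℝ} (h : Fits β a b)
    (h' : Fits β a' b') {u : H 1 a} {u' : H 1 a'}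
    (hu : (lippmann V B A 0 h.le u).dist = (lippmann V B A 0 h'.le u').dist) :
    u.dist = u'.dist := by
  wlog hle : a ≤ a' generalizing a a' b b'
  · exact (this h' h hu.symm (not_le.1 hle).le).symm
  have h1 : lippmann V B A 0 h.le (u - H.incl hle u') = 0 := by
    rw [map_sub, sub_eq_zero]
    exact H.dist_injective
      (hu.trans (lippmann_compat (by linarith) hVB hA le_rfl h h' (H.dist_incl hle u')).symm)
  have h2 := eq_zero_of_lippmann_zero hβ hVB hA hreg h h1
  exact congrArg H.dist (sub_eq_zero.1 h2)

/-- From (I + G_0 W_P) G_0 = G_0 (I + W_P G_0) one gets G_0 g = G_0 g'. The terms W_P G_0 g and W_P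
G_0 g' then cancel in the hypothesis. -/
theorem eq_of_dual_lippmann_eq (hβ : 5 < β) (hVB : FieldAssumption β V B)
    (hA : IsVectorPotential β B A) (hreg : IsRegularPoint V A) {a b a' b' : ℝ} (h : Fits β a b)
    (h' : Fits β a' b') {g : H (-1) b} {g' : H (-1) b'}
    (hg : (g + pertTo V B A h.le (free 0 b a g)).dist =
      (g' + pertTo V B A h'.le (free 0 b' a' g')).dist) : g.dist = g'.dist := by
  have e : ∀ {a b : ℝ} (h : Fits β a b) (g : H (-1) b),
      lippmann V B A 0 h.le (free 0 b a g) = free 0 b a (g + pertTo V B A h.le (free 0 b a g)) := by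
    intro a b h g
    rw [map_add]; rfl
  have h2 : (free 0 b a g).dist = (free 0 b' a' g').dist := by
    refine eq_of_lippmann_eq hβ hVB hA hreg h h' ?_
    rw [e h g, e h' g']
    exact free_compat le_rfl h.adm h'.adm hg
  have h3 := pertTo_compat (by linarith) hVB hA h.le h'.le h2
  have h4 : g.dist + (pertTo V B A h.le (free 0 b a g)).dist =
      g'.dist + (pertTo V B A h'.le (free 0 b' a' g')).dist := hg
  rw [h3] at h4
  exact add_right_cancel h4

end

/-! ### Perturbation of an inverse -/

section

variable {X Y : Type*} [NormedAddCommGroup X] [NormedSpace ℂ X] [CompleteSpace X]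
  [NormedAddCommGroup Y] [NormedSpace ℂ Y]

theorem exists_isInverse_one_add {E : X →L[ℂ] X} (hE : ‖E‖ ≤ 1 / 2) :
    ∃ N : X →L[ℂ] X, IsInverse N (ContinuousLinearMap.id ℂ X + E) ∧ ‖N‖ ≤ 2 := by
  set S := Units.oneSub (-E) (by rw [norm_neg]; linarith) with hS
  have h1 : (S : X →L[ℂ] X) = ContinuousLinearMap.id ℂ X + E := by
    rw [hS, Units.val_oneSub, sub_neg_eq_add]; rfl
  have h2 : IsInverse (↑S⁻¹ : X →L[ℂ] X) (ContinuousLinearMap.id ℂ X + E) := by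
    rw [← h1]; exact ⟨S.inv_mul, S.mul_inv⟩
  refine ⟨_, h2, ?_⟩
  set N : X →L[ℂ] X := ↑S⁻¹ with hN
  have h3 : N = ContinuousLinearMap.id ℂ X - E ∘L N := by
    ext1 x
    have := h2.apply_right x
    rw [add_apply, ContinuousLinearMap.id_apply] at this
    rw [sub_apply, ContinuousLinearMap.id_apply, ContinuousLinearMap.comp_apply]
    exact eq_sub_of_add_eq this
  have h4 : ‖N‖ ≤ 1 + 1 / 2 * ‖N‖ := by
    calc ‖N‖ = ‖ContinuousLinearMap.id ℂ X - E ∘L N‖ := by rw [← h3]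
      _ ≤ ‖ContinuousLinearMap.id ℂ X‖ + ‖E ∘L N‖ := norm_sub_le _ _
      _ ≤ 1 + 1 / 2 * ‖N‖ := by
        gcongr
        · exact ContinuousLinearMap.norm_id_le
        · exact (ContinuousLinearMap.opNorm_comp_le _ _).trans (by gcongr)
  linarith

/-- If `G = G₀ + κ G₁ + O(κ²)` and `Q` inverts `I + G₀ W`, then `I + G W` is invertible for small
`κ`, and `(I + G W)⁻¹ G = Q G₀ + κ Q G₁ (I - W Q G₀) + O(κ²)`. -/
theorem exists_inverse_expansion {W : X →L[ℂ] Y} {G₀ G₁ : Y →L[ℂ] X} {Q : X →L[ℂ] X}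
    (hQ : IsInverse Q (ContinuousLinearMap.id ℂ X + G₀ ∘L W)) {C : ℝ} (hC : 0 ≤ C) :
    ∃ δ > (0 : ℝ), δ ≤ 1 ∧ ∃ D : ℝ, ∀ (κ : ℂ) (G : Y →L[ℂ] X), ‖κ‖ < δ →
      ‖G - G₀ - κ • G₁‖ ≤ C * ‖κ‖ ^ 2 → ∃ M : X →L[ℂ] X,
        IsInverse M (ContinuousLinearMap.id ℂ X + G ∘L W) ∧
        ‖M ∘L G - (Q ∘L G₀ + κ • Q ∘L G₁ ∘L (ContinuousLinearMap.id ℂ Y - W ∘L Q ∘L G₀))‖ ≤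
          D * ‖κ‖ ^ 2 := by
  set P := ContinuousLinearMap.id ℂ Y - W ∘L Q ∘L G₀ with hP
  set c := C + ‖G₁‖ with hc
  have hc0 : 0 ≤ c := by positivity
  set b := ‖Q‖ * c * ‖W‖ with hb
  have hb0 : 0 ≤ b := by positivity
  -- This radius makes ‖Q (G - G₀) W‖ ≤ 1/2, so the Neumann series converges with inverse bounded by
  -- 2, and it keeps |κ| ≤ 1.
  refine ⟨1 / (2 * (b + 1)), by positivity, ?_,
    2 * (‖Q‖ * C * ‖P‖ + b * (‖Q‖ * ‖G₁‖ * ‖P‖)), fun κ G hκ hG => ?_⟩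
  · rw [div_le_one (by positivity)]; linarith
  have hκ1 : ‖κ‖ ≤ 1 := hκ.le.trans (by rw [div_le_one (by positivity)]; linarith)
  set E := G - G₀ with hE
  have hEn : ‖E‖ ≤ c * ‖κ‖ := by
    have e : E = (E - κ • G₁) + κ • G₁ := by abel
    rw [e]
    refine (norm_add_le _ _).trans ?_
    rw [norm_smul]
    have : C * ‖κ‖ ^ 2 ≤ C * ‖κ‖ := by
      gcongr
      exact pow_le_of_le_one (norm_nonneg _) hκ1 two_ne_zero
    rw [hc]
    linarith
  have hQEW : ‖Q ∘L E ∘L W‖ ≤ b * ‖κ‖ := by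
    refine (ContinuousLinearMap.opNorm_comp_le _ _).trans ?_
    calc ‖Q‖ * ‖E ∘L W‖ ≤ ‖Q‖ * (‖E‖ * ‖W‖) := by
          gcongr; exact ContinuousLinearMap.opNorm_comp_le _ _
      _ ≤ ‖Q‖ * (c * ‖κ‖ * ‖W‖) := by gcongr
      _ = b * ‖κ‖ := by rw [hb]; ring
  obtain ⟨N, hN, hN2⟩ := exists_isInverse_one_add (E := Q ∘L E ∘L W) (by
    refine hQEW.trans ?_
    calc b * ‖κ‖ ≤ (b + 1) * (1 / (2 * (b + 1))) := by gcongr; linarith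
      _ = 1 / 2 := by field_simp)
  -- Factoring out the invertible I + G₀ W leaves a small perturbation of the identity, so the
  -- inverse is N Q.
  have hfac : ContinuousLinearMap.id ℂ X + G ∘L W = (ContinuousLinearMap.id ℂ X + G₀ ∘L W) ∘L
      (ContinuousLinearMap.id ℂ X + Q ∘L E ∘L W) := by
    ext1 x
    have h1 := hQ.apply_right (E (W x))
    simp only [add_apply, ContinuousLinearMap.id_apply, ContinuousLinearMap.comp_apply, map_add]
      at h1 ⊢
    have h2 : G (W x) = E (W x) + G₀ (W x) := by rw [hE, sub_apply]; abel
    generalize Q (E (W x)) = q at h1 ⊢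
    rw [h2, ← h1]
    abel
  have hM : IsInverse (N ∘L Q) (ContinuousLinearMap.id ℂ X + G ∘L W) := by
    rw [hfac]
    constructor
    · ext1 x
      simp only [ContinuousLinearMap.comp_apply, hQ.apply_left, hN.apply_left,
        ContinuousLinearMap.id_apply]
    · ext1 x
      simp only [ContinuousLinearMap.comp_apply, hQ.apply_right, hN.apply_right,
        ContinuousLinearMap.id_apply]
  refine ⟨N ∘L Q, hM, ?_⟩
  -- Multiplied by N⁻¹ = I + Q E W, the error is Q E P - κ Q G₁ P - (Q E W)(κ Q G₁ P). The first two
  -- terms combine to the remainder of G, and the last is a product of two O(κ) factors.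
  have hdiff : (N ∘L Q) ∘L G - (Q ∘L G₀ + κ • Q ∘L G₁ ∘L P) =
      N ∘L (Q ∘L (E - κ • G₁) ∘L P - (Q ∘L E ∘L W) ∘L (κ • Q ∘L G₁ ∘L P)) := by
    ext1 y
    have h0 : ∀ x, N x = x - N (Q (E (W x))) := fun x => by
      have := hN.apply_left x
      simp only [add_apply, ContinuousLinearMap.id_apply, ContinuousLinearMap.comp_apply,
        map_add] at this
      exact eq_sub_of_add_eq this
    have h1 : N (Q (G₀ y)) = Q (G₀ y) - N (Q (E (W (Q (G₀ y))))) := h0 _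
    have h2 : N (Q (G₁ (P y))) = Q (G₁ (P y)) - N (Q (E (W (Q (G₁ (P y)))))) := h0 _
    have h3 : G y = E y + G₀ y := by rw [hE, sub_apply]; abel
    have h4 : E (P y) = E y - E (W (Q (G₀ y))) := by
      have : P y = y - W (Q (G₀ y)) := rfl
      rw [this, map_sub]
    simp only [ContinuousLinearMap.comp_apply, add_apply, sub_apply, smul_apply, map_sub, map_smul,
      h3, map_add, h1, h2, h4]
    module
  rw [hdiff]
  have n1 : ‖Q ∘L (E - κ • G₁) ∘L P‖ ≤ ‖Q‖ * C * ‖P‖ * ‖κ‖ ^ 2 := by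
    refine (ContinuousLinearMap.opNorm_comp_le _ _).trans ?_
    calc ‖Q‖ * ‖(E - κ • G₁) ∘L P‖ ≤ ‖Q‖ * (‖E - κ • G₁‖ * ‖P‖) := by
          gcongr; exact ContinuousLinearMap.opNorm_comp_le _ _
      _ ≤ ‖Q‖ * (C * ‖κ‖ ^ 2 * ‖P‖) := by gcongr
      _ = _ := by ring
  have n2 : ‖κ • Q ∘L G₁ ∘L P‖ ≤ ‖κ‖ * (‖Q‖ * ‖G₁‖ * ‖P‖) := by
    rw [norm_smul]
    gcongr
    refine (ContinuousLinearMap.opNorm_comp_le _ _).trans ?_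
    rw [mul_assoc]
    gcongr
    exact ContinuousLinearMap.opNorm_comp_le _ _
  calc _ ≤ ‖N‖ * ‖Q ∘L (E - κ • G₁) ∘L P - (Q ∘L E ∘L W) ∘L (κ • Q ∘L G₁ ∘L P)‖ :=
        ContinuousLinearMap.opNorm_comp_le _ _
    _ ≤ 2 * (‖Q‖ * C * ‖P‖ * ‖κ‖ ^ 2 + b * ‖κ‖ * (‖κ‖ * (‖Q‖ * ‖G₁‖ * ‖P‖))) := by
        gcongr
        refine (norm_sub_le _ _).trans (add_le_add n1 ?_)
        refine (ContinuousLinearMap.opNorm_comp_le _ _).trans ?_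
        gcongr
    _ = _ := by ring

end

/-! ### The resolvent of the Pauli operator -/

theorem exists_embed_L2 : ∃ ι : L2 →L[ℂ] H (-1) 0, ∀ g, (ι g).dist = ofL2 g := by
  obtain ⟨S, hS⟩ := exists_clm_of_rangeL2 (bes (-1)) fun g =>
    fm_mem_rangeL2 (hasTemperateGrowth_besselSymbol (-1))
      (norm_besselSymbol_le (by norm_num : (-1 : ℝ) ≤ 0)) (ofL2_mem g)
  refine ⟨((H.iso (-1) 0).symm.toContinuousLinearEquiv : L2 →L[ℂ] H (-1) 0) ∘L S, fun g => ?_⟩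
  change ((H.iso (-1) 0).symm (S g)).dist = _
  rw [H.iso_symm_apply, H.dist_ofFun, hS, neg_zero, wt_zero, bes_neg_bes]

theorem exists_restrict_L2 : ∃ π : H 1 0 →L[ℂ] L2, ∀ u, ofL2 (π u) = u.dist := by
  obtain ⟨S, hS⟩ := exists_clm_of_rangeL2 (bes (-1)) fun g =>
    fm_mem_rangeL2 (hasTemperateGrowth_besselSymbol (-1))
      (norm_besselSymbol_le (by norm_num : (-1 : ℝ) ≤ 0)) (ofL2_mem g)
  refine ⟨S ∘L ((H.iso 1 0).toContinuousLinearEquiv : H 1 0 →L[ℂ] L2), fun u => ?_⟩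
  change ofL2 (S (H.toL2 u)) = _
  rw [hS, H.dist_eq u, neg_zero, wt_zero]

theorem helm_zero_right (κ : ℂ) (u : Dist) : helm κ u = κ ^ 2 • u + helm 0 u := by
  rw [helm, helm]; module

section

variable {β : ℝ} {V : R3 → ℝ} {B A : R3 → R3}

/-- A solution of `(-Δ + W_P + κ²) u = f` in `H^{1,0}` solves the Lippmann-Schwinger equation. -/
theorem lippmann_eq_of_helm_eq (hβ : 5 < β) (hVB : FieldAssumption β V B)
    (hA : IsVectorPotential β B A) {κ : ℂ} (hκ : 0 < κ.re) {a b : ℝ} (h : Fits β a b)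
    {u : H 1 0} {u' : H 1 a} {f : H (-1) b} (hu : u'.dist = u.dist)
    (hf : helm κ u.dist + (pert β V B A 0 u).dist = f.dist) :
    lippmann V B A κ h.le u' = free κ b a f := by
  apply H.dist_injective
  apply helm_injective hκ
  rw [dist_lippmann, helm_add, helm_free hκ.le h.adm, helm_free hκ.le h.adm, ← hf, hu, dist_pertTo,
    pert_compat (by linarith) hVB hA hu]

/-- The weighted resolvent T = M R_0(κ) is defined only on H^{-1,b}. The formula R = R_0 - T W_P R_0
extends it to H^{-1,0}, because W_P maps H^{1,0} into H^{-1,b}. -/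
theorem exists_solution (hβ : 5 < β) (hVB : FieldAssumption β V B)
    (hA : IsVectorPotential β B A) {κ : ℂ} (hκ : 0 < κ.re) {a b : ℝ} (h : Fits β a b)
    {M : H 1 a →L[ℂ] H 1 a} (hM : IsInverse M (lippmann V B A κ h.le)) :
    ∃ R : H (-1) 0 →L[ℂ] H 1 0, ∀ f,
      helm κ (R f).dist + (pert β V B A 0 (R f)).dist = f.dist := by
  obtain ⟨R₀, hR₀⟩ := exists_free_unweighted hκ
  have hb0 : 0 ≤ b := by linarith [h.adm.left]
  have hbβ : b ≤ 0 + β := by linarith [h.le, h.adm.right]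
  have hab : a ≤ 0 := by linarith [h.adm.right]
  set T := M ∘L free κ b a with hT
  set W := pertTo V B A h.le
  set W₀ := pertTo V B A hbβ
  set J : H (-1) b →L[ℂ] H (-1) 0 := H.incl hb0
  -- T takes values in the larger space H^{1,a}. Rewriting it as R_0 - R_0 W_P T with the unweighted
  -- free resolvent shows that the same distribution lies in H^{1,0}.
  set T' : H (-1) b →L[ℂ] H 1 0 := R₀ ∘L J - R₀ ∘L J ∘L W ∘L T with hT'
  have hfree : ∀ g, (R₀ (J g)).dist = (free κ b a g).dist := fun g => by
    apply helm_injective hκ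
    rw [hR₀, helm_free hκ.le h.adm]
    rfl
  have hTT : ∀ g, (T' g).dist = (T g).dist := fun g => by
    have h1 : (T g).dist + (free κ b a (W (T g))).dist = (free κ b a g).dist :=
      congrArg H.dist (hM.apply_right (free κ b a g))
    have h2 : (T' g).dist = (R₀ (J g)).dist - (R₀ (J (W (T g)))).dist := rfl
    rw [h2, hfree, hfree, ← h1, add_sub_cancel_right]
  refine ⟨R₀ - T' ∘L W₀ ∘L R₀, fun f => ?_⟩
  set g := W₀ (R₀ f) with hg
  set u := (R₀ - T' ∘L W₀ ∘L R₀) f with hu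
  have hud : u = R₀ f - T' g := rfl
  have h1 : u.dist = (R₀ f).dist - (T' g).dist := rfl
  have h2 : (T' g).dist = (R₀ (J g)).dist - (R₀ (J (W (T g)))).dist := rfl
  have h3 : (pert β V B A 0 u).dist = g.dist - (W (T g)).dist := by
    rw [hud, map_sub]
    change (pert β V B A 0 (R₀ f)).dist - (pert β V B A 0 (T' g)).dist = _
    rw [pert_compat (by linarith) hVB hA (hTT g)]
    rfl
  rw [h3, h1, helm_sub, hR₀, h2, helm_sub, hR₀, hR₀]
  change f.dist - (g.dist - (W (T g)).dist) + _ = _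
  abel

/-- Off the spectrum the resolvent exists, and it extends to the weighted spaces. -/
theorem exists_isPauliResolvent (hβ : 5 < β) (hVB : FieldAssumption β V B)
    (hA : IsVectorPotential β B A) {κ : ℂ} (hκ : 0 < κ.re) {a b : ℝ} (h : Fits β a b)
    {M : H 1 a →L[ℂ] H 1 a} (hM : IsInverse M (lippmann V B A κ h.le)) :
    ∃ R : L2 →L[ℂ] L2, IsPauliResolvent V A κ R ∧
      ∀ (g : L2) (f : H (-1) b), f.dist = ofL2 g →
        (M (free κ b a f)).dist = ofL2 (R g) := by
  have hβ0 : 0 ≤ β := by linarith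
  have ha0 : a ≤ 0 := by linarith [h.adm.right]
  obtain ⟨ι, hι⟩ := exists_embed_L2
  obtain ⟨π, hπ⟩ := exists_restrict_L2
  obtain ⟨R, hR⟩ := exists_solution hβ hVB hA hκ h hM
  -- A difference of two solutions lies in H^{1,0} ⊂ H^{1,a} and solves the homogeneous
  -- Lippmann-Schwinger equation, so M annihilates it.
  have hunique : ∀ u u' : H 1 0, helm κ u.dist + (pert β V B A 0 u).dist =
      helm κ u'.dist + (pert β V B A 0 u').dist → u = u' := by
    intro u u' huu
    have h1 : helm κ (u - u').dist + (pert β V B A 0 (u - u')).dist = (0 : H (-1) b).dist := by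
      rw [map_sub]
      change helm κ (u.dist - u'.dist) + ((pert β V B A 0 u).dist - (pert β V B A 0 u').dist) = 0
      rw [helm_sub, sub_add_sub_comm, huu, sub_self]
    have h2 := lippmann_eq_of_helm_eq hβ hVB hA hκ h (H.dist_incl ha0 (u - u')) h1
    rw [map_zero] at h2
    have h3 := hM.apply_left (H.incl ha0 (u - u'))
    rw [h2, map_zero] at h3
    exact sub_eq_zero.1 (H.dist_injective (congrArg H.dist h3).symm)
  refine ⟨π ∘L R ∘L ι, ⟨fun g => ?_, fun u v huv => ?_⟩, fun g f hf => ?_⟩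
  · set u := R (ι g) with hu
    have h1 := hR (ι g)
    rw [hι, ← hu, helm_zero_right] at h1
    have h2 : ofL2 ((π ∘L R ∘L ι) g) = u.dist := hπ u
    refine ⟨h2 ▸ u.mem, ?_⟩
    rw [map_sub, map_smul, h2, isPauli_pert_iff hβ0 hVB hA, ← h1]
    abel
  · obtain ⟨hu, hp⟩ := huv
    set U : H 1 0 := ⟨ofL2 u, hu⟩ with hU
    have h1 : ofL2 v = helm 0 U.dist + (pert β V B A 0 U).dist :=
      (isPauli_pert_iff (u := U) hβ0 hVB hA).1 hp
    have h2 : R (ι (v + κ ^ 2 • u)) = U := by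
      apply hunique
      rw [hR, hι, map_add, map_smul, h1, helm_zero_right κ]
      change _ + κ ^ 2 • U.dist = _
      abel
    apply ofL2_injective
    change ofL2 (π (R (ι _))) = _
    rw [h2, hπ]
  · change _ = ofL2 (π (R (ι g)))
    have h1 := hR (ι g)
    rw [hι, ← hf] at h1
    have h2 := lippmann_eq_of_helm_eq hβ hVB hA hκ h (H.dist_incl ha0 (R (ι g))) h1
    rw [hπ, ← h2, hM.apply_left, H.dist_incl]

end

/-! ### The coefficients of the expansion -/

section

variable {β : ℝ} {V : R3 → ℝ} {B A : R3 → R3}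

theorem H.norm_incl_le {k s t : ℝ} (h : t ≤ s) : ‖(H.incl h : H k s →L[ℂ] H k t)‖ ≤ 1 :=
  LinearMap.mkContinuous_norm_le _ zero_le_one _

/-- The exponent at which the expansion is carried out. -/
def scale (β s : ℝ) : ℝ := min s (β / 2)

theorem scale_le (β s : ℝ) : scale β s ≤ s := min_le_left _ _

theorem scale_fits_le (β s : ℝ) : scale β s ≤ -scale β s + β := by
  have : scale β s ≤ β / 2 := min_le_right _ _
  linarith

/-- Capping the exponent at β/2 gives t ≤ β - t. Then W_P maps H^{1,-t} into H^{-1,t}, and a single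
pair of spaces carries the whole expansion. As β > 5, the capped exponent still exceeds 5/2 whenever
s does. -/
theorem fits_scale (hβ : 5 < β) {s : ℝ} (hs : 1 < s) : Fits β (-scale β s) (scale β s) :=
  ⟨admissible_neg (lt_min hs (by linarith)), scale_fits_le β s⟩

theorem fits_left (hβ : 5 < β) {t : ℝ} (h1 : 1 < t) (h2 : t < β - 1 / 2) :
    Fits β (-t) (β - t) :=
  ⟨⟨by linarith, by linarith, by linarith⟩, by linarith⟩

theorem fits_right (hβ : 5 < β) {t : ℝ} (h1 : 1 < t) (h2 : t < β - 1 / 2) :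
    Fits β (t - β) t :=
  ⟨⟨by linarith, by linarith, by linarith⟩, by linarith⟩

/-- `(I + G_0 W_P)⁻¹ G_0`, given the inverse. -/
def coeffZero {β s : ℝ} (Q : H 1 (-scale β s) →L[ℂ] H 1 (-scale β s)) : H (-1) s →L[ℂ] H 1 (-s) :=
  H.incl (neg_le_neg (scale_le β s)) ∘L (Q ∘L free 0 (scale β s) (-scale β s)) ∘L
    H.incl (scale_le β s)

variable (V B A) in
/-- `(I + W_P G_0)⁻¹ = I - W_P (I + G_0 W_P)⁻¹ G_0`, given the inverse of `I + G_0 W_P`. -/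
def dualInv {a b : ℝ} (h : b ≤ a + β) (Q : H 1 a →L[ℂ] H 1 a) : H (-1) b →L[ℂ] H (-1) b :=
  ContinuousLinearMap.id ℂ (H (-1) b) - pertTo V B A h ∘L Q ∘L free 0 b a

variable (V B A) in
/-- `(I + G_0 W_P)⁻¹ G_1 (I + W_P G_0)⁻¹`, given the inverse of `I + G_0 W_P`. -/
def coeffOne {β s : ℝ} (Q : H 1 (-scale β s) →L[ℂ] H 1 (-scale β s)) : H (-1) s →L[ℂ] H 1 (-s) :=
  H.incl (neg_le_neg (scale_le β s)) ∘L (Q ∘L freeOne (scale β s) (-scale β s) ∘L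
    dualInv V B A (scale_fits_le β s) Q) ∘L H.incl (scale_le β s)

theorem isInverse_dualInv {a b : ℝ} {h : b ≤ a + β} {Q : H 1 a →L[ℂ] H 1 a}
    (hQ : IsInverse Q (lippmann V B A 0 h)) :
    IsInverse (dualInv V B A h Q)
      (ContinuousLinearMap.id ℂ (H (-1) b) + pertTo V B A h ∘L free 0 b a) :=
  IsInverse.swap hQ

/-- Both images are mapped to the same distribution by I + G_0 W_P, which is injective across
scales. Hence the coefficients can be formed on any admissible scale. -/
theorem inverse_compat (hβ : 5 < β) (hVB : FieldAssumption β V B) (hA : IsVectorPotential β B A)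
    (hreg : IsRegularPoint V A) {a b a' b' : ℝ} (h : Fits β a b) (h' : Fits β a' b')
    {Q : H 1 a →L[ℂ] H 1 a} {Q' : H 1 a' →L[ℂ] H 1 a'} (hQ : IsInverse Q (lippmann V B A 0 h.le))
    (hQ' : IsInverse Q' (lippmann V B A 0 h'.le)) {u : H 1 a} {u' : H 1 a'}
    (hu : u.dist = u'.dist) : (Q u).dist = (Q' u').dist := by
  refine eq_of_lippmann_eq hβ hVB hA hreg h h' ?_
  rw [hQ.apply_right, hQ'.apply_right, hu]

theorem dualInv_compat (hβ : 5 < β) (hVB : FieldAssumption β V B) (hA : IsVectorPotential β B A)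
    (hreg : IsRegularPoint V A) {a b a' b' : ℝ} (h : Fits β a b) (h' : Fits β a' b')
    {Q : H 1 a →L[ℂ] H 1 a} {Q' : H 1 a' →L[ℂ] H 1 a'} (hQ : IsInverse Q (lippmann V B A 0 h.le))
    (hQ' : IsInverse Q' (lippmann V B A 0 h'.le)) {g : H (-1) b} {g' : H (-1) b'}
    (hg : g.dist = g'.dist) :
    (dualInv V B A h.le Q g).dist = (dualInv V B A h'.le Q' g').dist := by
  refine eq_of_dual_lippmann_eq hβ hVB hA hreg h h' ?_
  have h1 := (isInverse_dualInv hQ).apply_right g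
  have h2 := (isInverse_dualInv hQ').apply_right g'
  rw [add_apply, ContinuousLinearMap.id_apply, ContinuousLinearMap.comp_apply] at h1 h2
  rw [h1, h2, hg]

theorem isLeftInv_of_isInverse (hβ : 5 < β) (hVB : FieldAssumption β V B)
    (hA : IsVectorPotential β B A) {t : ℝ} (h : Fits β (-t) (β - t))
    {Q : H 1 (-t) →L[ℂ] H 1 (-t)} (hQ : IsInverse Q (lippmann V B A 0 h.le)) :
    IsLeftInv β V B A t Q :=
  ⟨free 0 (β - t) (-t), pertTo V B A h.le, isFree_zero_free h.adm,
    isW_pertTo (by linarith) hVB hA h.le, hQ⟩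

theorem isRightInv_dualInv (hβ : 5 < β) (hVB : FieldAssumption β V B)
    (hA : IsVectorPotential β B A) {t : ℝ} (h : Fits β (t - β) t)
    {Q : H 1 (t - β) →L[ℂ] H 1 (t - β)} (hQ : IsInverse Q (lippmann V B A 0 h.le)) :
    IsRightInv β V B A t (dualInv V B A h.le Q) :=
  ⟨free 0 t (t - β), pertTo V B A h.le, isFree_zero_free h.adm,
    isW_pertTo (by linarith) hVB hA h.le, isInverse_dualInv hQ⟩

theorem isF0_coeffZero (hβ : 5 < β) (hVB : FieldAssumption β V B) (hA : IsVectorPotential β B A)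
    (hreg : IsRegularPoint V A) {s : ℝ} (hs : 1 < s)
    {Q : H 1 (-scale β s) →L[ℂ] H 1 (-scale β s)}
    (hQ : IsInverse Q (lippmann V B A 0 (scale_fits_le β s))) :
    IsF0 β V B A s (coeffZero Q) := by
  intro t hts h1 h2
  have h := fits_scale hβ hs
  have hl := fits_left hβ h1 h2
  obtain ⟨Qt, hQt⟩ := exists_isInverse_lippmann hβ hVB hA hreg hl
  refine ⟨free 0 t (-t), Qt, isFree_zero_free (admissible_neg h1),
    isLeftInv_of_isInverse hβ hVB hA hl hQt, ?_⟩
  ext1 f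
  apply H.dist_injective
  exact inverse_compat hβ hVB hA hreg h hl hQ hQt
    (free_compat le_rfl h.adm (admissible_neg h1) rfl)

/-- On the scale t the left inverse uses the pair (-t, β-t) and the right inverse the pair (t-β, t),
while `coeffOne` uses one pair for both. Compatibility of each of the three factors identifies the
products. -/
theorem isF1_coeffOne (hβ : 5 < β) (hVB : FieldAssumption β V B) (hA : IsVectorPotential β B A)
    (hreg : IsRegularPoint V A) {s : ℝ} (hs : 3 / 2 < s)
    {Q : H 1 (-scale β s) →L[ℂ] H 1 (-scale β s)}
    (hQ : IsInverse Q (lippmann V B A 0 (scale_fits_le β s))) :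
    IsF1 β V B A s (coeffOne V B A Q) := by
  intro t hts h1 h2
  have h := fits_scale hβ (s := s) (by linarith)
  have hs' : 3 / 2 < scale β s := lt_min hs (by linarith)
  have hl := fits_left hβ (t := t) (by linarith) h2
  have hr := fits_right hβ (t := t) (by linarith) h2
  obtain ⟨Qt, hQt⟩ := exists_isInverse_lippmann hβ hVB hA hreg hl
  obtain ⟨Qr, hQr⟩ := exists_isInverse_lippmann hβ hVB hA hreg hr
  refine ⟨freeOne t (-t), Qt, dualInv V B A hr.le Qr, isFree_one_freeOne h1 (by linarith),
    isLeftInv_of_isInverse hβ hVB hA hl hQt, isRightInv_dualInv hβ hVB hA hr hQr, ?_⟩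
  ext1 f
  apply H.dist_injective
  refine inverse_compat hβ hVB hA hreg h hl hQ hQt
    (freeOne_compat hs' (by linarith) h1 (by linarith) ?_)
  exact dualInv_compat hβ hVB hA hreg h hr hQ hQr rfl

theorem exists_resolvent_expansion (hβ : 5 < β) (hVB : FieldAssumption β V B)
    (hA : IsVectorPotential β B A) {s : ℝ} (hs : 5 / 2 < s)
    {Q : H 1 (-scale β s) →L[ℂ] H 1 (-scale β s)}
    (hQ : IsInverse Q (lippmann V B A 0 (scale_fits_le β s))) :
    ∃ δ > (0 : ℝ), ∃ C : ℝ, ∀ κ : ℂ, 0 < κ.re → ‖κ‖ < δ →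
      ∃ (R : L2 →L[ℂ] L2) (T : H (-1) s →L[ℂ] H 1 (-s)),
        IsPauliResolvent V A κ R ∧ IsExtension R T ∧
        ‖T - (coeffZero Q + κ • coeffOne V B A Q)‖ ≤ C * ‖κ‖ ^ 2 := by
  have h := fits_scale hβ (s := s) (by linarith)
  obtain ⟨C, hC, hfree⟩ := exists_norm_free_expansion_le (s := scale β s)
    (lt_min hs (by linarith))
  obtain ⟨δ, hδ, hδ1, D, hD⟩ := exists_inverse_expansion hQ (G₁ := freeOne (scale β s) (-scale β s))
    hC
  refine ⟨δ, hδ, D, fun κ hκ hκδ => ?_⟩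
  obtain ⟨M, hM, hMD⟩ := hD κ (free κ (scale β s) (-scale β s)) hκδ
    (hfree κ hκ.le (hκδ.le.trans hδ1))
  obtain ⟨R, hR, hext⟩ := exists_isPauliResolvent hβ hVB hA hκ h hM
  set I₁ : H 1 (-scale β s) →L[ℂ] H 1 (-s) := H.incl (neg_le_neg (scale_le β s)) with hI₁
  set I₂ : H (-1) s →L[ℂ] H (-1) (scale β s) := H.incl (scale_le β s) with hI₂
  refine ⟨R, I₁ ∘L (M ∘L free κ (scale β s) (-scale β s)) ∘L I₂, hR, fun g f hf => ?_, ?_⟩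
  · exact hext g (I₂ f) hf
  · have e : I₁ ∘L (M ∘L free κ (scale β s) (-scale β s)) ∘L I₂ -
        (coeffZero Q + κ • coeffOne V B A Q) =
        I₁ ∘L (M ∘L free κ (scale β s) (-scale β s) - (Q ∘L free 0 (scale β s) (-scale β s) +
          κ • Q ∘L freeOne (scale β s) (-scale β s) ∘L
            dualInv V B A (scale_fits_le β s) Q)) ∘L I₂ := by
      ext1 f
      simp only [coeffZero, coeffOne, sub_apply, add_apply, smul_apply,
        ContinuousLinearMap.comp_apply, map_sub, map_add, map_smul, hI₁, hI₂]
    rw [e]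
    set E := M ∘L free κ (scale β s) (-scale β s) - (Q ∘L free 0 (scale β s) (-scale β s) +
          κ • Q ∘L freeOne (scale β s) (-scale β s) ∘L
            dualInv V B A (scale_fits_le β s) Q) with hE
    calc ‖I₁ ∘L E ∘L I₂‖ ≤ ‖I₁‖ * (‖E‖ * ‖I₂‖) :=
          (ContinuousLinearMap.opNorm_comp_le _ _).trans
            (mul_le_mul_of_nonneg_left (ContinuousLinearMap.opNorm_comp_le _ _) (norm_nonneg _))
      _ ≤ 1 * (‖E‖ * 1) := by
          gcongr
          · exact H.norm_incl_le _
          · exact H.norm_incl_le _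
      _ = ‖E‖ := by ring
      _ ≤ D * ‖κ‖ ^ 2 := hMD

end

end PauliThreshold

end

theorem theorem6p2 (β : ℝ) (hβ : 5 < β) (V : R3 → ℝ) (B A : R3 → R3)
    (hVB : FieldAssumption β V B) (hA : IsVectorPotential β B A) (hreg : IsRegularPoint V A) :
    ∃ F₀ F₁ : ∀ s : ℝ, H (-1) s →L[ℂ] H 1 (-s),
      (∀ s : ℝ, 1 < s → IsF0 β V B A s (F₀ s)) ∧
      (∀ s : ℝ, 3 / 2 < s → IsF1 β V B A s (F₁ s)) ∧
      ∀ s : ℝ, 5 / 2 < s → ∃ δ > (0 : ℝ), ∃ C : ℝ, ∀ κ : ℂ, 0 < κ.re → ‖κ‖ < δ →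
        ∃ (R : L2 →L[ℂ] L2) (T : H (-1) s →L[ℂ] H 1 (-s)),
          IsPauliResolvent V A κ R ∧ IsExtension R T ∧
          ‖T - (F₀ s + κ • F₁ s)‖ ≤ C * ‖κ‖ ^ 2 := by
  have hex : ∀ s : ℝ, ∃ Q : H 1 (-scale β s) →L[ℂ] H 1 (-scale β s),
      1 < s → IsInverse Q (lippmann V B A 0 (scale_fits_le β s)) := by
    intro s
    by_cases hs : 1 < s
    · obtain ⟨Q, hQ⟩ := exists_isInverse_lippmann hβ hVB hA hreg (fits_scale hβ hs)
      exact ⟨Q, fun _ => hQ⟩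
    -- The families are indexed by all real s, but nothing is claimed for s ≤ 1, so any operator
    -- serves there.
    · exact ⟨0, fun h => absurd h hs⟩
  choose Q hQ using hex
  exact ⟨fun s => coeffZero (Q s), fun s => coeffOne V B A (Q s),
    fun s hs => isF0_coeffZero hβ hVB hA hreg hs (hQ s hs),
    fun s hs => isF1_coeffOne hβ hVB hA hreg hs (hQ s (by linarith)),
    fun s hs => exists_resolvent_expansion hβ hVB hA hs (hQ s (by linarith))⟩
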